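/- Let $n\ge 2$ and let $\Omega\subseteq\mathbb R^n$ be a nonempty open set. Then there is $u\in SBD(\Omega)\cap L^\infty(\Omega;\mathbb R^n)$ such that $$e(u)=0\quad \mathcal L^n\text{-a.e. in }\Omega,\qquad \mathcal H^{n-1}(J_u)=\infty,\qquad \nabla u\notin L^1(\Omega;\mathbb R^{n\times n}),$$ and moreover $u\notin GBV(\Omega;\mathbb R^n)$. Here $u\in BD(\Omega)$ means that $u\in L^1(\Omega;\mathbb R^n)$ and the symmetrized distributional gradient $Eu=(Du+Du^T)/2$ is a bounded Radon measure on $\Omega$; $e(u)$ is the density of the absolutely continuous part of $Eu$ with respect to Lebesgue measure $\mathcal L^n$, and $E^su$ is the singular part of $Eu$. The jump set $J_u$ is the set of $x\in\Omega$ for which there are $a\neq b$ in $\mathbb R^n$ and a unit vector $\nu$ such that the mean of $|u-a|$ over $\{y\in B_r(x):(y-x)\cdot\nu>0\}$ and the mean of $|u-b|$ over $\{y\in B_r(x):(y-x)\cdot\nu<0\}$ tend to $0$ as $r\to0^+$. The Cantor part $E^cu$ is the restriction of $E^su$ to $\Omega\setminus J_u$, and $SBD(\Omega)=\{u\in BD(\Omega):E^cu=0\}$.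 The matrix $\nabla u(x)$ is the approximate gradient of $u$ at $x$, i.e. for some $z\in\mathbb R^n$ the mean of $|u(y)-z-\nabla u(x)(y-x)|/r$ over $y\in B_r(x)$ tends to $0$ as $r\to0^+$; it exists for $\mathcal L^n$-a.e. $x\in\Omega$. Finally, $u\in GBV(\Omega;\mathbb R^n)$ means that $u$ is measurable and $\varphi\circ u\in BV_{\mathrm{loc}}(\Omega)$ for every $\varphi\in C^1(\mathbb R^n)$ whose gradient has compact support. -/

import Mathlib

open MeasureTheory Filter Topology
open scoped ContDiff

/-- Euclidean space `ℝⁿ` with the Euclidean norm and Lebesgue measure. -/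
abbrev Rn (n : ℕ) : Type := EuclideanSpace ℝ (Fin n)

/-- `φ ∈ C_c^∞(Ω)`. -/
structure IsTestFunction {n : ℕ} (Ω : Set (Rn n)) (φ : Rn n → ℝ) : Prop where
  smooth : ContDiff ℝ ∞ φ
  compact : HasCompactSupport φ
  support : tsupport φ ⊆ Ω

/-- The partial derivative `∂ᵢφ(x)` (used for differentiable `φ` only). -/
noncomputable def partialDeriv {n : ℕ} (i : Fin n) (φ : Rn n → ℝ) (x : Rn n) : ℝ :=
  fderiv ℝ φ x (EuclideanSpace.single i 1)

/-- `E = (E i j)` is the symmetrized distributional gradient `Eu = (Du + Duᵀ)/2` of `u` on the open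
set `Ω`, and it is a bounded (signed, matrix-valued) Radon measure on `Ω`. A measure on `Ω` is
represented by a measure on `ℝⁿ` which does not charge the complement of `Ω`; signed measures are
finite by definition. For `u ∈ L¹(Ω)` such an `E` is unique. -/
structure IsStrainMeasure {n : ℕ} (Ω : Set (Rn n)) (u : Rn n → Rn n)
    (E : Fin n → Fin n → SignedMeasure (Rn n)) : Prop where
  concentrated : ∀ i j, (E i j).totalVariation Ωᶜ = 0
  integral_eq : ∀ φ : Rn n → ℝ, IsTestFunction Ω φ → ∀ i j,
    ∫ x in Ω, (u x i * partialDeriv j φ x + u x j * partialDeriv i φ x) / 2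
      = - ∫ᵛ x, φ x ∂<•(E i j)

/-- `u ∈ BD(Ω)`, with strain measure `Eu = E`. -/
structure IsBD {n : ℕ} (Ω : Set (Rn n)) (u : Rn n → Rn n)
    (E : Fin n → Fin n → SignedMeasure (Rn n)) : Prop where
  integrable : IntegrableOn u Ω
  strain : IsStrainMeasure Ω u E

/-- `a` is the one-sided approximate limit of `u` at `x` in the direction `ν`: the mean of
`|u - a|` over the half ball `{y ∈ B_r(x) : (y - x) · ν > 0}` tends to `0` as `r → 0⁺`. -/
def IsOneSidedApproxLimit {n : ℕ} (u : Rn n → Rn n) (x ν a : Rn n) : Prop :=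
  Tendsto (fun r : ℝ => ⨍⁻ y in {y ∈ Metric.ball x r | 0 < inner ℝ (y - x) ν}, ‖u y - a‖ₑ ∂volume)
    (𝓝[>] 0) (𝓝 0)

/-- The (approximate) jump set `J_u ⊆ Ω`: the points at which `u` has two distinct one-sided
approximate limits `a`, `b` with respect to a unit vector `ν`. -/
def jumpSet {n : ℕ} (Ω : Set (Rn n)) (u : Rn n → Rn n) : Set (Rn n) :=
  {x ∈ Ω | ∃ a b ν : Rn n, a ≠ b ∧ ‖ν‖ = 1 ∧
    IsOneSidedApproxLimit u x ν a ∧ IsOneSidedApproxLimit u x (-ν) b}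

/-- The density `e(u)` of the absolutely continuous part of the strain measure `E = Eu` with respect
to Lebesgue measure. -/
noncomputable def strainDensity {n : ℕ} (E : Fin n → Fin n → SignedMeasure (Rn n)) (x : Rn n) :
    Matrix (Fin n) (Fin n) ℝ :=
  Matrix.of fun i j => (E i j).rnDeriv volume x

/-- The singular part `Eˢu` of the strain measure `E = Eu` with respect to Lebesgue measure. -/
noncomputable def strainSingularPart {n : ℕ} (E : Fin n → Fin n → SignedMeasure (Rn n)) :
    Fin n → Fin n → SignedMeasure (Rn n) :=
  fun i j => (E i j).singularPart volume

/-- `u ∈ SBD(Ω)`, with strain measure `Eu = E`. The jump part and the Cantor part of `Eu` are the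
restrictions of `Eˢu` to `J_u` and to `Ω \ J_u`. So `Eᶜu = 0` says that `Ω \ J_u` is a null set of
(every component of) `|Eˢu|`. -/
structure IsSBD {n : ℕ} (Ω : Set (Rn n)) (u : Rn n → Rn n)
    (E : Fin n → Fin n → SignedMeasure (Rn n)) : Prop extends IsBD Ω u E where
  cantor_eq_zero : ∀ i j, (strainSingularPart E i j).totalVariation (Ω \ jumpSet Ω u) = 0

/-- `u` is approximately differentiable at `x` with approximate gradient `L`: for some
`z` (the approximate limit of `u` at `x`), the mean over `B_r(x)` of `|u(y) - z - L(y - x)| / r`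
tends to `0` as `r → 0⁺`. -/
def HasApproxGradientAt {n : ℕ} (u : Rn n → Rn n) (L : Rn n →L[ℝ] Rn n) (x : Rn n) : Prop :=
  ∃ z : Rn n, Tendsto
    (fun r : ℝ => ⨍⁻ y in Metric.ball x r, ‖u y - z - L (y - x)‖ₑ / ENNReal.ofReal r ∂volume)
    (𝓝[>] 0) (𝓝 0)

/-- `u` is approximately differentiable a.e. in `Ω`, and `∇u = G` a.e. in `Ω`. -/
def IsApproxGradient {n : ℕ} (Ω : Set (Rn n)) (u : Rn n → Rn n)
    (G : Rn n → Rn n →L[ℝ] Rn n) : Prop :=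
  ∀ᵐ x ∂volume.restrict Ω, HasApproxGradientAt u (G x) x

/-- `f ∈ BV(V)`: `f ∈ L¹(V)` and the distributional gradient of `f` on `V` is a bounded
(`ℝⁿ`-valued) Radon measure. The mass of `D` outside `V` plays no role. -/
def IsBV {n : ℕ} (V : Set (Rn n)) (f : Rn n → ℝ) : Prop :=
  IntegrableOn f V ∧ ∃ D : Fin n → SignedMeasure (Rn n),
    ∀ φ : Rn n → ℝ, IsTestFunction V φ → ∀ i,
      ∫ x in V, f x * partialDeriv i φ x = - ∫ᵛ x, φ x ∂<•(D i)

/-- `f ∈ BV_loc(Ω)`: `f ∈ BV(V)` for every open set `V` compactly contained in `Ω`. -/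
def IsBVLoc {n : ℕ} (Ω : Set (Rn n)) (f : Rn n → ℝ) : Prop :=
  ∀ V : Set (Rn n), IsOpen V → IsCompact (closure V) → closure V ⊆ Ω → IsBV V f

/-- `u ∈ GBV(Ω; ℝⁿ)`: `u` is measurable on `Ω` and `φ(u) ∈ BV_loc(Ω)` for every `φ ∈ C¹(ℝⁿ)` whose
gradient has compact support. -/
def IsGBV {n : ℕ} (Ω : Set (Rn n)) (u : Rn n → Rn n) : Prop :=
  AEStronglyMeasurable u (volume.restrict Ω) ∧
    ∀ φ : Rn n → ℝ, ContDiff ℝ 1 φ → HasCompactSupport (fderiv ℝ φ) →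
      IsBVLoc Ω (fun x => φ (u x))

/-! The field has only two nonzero components, `F` in direction `i` and `H` in direction `j`, both
built from tensor products of piecewise smooth functions of one variable. Their derivatives are an
absolutely continuous part plus jumps on hyperplanes `{x_l = t}`. The absolutely continuous strain
vanishes as soon as only `∂_j F` and `∂_i H` have densities and these are opposite, `a` and `-a`.
The field then rotates infinitesimally at almost every point. The heart of the matter is that `a`
can have large `L¹` norm while the jumps have small total mass (`exists_large_rotation`); this is
the failure of Korn's inequality in `L¹`, obtained by a staircase of laminates.

Start on a box of volume `V` with `∂_j F = ∂_i H = 1`. Suppose that both slopes equal `2^k` on a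
product set of volume `2⁻ᵏ V` and are opposite elsewhere. Add to `F` a sawtooth in `x_j` that
changes the slope to `2^(k+1)` on two thirds of this set and to `-2^k` on the rest, where it now
cancels `∂_i H`. Then add to `H` a sawtooth in `x_i` that changes its slope on the two thirds to
`2^(k+1)` on three quarters and to `-2^(k+1)` on the rest, where it cancels `∂_j F`. Half of the set
is left over, with slopes `2^(k+1)`, and `∫ |a|` outside the leftover set has grown by at least
`V/2` (`HasStage.succ`). Sawteeth are continuous in their own variable and jump only across lateral
faces, by their amplitude; finer teeth make this cost as small as desired. After `k` steps the slope
`2^k` on the leftover set is removed by descents with compensating jumps, of mass about `2^k · 2⁻ᵏ V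
= V` for each component. The cost stays bounded while `∫ |a| ≥ kV/2`, and scaling down gives small
cost with `∫ |a| ≥ 1`.

A large jump set is cheaper: a staircase function with many tiny steps has a jump set of area at
least one, which does not change when the function is scaled down (`exists_many_jumps`).

The two kinds of blocks, with size and cost `2⁻ᵐ`, alternate in disjoint dyadic cubes shrinking to a
point `x₀` of `Ω`. The sum is bounded with finite strain measure, but every second cube contributes
at least one to `∫ |∇u|` and to the variation of `D_j u_i`, and the others contribute at least one
to the area of the jump set. As `u` is bounded, a cutoff turns `GBV` into `BV_loc` of the component
`u_i`, a contradiction near `x₀`.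

The Cantor part is excluded by structure. All singular measures are absolutely continuous with
respect to area on countably many coordinate hyperplanes, so they do not charge points on two of
them. Near any other point `u` is `C¹` on both sides of one hyperplane, and integration by parts
shows that the strain there vanishes where the two traces agree, while points with different traces
are jump points (`totalVariation_diff_jumpSet_eq_zero`). -/

section SignedMeasures

/-! ### Differences of finite measures as signed measures -/

variable {X : Type*} [MeasurableSpace X]

/-- The integral against a difference of two finite measures. -/
theorem integral_toSignedMeasure_sub (P N : Measure X) [IsFiniteMeasure P] [IsFiniteMeasure N]
    {f : X → ℝ} (hP : Integrable f P) (hN : Integrable f N) :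
    ∫ᵛ x, f x ∂<•(P.toSignedMeasure - N.toSignedMeasure) = ∫ x, f x ∂P - ∫ x, f x ∂N := by
  rw [VectorMeasure.integral_sub_vectorMeasure, VectorMeasure.integral_toSignedMeasure,
    VectorMeasure.integral_toSignedMeasure]
  · simpa [VectorMeasure.Integrable, Measure.variation_toSignedMeasure] using hP
  · simpa [VectorMeasure.Integrable, Measure.variation_toSignedMeasure] using hN

theorem integral_signedMeasure_eq_jordan (D : SignedMeasure X) {f : X → ℝ}
    (hP : Integrable f D.toJordanDecomposition.posPart)
    (hN : Integrable f D.toJordanDecomposition.negPart) :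
    ∫ᵛ x, f x ∂<•D = ∫ x, f x ∂D.toJordanDecomposition.posPart
      - ∫ x, f x ∂D.toJordanDecomposition.negPart := by
  rw [← integral_toSignedMeasure_sub _ _ hP hN]
  conv_lhs => rw [← SignedMeasure.toSignedMeasure_toJordanDecomposition D]
  rfl

/-- A signed measure vanishing on all measurable subsets of `S` has no total variation on `S`. -/
theorem totalVariation_eq_zero_of_forall_subset (D : SignedMeasure X) {S : Set X}
    (hS : MeasurableSet S) (h : ∀ S' ⊆ S, MeasurableSet S' → D S' = 0) :
    D.totalVariation S = 0 := by
  obtain ⟨i, hi, hi₂, hi₃, hpos, hneg⟩ := D.toJordanDecomposition_spec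
  rw [SignedMeasure.totalVariation, Measure.add_apply, hpos, hneg,
    SignedMeasure.toMeasureOfZeroLE_apply _ _ _ hS, SignedMeasure.toMeasureOfLEZero_apply _ _ _ hS]
  simp [h _ Set.inter_subset_right (hi.inter hS), h _ Set.inter_subset_right (hi.compl.inter hS)]

/-- `P` and `N` need not be mutually singular, so they are not the Jordan parts of the difference,
and `P S = N S` alone would not suffice. Equality on all measurable subsets is what kills both
Jordan parts. -/
theorem totalVariation_sub_eq_zero (P N : Measure X) [IsFiniteMeasure P] [IsFiniteMeasure N]
    {S : Set X} (hS : MeasurableSet S) (h : ∀ S' ⊆ S, MeasurableSet S' → P S' = N S') :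
    (P.toSignedMeasure - N.toSignedMeasure).totalVariation S = 0 := by
  refine totalVariation_eq_zero_of_forall_subset _ hS fun S' hS' hm ↦ ?_
  simp [hm, measureReal_def, h S' hS' hm]

/-- A signed measure concentrated on a null set has zero density, and is its own singular part. -/
theorem rnDeriv_eq_zero_of_concentrated (D : SignedMeasure X) (μ : Measure X) [SigmaFinite μ]
    {S : Set X} (hS : MeasurableSet S) (h : D.totalVariation Sᶜ = 0) (hμ : μ S = 0) :
    D.rnDeriv μ =ᵐ[μ] 0 ∧ D.singularPart μ = D := by
  have hm : D ⟂ᵥ μ.toENNRealVectorMeasure := by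
    rw [SignedMeasure.mutuallySingular_ennreal_iff, VectorMeasure.ennrealToMeasure_toENNRealVectorMeasure]
    exact ⟨Sᶜ, hS.compl, h, by simpa using hμ⟩
  have h0 : D = D + μ.withDensityᵥ (0 : X → ℝ) := by simp
  exact ⟨(SignedMeasure.eq_rnDeriv D 0 (integrable_zero _ _ _) hm h0).symm,
    (SignedMeasure.eq_singularPart D 0 hm h0).symm⟩

end SignedMeasures

/-! ### Measures determined by test functions -/

theorem IsTestFunction.integrable {n : ℕ} {Ω : Set (Rn n)} {φ : Rn n → ℝ}
    (hφ : IsTestFunction Ω φ) (μ : Measure (Rn n)) [IsFiniteMeasureOnCompacts μ] :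
    Integrable φ μ :=
  hφ.smooth.continuous.integrable_of_hasCompactSupport hφ.compact

/-- Two finite measures with the same integrals of all test functions on `U` agree in `U`. -/
theorem measure_eq_of_integral_testFunction_eq {n : ℕ} {U : Set (Rn n)} (hU : IsOpen U)
    (μ ν : Measure (Rn n)) [IsFiniteMeasure μ] [IsFiniteMeasure ν]
    (h : ∀ φ, IsTestFunction U φ → ∫ x, φ x ∂μ = ∫ x, φ x ∂ν) {S : Set (Rn n)}
    (hSU : S ⊆ U) (hS : MeasurableSet S) : μ S = ν S := by
  set σ := μ + ν with hσ
  have : IsFiniteMeasure σ := hσ ▸ inferInstance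
  have : μ.HaveLebesgueDecomposition σ := Measure.haveLebesgueDecomposition_of_sigmaFinite _ _
  have : ν.HaveLebesgueDecomposition σ := Measure.haveLebesgueDecomposition_of_sigmaFinite _ _
  have hμ : μ ≪ σ := Measure.AbsolutelyContinuous.rfl.add_right ν
  have hν : ν ≪ σ := by
    simp only [σ, add_comm μ ν]; exact Measure.AbsolutelyContinuous.rfl.add_right μ
  -- Both measures have densities with respect to `σ = μ + ν`. The fundamental lemma of the calculus
  -- of variations, with `σ` as reference measure, shows that the densities agree `σ`-a.e. in `U`.
  set f : Rn n → ℝ := fun x ↦ (μ.rnDeriv σ x).toReal - (ν.rnDeriv σ x).toReal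
  have i1 : Integrable (fun x ↦ (μ.rnDeriv σ x).toReal) σ := Measure.integrable_toReal_rnDeriv
  have i2 : Integrable (fun x ↦ (ν.rnDeriv σ x).toReal) σ := Measure.integrable_toReal_rnDeriv
  have hf : ∀ᵐ x ∂σ, x ∈ U → f x = 0 := by
    refine hU.ae_eq_zero_of_integral_contDiff_smul_eq_zero
      ((i1.sub i2).locallyIntegrable.locallyIntegrableOn U) fun g hg hg' hgU ↦ ?_
    have hT : IsTestFunction U g := ⟨hg, hg', hgU⟩
    have e1 := integral_rnDeriv_smul (f := g) hμ
    have e2 := integral_rnDeriv_smul (f := g) hν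
    have j1 : Integrable (fun x ↦ (μ.rnDeriv σ x).toReal • g x) σ :=
      (integrable_rnDeriv_smul_iff hμ).2 (hT.integrable μ)
    have j2 : Integrable (fun x ↦ (ν.rnDeriv σ x).toReal • g x) σ :=
      (integrable_rnDeriv_smul_iff hν).2 (hT.integrable ν)
    calc ∫ x, g x • f x ∂σ
        = ∫ x, ((μ.rnDeriv σ x).toReal • g x - (ν.rnDeriv σ x).toReal • g x) ∂σ := by
          congr 1; ext x; simp [f]; ring
      _ = 0 := by rw [integral_sub j1 j2, e1, e2, h g hT, sub_self]
  rw [← Measure.setLIntegral_rnDeriv hμ, ← Measure.setLIntegral_rnDeriv hν]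
  refine setLIntegral_congr_fun_ae hS ?_
  filter_upwards [hf, μ.rnDeriv_lt_top σ, ν.rnDeriv_lt_top σ] with x hx h1 h2 hxS
  have := hx (hSU hxS)
  exact (ENNReal.toReal_eq_toReal_iff' h1.ne h2.ne).1 (sub_eq_zero.1 this)

/-! ### Fubini along a coordinate, area on hyperplanes, weak partial derivatives -/

section Slab
open scoped ENNReal

variable {n : ℕ}

/-- The point `y` with its `l`-th coordinate replaced by `s`. -/
noncomputable def setCoord (l : Fin n) (s : ℝ) (y : Rn n) : Rn n :=
  y + (s - y l) • EuclideanSpace.single l 1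

@[simp] theorem setCoord_same (l : Fin n) (s : ℝ) (y : Rn n) : setCoord l s y l = s := by
  simp [setCoord]

theorem setCoord_ne {l m : Fin n} (h : m ≠ l) (s : ℝ) (y : Rn n) : setCoord l s y m = y m := by
  simp [setCoord, h]

theorem continuous_setCoord (l : Fin n) :
    Continuous fun p : Rn n × ℝ ↦ setCoord l p.2 p.1 := by
  unfold setCoord; fun_prop

theorem continuous_setCoord_const (l : Fin n) (t : ℝ) : Continuous (setCoord (n := n) l t) := by
  unfold setCoord; fun_prop

/-- The slab `{0 < y_l < 1}`. -/
def slab (l : Fin n) : Set (Rn n) := {y | y l ∈ Set.Ioo (0 : ℝ) 1}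

theorem measurableSet_slab (l : Fin n) : MeasurableSet (slab l) :=
  measurableSet_Ioo.preimage (by fun_prop : Measurable fun y : Rn n ↦ y l)

/-- Lebesgue measure on the slab `{0 < y_l < 1}`. -/
noncomputable abbrev slabMeasure (l : Fin n) : Measure (Rn n) := volume.restrict (slab l)

/-- Tonelli's theorem in the `l`-th coordinate, the other coordinates being parametrized by a slab
of unit width. -/
theorem lintegral_slab (l : Fin n) {f : Rn n → ℝ≥0∞} (hf : Measurable f) :
    ∫⁻ y, ∫⁻ s, f (setCoord l s y) ∂(volume : Measure ℝ) ∂(slabMeasure l) = ∫⁻ x, f x := by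
  set e : Rn n := EuclideanSpace.single l 1 with he
  have hel : e l = 1 := by simp [he]
  calc ∫⁻ y, ∫⁻ s, f (setCoord l s y) ∂(volume : Measure ℝ) ∂(slabMeasure l)
      = ∫⁻ y, ∫⁻ s : ℝ, (slab l).indicator 1 y * f (y + s • e) := by
        rw [← lintegral_indicator (measurableSet_slab l)]
        refine lintegral_congr fun y ↦ ?_
        by_cases hy : y ∈ slab l
        · simp only [hy, Set.indicator_of_mem, Pi.one_apply, one_mul]
          exact lintegral_sub_right_eq_self (fun s ↦ f (y + s • e)) (y l)
        · simp [hy]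
    _ = ∫⁻ s : ℝ, ∫⁻ y, (slab l).indicator 1 y * f (y + s • e) := by
        refine lintegral_lintegral_swap (Measurable.aemeasurable ?_)
        refine Measurable.mul ?_ (hf.comp (by fun_prop))
        exact (measurable_one.indicator (measurableSet_slab l)).comp measurable_fst
    _ = ∫⁻ s : ℝ, ∫⁻ z, (slab l).indicator 1 (z - s • e) * f z := by
        refine lintegral_congr fun s ↦ ?_
        rw [← lintegral_sub_right_eq_self _ (s • e)]
        simp
    _ = ∫⁻ z, ∫⁻ s : ℝ, (slab l).indicator 1 (z - s • e) * f z := by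
        refine lintegral_lintegral_swap (Measurable.aemeasurable ?_)
        refine Measurable.mul ?_ (hf.comp measurable_snd)
        exact (measurable_one.indicator (measurableSet_slab l)).comp (by fun_prop)
    _ = ∫⁻ z, f z := by
        refine lintegral_congr fun z ↦ ?_
        have hmz : Measurable fun s : ℝ ↦ (slab l).indicator (1 : Rn n → ℝ≥0∞) (z - s • e) :=
          (measurable_one.indicator (measurableSet_slab l)).comp (by fun_prop)
        rw [lintegral_mul_const _ hmz]
        -- For fixed `z` the shifts that bring `z` into the slab form an interval of length one, so
        -- the weight integrates to one. This is why the slab has unit width.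
        have : ∀ s : ℝ, (slab l).indicator (1 : Rn n → ℝ≥0∞) (z - s • e)
            = (Set.Ioo (z l - 1) (z l)).indicator 1 s := by
          intro s
          have : z - s • e ∈ slab l ↔ s ∈ Set.Ioo (z l - 1) (z l) := by
            simp only [slab, Set.mem_ofPred_eq, Set.mem_Ioo, PiLp.sub_apply, PiLp.smul_apply, hel,
              smul_eq_mul, mul_one]
            constructor <;> rintro ⟨h1, h2⟩ <;> constructor <;> linarith
          by_cases h : s ∈ Set.Ioo (z l - 1) (z l)
          · simp [this.2 h, h]
          · rw [Set.indicator_of_notMem h, Set.indicator_of_notMem (fun hh ↦ h (this.1 hh))]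
        simp_rw [this]
        rw [lintegral_indicator_one measurableSet_Ioo]
        simp

/-- The slab plays the role of `ℝⁿ⁻¹`: integration over it of a function independent of `y_l` is
integration over the other coordinates. This gives Fubini in one coordinate without leaving `Rn n`.
-/
theorem measurePreserving_setCoord (l : Fin n) :
    MeasurePreserving (fun p : Rn n × ℝ ↦ setCoord l p.2 p.1)
      ((slabMeasure l).prod volume) volume := by
  refine ⟨(continuous_setCoord l).measurable, ?_⟩
  ext S hS
  rw [Measure.map_apply (continuous_setCoord l).measurable hS,
    Measure.prod_apply ((continuous_setCoord l).measurable hS), ← lintegral_indicator_one hS,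
    ← lintegral_slab l (measurable_one.indicator hS)]
  refine lintegral_congr fun y ↦ ?_
  rw [← lintegral_indicator_one]
  · rfl
  · exact measurable_prodMk_left ((continuous_setCoord l).measurable hS)

theorem integrable_slab (l : Fin n) {f : Rn n → ℝ} (hf : Integrable f) :
    Integrable (fun p : Rn n × ℝ ↦ f (setCoord l p.2 p.1)) ((slabMeasure l).prod volume) :=
  (measurePreserving_setCoord l).integrable_comp_of_integrable hf

theorem integral_slab (l : Fin n) {f : Rn n → ℝ} (hf : Integrable f) :
    ∫ x, f x = ∫ y, ∫ s, f (setCoord l s y) ∂(volume : Measure ℝ) ∂(slabMeasure l) := by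
  rw [← (measurePreserving_setCoord l).map_eq, integral_map
    (continuous_setCoord l).measurable.aemeasurable, integral_prod _ (integrable_slab l hf)]
  rw [(measurePreserving_setCoord l).map_eq]; exact hf.1

/-- The `(n-1)`-dimensional area on the hyperplane `{y_l = t}`. -/
noncomputable def faceMeasure (l : Fin n) (t : ℝ) : Measure (Rn n) :=
  (slabMeasure l).map (setCoord l t)

/-- `P` gives no mass to the sets which have zero area on all hyperplanes `{y_l = t}`, `t ∈ T`. -/
def FaceAC (T : Set ℝ) (P : Measure (Rn n)) : Prop :=
  ∀ S, MeasurableSet S → (∀ l, ∀ t ∈ T, faceMeasure l t S = 0) → P S = 0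

theorem FaceAC.mono {T T' : Set ℝ} (h : T ⊆ T') {P : Measure (Rn n)} (hP : FaceAC T P) :
    FaceAC T' P := fun S hS h0 ↦ hP S hS fun l t ht ↦ h0 l t (h ht)

theorem FaceAC.add {T : Set ℝ} {P Q : Measure (Rn n)} (hP : FaceAC T P) (hQ : FaceAC T Q) :
    FaceAC T (P + Q) := fun S hS h0 ↦ by simp [hP S hS h0, hQ S hS h0]

/-- The weak partial derivative `∂_l F` is `g dx + P - N`, with measures `P`, `N` of mass at most
`C` on the grid of hyperplanes generated by `T`. -/
def IsWeakPartial (T : Set ℝ) (l : Fin n) (F g : Rn n → ℝ) (C : ℝ≥0∞) : Prop :=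
  ∃ P N : Measure (Rn n), IsFiniteMeasure P ∧ IsFiniteMeasure N ∧ P Set.univ ≤ C ∧
    N Set.univ ≤ C ∧ FaceAC T P ∧ FaceAC T N ∧
    ∀ φ : Rn n → ℝ, ContDiff ℝ 1 φ → HasCompactSupport φ →
      ∫ x, F x * partialDeriv l φ x = -(∫ x, g x * φ x) - (∫ x, φ x ∂P) + ∫ x, φ x ∂N

theorem continuous_partialDeriv {φ : Rn n → ℝ} (hφ : ContDiff ℝ 1 φ) (l : Fin n) :
    Continuous (partialDeriv l φ) :=
  (hφ.continuous_fderiv one_ne_zero).clm_apply continuous_const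

theorem hasCompactSupport_partialDeriv {φ : Rn n → ℝ} (hφ : HasCompactSupport φ) (l : Fin n) :
    HasCompactSupport (partialDeriv l φ) := by
  exact (hφ.fderiv (𝕜 := ℝ)).comp_left
    (g := fun L : Rn n →L[ℝ] ℝ ↦ L (EuclideanSpace.single l 1)) rfl

theorem IsWeakPartial.mono {T T' : Set ℝ} {l : Fin n} {F g : Rn n → ℝ} {C C' : ℝ≥0∞}
    (h : IsWeakPartial T l F g C) (hT : T ⊆ T') (hC : C ≤ C') : IsWeakPartial T' l F g C' := by
  obtain ⟨P, N, h1, h2, h3, h4, h5, h6, h7⟩ := h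
  exact ⟨P, N, h1, h2, h3.trans hC, h4.trans hC, h5.mono hT, h6.mono hT, h7⟩

theorem integrable_mul_of_continuous {F φ : Rn n → ℝ} (hF : Integrable F) (hφ : Continuous φ)
    (hc : HasCompactSupport φ) : Integrable fun x ↦ F x * φ x := by
  obtain ⟨C, hC⟩ := hc.exists_bound_of_continuous hφ
  exact hF.mul_bdd hφ.aestronglyMeasurable (Eventually.of_forall hC)

theorem integrable_of_continuous_hasCompactSupport {X : Type*} [TopologicalSpace X]
    [MeasurableSpace X] [OpensMeasurableSpace X] {φ : X → ℝ} (hφ : Continuous φ)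
    (hc : HasCompactSupport φ) (P : Measure X) [IsFiniteMeasure P] : Integrable φ P :=
  hφ.integrable_of_hasCompactSupport hc

theorem IsWeakPartial.add {T : Set ℝ} {l : Fin n} {F g F' g' : Rn n → ℝ} {C C' : ℝ≥0∞}
    (h : IsWeakPartial T l F g C) (h' : IsWeakPartial T l F' g' C')
    (hF : Integrable F) (hF' : Integrable F') (hg : Integrable g) (hg' : Integrable g') :
    IsWeakPartial T l (fun x ↦ F x + F' x) (fun x ↦ g x + g' x) (C + C') := by
  obtain ⟨P, N, h1, h2, h3, h4, h5, h6, h7⟩ := h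
  obtain ⟨P', N', h1', h2', h3', h4', h5', h6', h7'⟩ := h'
  refine ⟨P + P', N + N', inferInstance, inferInstance, ?_, ?_, h5.add h5', h6.add h6',
    fun φ hφ hc ↦ ?_⟩
  · simpa using add_le_add h3 h3'
  · simpa using add_le_add h4 h4'
  · have hd := continuous_partialDeriv hφ l
    have hdc := hasCompactSupport_partialDeriv hc l
    simp only [add_mul]
    rw [integral_add (integrable_mul_of_continuous hF hd hdc)
        (integrable_mul_of_continuous hF' hd hdc),
      integral_add (integrable_mul_of_continuous hg hφ.continuous hc)
        (integrable_mul_of_continuous hg' hφ.continuous hc), h7 φ hφ hc, h7' φ hφ hc,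
      integral_add_measure (integrable_of_continuous_hasCompactSupport hφ.continuous hc P)
        (integrable_of_continuous_hasCompactSupport hφ.continuous hc P'),
      integral_add_measure (integrable_of_continuous_hasCompactSupport hφ.continuous hc N)
        (integrable_of_continuous_hasCompactSupport hφ.continuous hc N')]
    ring

theorem IsWeakPartial.const_mul {T : Set ℝ} {l : Fin n} {F g : Rn n → ℝ} {C : ℝ≥0∞}
    (h : IsWeakPartial T l F g C) {c : ℝ} (hc : 0 ≤ c) :
    IsWeakPartial T l (fun x ↦ c * F x) (fun x ↦ c * g x) (ENNReal.ofReal c * C) := by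
  obtain ⟨P, N, h1, h2, h3, h4, h5, h6, h7⟩ := h
  refine ⟨ENNReal.ofReal c • P, ENNReal.ofReal c • N, P.smul_finite ENNReal.ofReal_ne_top,
    N.smul_finite ENNReal.ofReal_ne_top, ?_, ?_, fun S hS h0 ↦ ?_, fun S hS h0 ↦ ?_,
    fun φ hφ hcs ↦ ?_⟩
  · simp only [Measure.smul_apply, smul_eq_mul]; gcongr
  · simp only [Measure.smul_apply, smul_eq_mul]; gcongr
  · simp [h5 S hS h0]
  · simp [h6 S hS h0]
  · simp only [mul_assoc, integral_const_mul, integral_smul_measure, h7 φ hφ hcs,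
      ENNReal.toReal_ofReal hc, smul_eq_mul]
    ring

theorem isWeakPartial_zero (T : Set ℝ) (l : Fin n) :
    IsWeakPartial T l (fun _ ↦ 0) (fun _ ↦ 0) 0 :=
  ⟨0, 0, inferInstance, inferInstance, by simp, by simp, fun _ _ _ ↦ by simp, fun _ _ _ ↦ by simp,
    fun _ _ _ ↦ by simp⟩

/-- The weak derivative of `c : ℝ → ℝ` is `c' ds + P - N`. -/
def IsWeakDeriv (c c' : ℝ → ℝ) (P N : Measure ℝ) : Prop :=
  ∀ ψ : ℝ → ℝ, ContDiff ℝ 1 ψ → HasCompactSupport ψ →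
    ∫ s, c s * deriv ψ s = -(∫ s, c' s * ψ s) - (∫ s, ψ s ∂P) + ∫ s, ψ s ∂N

/-- The measure `h dH^{n-1} ⊗ ρ`, with `ρ` in the variable `y_l`. -/
noncomputable def faceProd (l : Fin n) (h : Rn n → ℝ≥0∞) (ρ : Measure ℝ) : Measure (Rn n) :=
  (((slabMeasure l).withDensity h).prod ρ).map (fun p : Rn n × ℝ ↦ setCoord l p.2 p.1)

theorem faceProd_univ (l : Fin n) (h : Rn n → ℝ≥0∞) (ρ : Measure ℝ) [SFinite ρ] :
    faceProd l h ρ Set.univ = (∫⁻ y, h y ∂(slabMeasure l)) * ρ Set.univ := by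
  rw [faceProd, Measure.map_apply (continuous_setCoord l).measurable MeasurableSet.univ,
    Set.preimage_univ, ← Set.univ_prod_univ, Measure.prod_prod, withDensity_apply _ .univ,
    Measure.restrict_univ]

/-- The slice of the product measure at `t` has a density with respect to the area on `{y_l = t}`,
and `ρ`-almost every `t` lies in `T`. -/
theorem faceAC_faceProd {T : Set ℝ} (l : Fin n) (h : Rn n → ℝ≥0∞)
    (ρ : Measure ℝ) [SFinite ρ] (hρ : ∀ᵐ t ∂ρ, t ∈ T) : FaceAC T (faceProd l h ρ) := by
  intro S hS h0
  have hm' : SFinite ((slabMeasure l).withDensity h) := inferInstance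
  rw [faceProd, Measure.map_apply (continuous_setCoord l).measurable hS,
    Measure.prod_apply_symm ((continuous_setCoord l).measurable hS)]
  rw [lintegral_eq_zero_iff' (by
    exact (measurable_measure_prodMk_right ((continuous_setCoord l).measurable hS)).aemeasurable)]
  filter_upwards [hρ] with t ht
  have := h0 l t ht
  rw [faceMeasure, Measure.map_apply (continuous_setCoord_const l t).measurable hS] at this
  exact withDensity_absolutelyContinuous _ _ this

theorem integral_faceProd (l : Fin n) {h : Rn n → ℝ} (hm : Measurable h) (hpos : ∀ y, 0 ≤ h y)
    (hi : Integrable h (slabMeasure l)) (ρ : Measure ℝ) [IsFiniteMeasure ρ]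
    {φ : Rn n → ℝ} (hφ : Continuous φ) (hc : HasCompactSupport φ) :
    ∫ x, φ x ∂(faceProd l (fun y ↦ ENNReal.ofReal (h y)) ρ)
      = ∫ y, h y * ∫ s, φ (setCoord l s y) ∂ρ ∂(slabMeasure l) := by
  have hfin : IsFiniteMeasure ((slabMeasure l).withDensity fun y ↦ ENNReal.ofReal (h y)) :=
    isFiniteMeasure_withDensity_ofReal hi.2
  rw [faceProd, integral_map (continuous_setCoord l).measurable.aemeasurable
    hφ.aestronglyMeasurable, integral_prod]
  · rw [integral_withDensity_eq_integral_toReal_smul hm.ennreal_ofReal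
      (Eventually.of_forall fun _ ↦ ENNReal.ofReal_lt_top)]
    simp [ENNReal.toReal_ofReal (hpos _)]
  · obtain ⟨C, hC⟩ := hc.exists_bound_of_continuous hφ
    exact Integrable.of_bound (hφ.comp (continuous_setCoord l)).aestronglyMeasurable C
      (Eventually.of_forall fun _ ↦ hC _)

theorem contDiff_setCoord (l : Fin n) (y : Rn n) : ContDiff ℝ 1 fun s ↦ setCoord l s y := by
  unfold setCoord; fun_prop

theorem hasCompactSupport_comp_setCoord {φ : Rn n → ℝ} (hc : HasCompactSupport φ) (l : Fin n)
    (y : Rn n) : HasCompactSupport fun s ↦ φ (setCoord l s y) := by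
  refine HasCompactSupport.of_support_subset_isCompact
    (hc.image (by fun_prop : Continuous fun x : Rn n ↦ x l)) fun s hs ↦ ?_
  exact ⟨setCoord l s y, subset_tsupport _ hs, by simp⟩

theorem hasDerivAt_comp_setCoord {φ : Rn n → ℝ} (hφ : Differentiable ℝ φ) (l : Fin n)
    (y : Rn n) (s : ℝ) :
    HasDerivAt (fun s ↦ φ (setCoord l s y)) (partialDeriv l φ (setCoord l s y)) s := by
  have h1 : HasDerivAt (fun s ↦ setCoord l s y) (EuclideanSpace.single l 1) s := by
    unfold setCoord
    simpa using (((hasDerivAt_id s).sub_const (y l)).smul_const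
      (EuclideanSpace.single l (1 : ℝ))).const_add y
  exact (hφ (setCoord l s y)).hasFDerivAt.comp_hasDerivAt s h1

/-- The weak partial derivative in direction `l` of `h(x) c(x_l)`, where `h` does not depend on
`x_l`. -/
theorem isWeakPartial_mul {T : Set ℝ} (l : Fin n) {h : Rn n → ℝ} (hm : Measurable h)
    (hl : ∀ s y, h (setCoord l s y) = h y) (hi : Integrable h (slabMeasure l))
    {c c' : ℝ → ℝ} {P N : Measure ℝ}
    [IsFiniteMeasure P] [IsFiniteMeasure N] (hP : ∀ᵐ t ∂P, t ∈ T) (hN : ∀ᵐ t ∂N, t ∈ T)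
    (hw : IsWeakDeriv c c' P N) {F g : Rn n → ℝ} (hF : Integrable F) (hg : Integrable g)
    (hFe : ∀ x, F x = h x * c (x l)) (hge : ∀ x, g x = h x * c' (x l)) :
    IsWeakPartial T l F g
      ((∫⁻ y, ENNReal.ofReal |h y| ∂(slabMeasure l)) * (P Set.univ + N Set.univ)) := by
  set hp : Rn n → ℝ := fun y ↦ max (h y) 0
  set hn : Rn n → ℝ := fun y ↦ max (-h y) 0
  have hpm : Measurable hp := hm.max measurable_const
  have hnm : Measurable hn := hm.neg.max measurable_const
  have hpi : Integrable hp (slabMeasure l) := hi.pos_part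
  have hni : Integrable hn (slabMeasure l) := hi.neg_part
  have hfp : IsFiniteMeasure ((slabMeasure l).withDensity fun y ↦ ENNReal.ofReal (hp y)) :=
    isFiniteMeasure_withDensity_ofReal hpi.2
  have hfn : IsFiniteMeasure ((slabMeasure l).withDensity fun y ↦ ENNReal.ofReal (hn y)) :=
    isFiniteMeasure_withDensity_ofReal hni.2
  have hfin1 : ∀ ρ : Measure ℝ, IsFiniteMeasure ρ →
      IsFiniteMeasure (faceProd l (fun y ↦ ENNReal.ofReal (hp y)) ρ) := fun ρ _ ↦ by
    unfold faceProd; infer_instance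
  have hfin2 : ∀ ρ : Measure ℝ, IsFiniteMeasure ρ →
      IsFiniteMeasure (faceProd l (fun y ↦ ENNReal.ofReal (hn y)) ρ) := fun ρ _ ↦ by
    unfold faceProd; infer_instance
  have := hfin1 P ‹_›
  have := hfin1 N ‹_›
  have := hfin2 P ‹_›
  have := hfin2 N ‹_›
  have b1 : ∫⁻ y, ENNReal.ofReal (hp y) ∂(slabMeasure l)
      ≤ ∫⁻ y, ENNReal.ofReal |h y| ∂(slabMeasure l) := by
    gcongr with y; exact max_le (le_abs_self _) (abs_nonneg _)
  have b2 : ∫⁻ y, ENNReal.ofReal (hn y) ∂(slabMeasure l)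
      ≤ ∫⁻ y, ENNReal.ofReal |h y| ∂(slabMeasure l) := by
    gcongr with y; exact max_le (neg_le_abs _) (abs_nonneg _)
  -- Where `h` is negative, multiplication by `h` exchanges the roles of `P` and `N`; hence the
  -- positive part of `h` is paired with `P` and the negative part with `N`, and the other way round
  -- in the second measure.
  refine ⟨faceProd l (fun y ↦ ENNReal.ofReal (hp y)) P
      + faceProd l (fun y ↦ ENNReal.ofReal (hn y)) N,
    faceProd l (fun y ↦ ENNReal.ofReal (hp y)) N + faceProd l (fun y ↦ ENNReal.ofReal (hn y)) P,
    inferInstance, inferInstance, ?_, ?_, ?_, ?_, fun φ hφ hcs ↦ ?_⟩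
  · rw [Measure.add_apply, faceProd_univ, faceProd_univ, mul_add]; gcongr
  · rw [Measure.add_apply, faceProd_univ, faceProd_univ, mul_add, add_comm]; gcongr
  · exact (faceAC_faceProd l _ P hP).add
      (faceAC_faceProd l _ N hN)
  · exact (faceAC_faceProd l _ N hN).add
      (faceAC_faceProd l _ P hP)
  · have hd := continuous_partialDeriv hφ l
    have hdc := hasCompactSupport_partialDeriv hcs l
    have hφi := integrable_of_continuous_hasCompactSupport hφ.continuous hcs
    obtain ⟨C, hC⟩ := hcs.exists_bound_of_continuous hφ.continuous
    have hFd := integrable_mul_of_continuous hF hd hdc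
    have hgφ := integrable_mul_of_continuous hg hφ.continuous hcs
    have bdd : ∀ (ρ : Measure ℝ) [IsFiniteMeasure ρ] (k : Rn n → ℝ),
        Integrable k (slabMeasure l) →
        Integrable (fun y ↦ k y * ∫ s, φ (setCoord l s y) ∂ρ) (slabMeasure l) := by
      intro ρ _ k hk
      refine hk.mul_bdd (c := C * ρ.real Set.univ) ?_ (Eventually.of_forall fun y ↦ ?_)
      · exact (StronglyMeasurable.integral_prod_right'
          (f := fun p : Rn n × ℝ ↦ φ (setCoord l p.2 p.1))
          (hφ.continuous.comp (continuous_setCoord l)).stronglyMeasurable).aestronglyMeasurable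
      · exact norm_integral_le_of_norm_le_const (Eventually.of_forall fun s ↦ hC _)
    -- On each line in direction `l` the factor `h` is constant, so the one-dimensional weak
    -- derivative applies to the restriction of `φ` to that line.
    have key : ∀ y, ∫ s, F (setCoord l s y) * partialDeriv l φ (setCoord l s y)
        = -(∫ s, g (setCoord l s y) * φ (setCoord l s y))
          - (hp y * (∫ s, φ (setCoord l s y) ∂P) + hn y * ∫ s, φ (setCoord l s y) ∂N)
          + (hp y * (∫ s, φ (setCoord l s y) ∂N) + hn y * ∫ s, φ (setCoord l s y) ∂P) := by
      intro y
      have hder : deriv (fun s ↦ φ (setCoord l s y))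
          = fun s ↦ partialDeriv l φ (setCoord l s y) :=
        funext fun s ↦
          (hasDerivAt_comp_setCoord (hφ.differentiable one_ne_zero) l y s).deriv
      have := hw (fun s ↦ φ (setCoord l s y)) (hφ.comp (contDiff_setCoord l y))
        (hasCompactSupport_comp_setCoord hcs l y)
      rw [hder] at this
      simp only [hFe, hge, hl, setCoord_same, mul_assoc, integral_const_mul]
      rw [this]
      have : h y = hp y - hn y := by
        simp only [hp, hn]
        rcases le_total (h y) 0 with h0 | h0
        · rw [max_eq_right h0, max_eq_left (by linarith)]; ring
        · rw [max_eq_left h0, max_eq_right (by linarith)]; ring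
      rw [this]; ring
    rw [integral_slab l hFd, integral_slab l hgφ,
      integral_add_measure (hφi _) (hφi _), integral_add_measure (hφi _) (hφi _),
      integral_faceProd l hpm (fun _ ↦ le_max_right _ _) hpi P hφ.continuous hcs,
      integral_faceProd l hnm (fun _ ↦ le_max_right _ _) hni N hφ.continuous hcs,
      integral_faceProd l hpm (fun _ ↦ le_max_right _ _) hpi N hφ.continuous hcs,
      integral_faceProd l hnm (fun _ ↦ le_max_right _ _) hni P hφ.continuous hcs]
    simp_rw [key]
    have i0 : Integrable (fun y ↦ ∫ s, g (setCoord l s y) * φ (setCoord l s y))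
        (slabMeasure l) := (integrable_slab l hgφ).integral_prod_left
    rw [integral_add, integral_sub, integral_neg, integral_add (bdd P hp hpi) (bdd N hn hni),
      integral_add (bdd N hp hpi) (bdd P hn hni)]
    · exact i0.neg
    · exact (bdd P hp hpi).add (bdd N hn hni)
    · exact i0.neg.sub ((bdd P hp hpi).add (bdd N hn hni))
    · exact (bdd N hp hpi).add (bdd P hn hni)

end Slab

/-! ### Piecewise smooth functions of one variable: steps, sawteeth, descents -/

section OneDim
open scoped ENNReal

/-- `c` is supported in `[p, q)`, piecewise `C¹` with exceptional points in `T`, and has derivative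
`c'` off `T`. -/
structure IsPw (T : Set ℝ) (p q : ℝ) (c c' : ℝ → ℝ) : Prop where
  measurable : Measurable c
  measurable' : Measurable c'
  bdd : ∃ K, ∀ s, |c s| ≤ K
  bdd' : ∃ K, ∀ s, |c' s| ≤ K
  supp : ∀ s, s ∉ Set.Ico p q → c s = 0
  supp' : ∀ s, s ∉ Set.Ico p q → c' s = 0
  right : ∀ s, ∃ f : ℝ → ℝ, ContDiff ℝ 1 f ∧ ∀ᶠ s' in 𝓝 s, s < s' → c s' = f s'
  left : ∀ s, ∃ f : ℝ → ℝ, ContDiff ℝ 1 f ∧ ∀ᶠ s' in 𝓝 s, s' < s → c s' = f s'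
  loc : ∀ s, s ∉ T → ∃ f : ℝ → ℝ, ContDiff ℝ 1 f ∧ c =ᶠ[𝓝 s] f
  deriv : ∀ s, s ∉ T → HasDerivAt c (c' s) s

namespace IsPw

variable {T T₁ T₂ : Set ℝ} {p q : ℝ} {c c' c₁ c₁' c₂ c₂' : ℝ → ℝ}

theorem mono (h : IsPw T p q c c') {T' : Set ℝ} {p' q' : ℝ} (hT : T ⊆ T') (hp : p' ≤ p)
    (hq : q ≤ q') : IsPw T' p' q' c c' where
  measurable := h.measurable
  measurable' := h.measurable'
  bdd := h.bdd
  bdd' := h.bdd'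
  supp s hs := h.supp s fun h' ↦ hs ⟨hp.trans h'.1, h'.2.trans_le hq⟩
  supp' s hs := h.supp' s fun h' ↦ hs ⟨hp.trans h'.1, h'.2.trans_le hq⟩
  right := h.right
  left := h.left
  loc s hs := h.loc s fun h' ↦ hs (hT h')
  deriv s hs := h.deriv s fun h' ↦ hs (hT h')

theorem add (h₁ : IsPw T₁ p q c₁ c₁') (h₂ : IsPw T₂ p q c₂ c₂') :
    IsPw (T₁ ∪ T₂) p q (fun s ↦ c₁ s + c₂ s) (fun s ↦ c₁' s + c₂' s) where
  measurable := h₁.measurable.add h₂.measurable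
  measurable' := h₁.measurable'.add h₂.measurable'
  bdd := by
    obtain ⟨K, hK⟩ := h₁.bdd
    obtain ⟨K', hK'⟩ := h₂.bdd
    exact ⟨K + K', fun s ↦ (abs_add_le _ _).trans (add_le_add (hK s) (hK' s))⟩
  bdd' := by
    obtain ⟨K, hK⟩ := h₁.bdd'
    obtain ⟨K', hK'⟩ := h₂.bdd'
    exact ⟨K + K', fun s ↦ (abs_add_le _ _).trans (add_le_add (hK s) (hK' s))⟩
  supp s hs := by simp [h₁.supp s hs, h₂.supp s hs]
  supp' s hs := by simp [h₁.supp' s hs, h₂.supp' s hs]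
  right s := by
    obtain ⟨f, hf, hf'⟩ := h₁.right s
    obtain ⟨g, hg, hg'⟩ := h₂.right s
    refine ⟨fun s ↦ f s + g s, hf.add hg, ?_⟩
    filter_upwards [hf', hg'] with s' h1 h2 h3
    rw [h1 h3, h2 h3]
  left s := by
    obtain ⟨f, hf, hf'⟩ := h₁.left s
    obtain ⟨g, hg, hg'⟩ := h₂.left s
    refine ⟨fun s ↦ f s + g s, hf.add hg, ?_⟩
    filter_upwards [hf', hg'] with s' h1 h2 h3
    rw [h1 h3, h2 h3]
  loc s hs := by
    obtain ⟨f, hf, hf'⟩ := h₁.loc s fun h ↦ hs (.inl h)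
    obtain ⟨g, hg, hg'⟩ := h₂.loc s fun h ↦ hs (.inr h)
    exact ⟨fun s ↦ f s + g s, hf.add hg, hf'.add hg'⟩
  deriv s hs := (h₁.deriv s fun h ↦ hs (.inl h)).add (h₂.deriv s fun h ↦ hs (.inr h))

theorem const_mul (h : IsPw T p q c c') (k : ℝ) :
    IsPw T p q (fun s ↦ k * c s) (fun s ↦ k * c' s) where
  measurable := h.measurable.const_mul k
  measurable' := h.measurable'.const_mul k
  bdd := by
    obtain ⟨K, hK⟩ := h.bdd
    exact ⟨|k| * K, fun s ↦ by rw [abs_mul]; gcongr; exact hK s⟩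
  bdd' := by
    obtain ⟨K, hK⟩ := h.bdd'
    exact ⟨|k| * K, fun s ↦ by rw [abs_mul]; gcongr; exact hK s⟩
  supp s hs := by simp [h.supp s hs]
  supp' s hs := by simp [h.supp' s hs]
  right s := by
    obtain ⟨f, hf, hf'⟩ := h.right s
    refine ⟨fun s ↦ k * f s, contDiff_const.mul hf, ?_⟩
    filter_upwards [hf'] with s' h1 h3
    rw [h1 h3]
  left s := by
    obtain ⟨f, hf, hf'⟩ := h.left s
    refine ⟨fun s ↦ k * f s, contDiff_const.mul hf, ?_⟩
    filter_upwards [hf'] with s' h1 h3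
    rw [h1 h3]
  loc s hs := by
    obtain ⟨f, hf, hf'⟩ := h.loc s hs
    exact ⟨fun s ↦ k * f s, contDiff_const.mul hf, by
      filter_upwards [hf'] with s' h1; rw [h1]⟩
  deriv s hs := (h.deriv s hs).const_mul k

theorem zero (p q : ℝ) : IsPw ∅ p q (fun _ ↦ 0) (fun _ ↦ 0) where
  measurable := measurable_const
  measurable' := measurable_const
  bdd := ⟨0, by simp⟩
  bdd' := ⟨0, by simp⟩
  supp := by simp
  supp' := by simp
  right s := ⟨0, contDiff_const, by simp⟩
  left s := ⟨0, contDiff_const, by simp⟩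
  loc s _ := ⟨0, contDiff_const, by rfl⟩
  deriv s _ := hasDerivAt_const _ _

theorem integrable (h : IsPw T p q c c') : Integrable c := by
  obtain ⟨K, hK⟩ := h.bdd
  have : IntegrableOn c (Set.Ico p q) :=
    Measure.integrableOn_of_bounded (M := K) (by simp) h.measurable.aestronglyMeasurable
      (Eventually.of_forall hK)
  refine (integrableOn_iff_integrable_of_support_subset fun s hs ↦ ?_).1 this
  by_contra hs'
  exact hs (h.supp s hs')

theorem integrable' (h : IsPw T p q c c') : Integrable c' := by
  obtain ⟨K, hK⟩ := h.bdd'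
  have : IntegrableOn c' (Set.Ico p q) :=
    Measure.integrableOn_of_bounded (M := K) (by simp) h.measurable'.aestronglyMeasurable
      (Eventually.of_forall hK)
  refine (integrableOn_iff_integrable_of_support_subset fun s hs ↦ ?_).1 this
  by_contra hs'
  exact hs (h.supp' s hs')

end IsPw

/-- A smooth function cut off to an interval. -/
theorem isPw_indicator {a b : ℝ} {f f' : ℝ → ℝ} (hf : ContDiff ℝ 1 f)
    (hf' : ∀ s, HasDerivAt f (f' s) s) :
    IsPw {a, b} a b ((Set.Ico a b).indicator f) ((Set.Ico a b).indicator f') := by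
  have hcont : Continuous f' := by
    have : f' = deriv f := funext fun s ↦ (hf' s).deriv.symm
    rw [this]; exact hf.continuous_deriv le_rfl
  have bd : ∀ g : ℝ → ℝ, Continuous g → ∃ K, ∀ s, |(Set.Ico a b).indicator g s| ≤ K := by
    intro g hg
    obtain ⟨K, hK⟩ := (isCompact_Icc (a := a) (b := b)).exists_bound_of_continuousOn hg.continuousOn
    refine ⟨max K 0, fun s ↦ ?_⟩
    by_cases hs : s ∈ Set.Ico a b
    · rw [Set.indicator_of_mem hs]
      exact (hK s (Set.Ico_subset_Icc_self hs)).trans (le_max_left _ _)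
    · simp [hs]
  have inside : ∀ s ∈ Set.Ioo a b, (Set.Ico a b).indicator f =ᶠ[𝓝 s] f := fun s hs ↦ by
    filter_upwards [isOpen_Ioo.mem_nhds hs] with s' hs'
    exact Set.indicator_of_mem (Set.Ioo_subset_Ico_self hs') f
  have outside : ∀ s, s < a ∨ b < s → (Set.Ico a b).indicator f =ᶠ[𝓝 s] fun _ ↦ 0 := by
    rintro s (hs | hs)
    · filter_upwards [Iio_mem_nhds hs] with s' hs'
      exact Set.indicator_of_notMem (fun h ↦ absurd h.1 (not_le.2 hs')) _
    · filter_upwards [Ioi_mem_nhds hs] with s' hs'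
      exact Set.indicator_of_notMem (fun h ↦ absurd h.2 (not_lt.2 (le_of_lt hs'))) _
  have hz : ContDiff ℝ 1 fun _ : ℝ ↦ (0 : ℝ) := contDiff_const
  refine ⟨hf.continuous.measurable.indicator measurableSet_Ico,
    hcont.measurable.indicator measurableSet_Ico, bd f hf.continuous, bd f' hcont,
    fun s hs ↦ Set.indicator_of_notMem hs _, fun s hs ↦ Set.indicator_of_notMem hs _,
    fun s ↦ ?_, fun s ↦ ?_, fun s hs ↦ ?_, fun s hs ↦ ?_⟩
  · rcases lt_or_ge s a with h1 | h1
    · exact ⟨_, hz, (outside s (.inl h1)).mono fun s' h _ ↦ h⟩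
    rcases lt_or_ge s b with h2 | h2
    · refine ⟨f, hf, ?_⟩
      filter_upwards [Iio_mem_nhds h2] with s' hs' hs''
      exact Set.indicator_of_mem (s := Set.Ico a b) ⟨h1.trans hs''.le, hs'⟩ f
    · refine ⟨_, hz, Eventually.of_forall fun s' hs' ↦ ?_⟩
      exact Set.indicator_of_notMem (fun h ↦ absurd h.2 (not_lt.2 (h2.trans hs'.le))) _
  · rcases le_or_gt s a with h1 | h1
    · refine ⟨_, hz, Eventually.of_forall fun s' hs' ↦ ?_⟩
      exact Set.indicator_of_notMem (fun h ↦ absurd h.1 (not_le.2 (hs'.trans_le h1))) _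
    rcases le_or_gt s b with h2 | h2
    · refine ⟨f, hf, ?_⟩
      filter_upwards [Ioi_mem_nhds h1] with s' hs' hs''
      exact Set.indicator_of_mem (s := Set.Ico a b) ⟨le_of_lt hs', hs''.trans_le h2⟩ f
    · exact ⟨_, hz, (outside s (.inr h2)).mono fun s' h _ ↦ h⟩
  · simp only [Set.mem_insert_iff, Set.mem_singleton_iff, not_or] at hs
    rcases lt_or_gt_of_ne hs.1 with h1 | h1
    · exact ⟨_, hz, outside s (.inl h1)⟩
    rcases lt_or_gt_of_ne hs.2 with h2 | h2
    · exact ⟨f, hf, inside s ⟨h1, h2⟩⟩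
    · exact ⟨_, hz, outside s (.inr h2)⟩
  · simp only [Set.mem_insert_iff, Set.mem_singleton_iff, not_or] at hs
    rcases lt_or_gt_of_ne hs.1 with h1 | h1
    · rw [Set.indicator_of_notMem (fun h ↦ absurd h.1 (not_le.2 h1))]
      exact (hasDerivAt_const s (0 : ℝ)).congr_of_eventuallyEq (outside s (.inl h1))
    rcases lt_or_gt_of_ne hs.2 with h2 | h2
    · rw [Set.indicator_of_mem (s := Set.Ico a b) ⟨h1.le, h2⟩]
      exact (hf' s).congr_of_eventuallyEq (inside s ⟨h1, h2⟩)
    · rw [Set.indicator_of_notMem (fun h ↦ absurd h.2 (not_lt.2 h2.le))]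
      exact (hasDerivAt_const s (0 : ℝ)).congr_of_eventuallyEq (outside s (.inr h2))

/-- Integration by parts for a smooth function cut off to an interval. -/
theorem integral_indicator_mul_deriv {a b : ℝ} (hab : a < b) {f f' : ℝ → ℝ}
    (hf' : ∀ s, HasDerivAt f (f' s) s) (hcont : Continuous f') {ψ : ℝ → ℝ}
    (hψ : ContDiff ℝ 1 ψ) :
    ∫ s, (Set.Ico a b).indicator f s * deriv ψ s
      = f b * ψ b - f a * ψ a - ∫ s, (Set.Ico a b).indicator f' s * ψ s := by
  have e : ∀ g h : ℝ → ℝ, ∫ s, (Set.Ico a b).indicator g s * h s = ∫ s in a..b, g s * h s := by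
    intro g h
    rw [intervalIntegral.integral_of_le hab.le, ← integral_Ico_eq_integral_Ioc,
      ← integral_indicator measurableSet_Ico]
    congr 1; ext s
    by_cases hs : s ∈ Set.Ico a b <;> simp [hs]
  rw [e, e]
  exact intervalIntegral.integral_mul_deriv_eq_deriv_mul (fun s _ ↦ hf' s)
    (fun s _ ↦ ((hψ.differentiable one_ne_zero) s).hasDerivAt) (hcont.intervalIntegrable _ _)
    ((hψ.continuous_deriv le_rfl).intervalIntegrable _ _)

theorem IsWeakDeriv.add {T₁ T₂ : Set ℝ} {p q : ℝ} {c c' d d' : ℝ → ℝ} {P N P' N' : Measure ℝ}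
    [IsFiniteMeasure P] [IsFiniteMeasure N] [IsFiniteMeasure P'] [IsFiniteMeasure N']
    (hc : IsPw T₁ p q c c') (hd : IsPw T₂ p q d d')
    (h : IsWeakDeriv c c' P N) (h' : IsWeakDeriv d d' P' N') :
    IsWeakDeriv (fun s ↦ c s + d s) (fun s ↦ c' s + d' s) (P + P') (N + N') := by
  intro ψ hψ hs
  have hψi := integrable_of_continuous_hasCompactSupport hψ.continuous hs
  obtain ⟨K, hK⟩ := hs.exists_bound_of_continuous hψ.continuous
  obtain ⟨K', hK'⟩ := hs.deriv.exists_bound_of_continuous (hψ.continuous_deriv le_rfl)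
  have i : ∀ g : ℝ → ℝ, Integrable g → Integrable fun s ↦ g s * ψ s := fun g hg ↦
    hg.mul_bdd hψ.continuous.aestronglyMeasurable (Eventually.of_forall hK)
  have i' : ∀ g : ℝ → ℝ, Integrable g → Integrable fun s ↦ g s * deriv ψ s := fun g hg ↦
    hg.mul_bdd (hψ.continuous_deriv le_rfl).aestronglyMeasurable (Eventually.of_forall hK')
  simp only [add_mul]
  rw [integral_add (i' c hc.integrable) (i' d hd.integrable), integral_add (i c' hc.integrable')
    (i d' hd.integrable'), integral_add_measure (hψi _) (hψi _),
    integral_add_measure (hψi _) (hψi _), h ψ hψ hs, h' ψ hψ hs]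
  ring

theorem isWeakDeriv_zero : IsWeakDeriv (fun _ ↦ 0) (fun _ ↦ 0) 0 0 := fun _ _ _ ↦ by simp

/-- The sum of the indicator functions of the half-open intervals in `L`. -/
noncomputable def chi (L : List (ℝ × ℝ)) (s : ℝ) : ℝ :=
  (L.map fun I ↦ (Set.Ico I.1 I.2).indicator (fun _ ↦ (1 : ℝ)) s).sum

/-- `L` consists of nonempty subintervals of `[p, q)`. -/
def IsIntervalList (p q : ℝ) (L : List (ℝ × ℝ)) : Prop := ∀ I ∈ L, p ≤ I.1 ∧ I.1 < I.2 ∧ I.2 ≤ q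

theorem chi_nil (s : ℝ) : chi [] s = 0 := rfl

theorem chi_cons (I : ℝ × ℝ) (L : List (ℝ × ℝ)) (s : ℝ) :
    chi (I :: L) s = chi [I] s + chi L s := by simp [chi]

theorem chi_append (L L' : List (ℝ × ℝ)) (s : ℝ) : chi (L ++ L') s = chi L s + chi L' s := by
  simp [chi]

theorem chi_singleton (I : ℝ × ℝ) (s : ℝ) :
    chi [I] s = (Set.Ico I.1 I.2).indicator (fun _ ↦ (1 : ℝ)) s := by simp [chi]

theorem chi_nonneg (L : List (ℝ × ℝ)) (s : ℝ) : 0 ≤ chi L s := by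
  induction L with
  | nil => simp [chi_nil]
  | cons I L ih =>
    rw [chi_cons, chi_singleton]
    exact add_nonneg (Set.indicator_nonneg (by simp) _) ih

theorem chi_nat (L : List (ℝ × ℝ)) (s : ℝ) : ∃ k : ℕ, chi L s = k := by
  induction L with
  | nil => exact ⟨0, by simp [chi_nil]⟩
  | cons I L ih =>
    obtain ⟨k, hk⟩ := ih
    rw [chi_cons, chi_singleton, hk]
    by_cases hs : s ∈ Set.Ico I.1 I.2
    · exact ⟨1 + k, by simp [hs]⟩
    · exact ⟨k, by simp [hs]⟩

/-- Intervals in a list may overlap, and `chi` counts multiplicity. The bound `chi ≤ 1` expresses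
disjointness, and counting makes the values integers. -/
theorem chi_eq_zero_or_one {L : List (ℝ × ℝ)} {s : ℝ} (h : chi L s ≤ 1) :
    chi L s = 0 ∨ chi L s = 1 := by
  obtain ⟨k, hk⟩ := chi_nat L s
  rw [hk] at h ⊢
  have : k ≤ 1 := by exact_mod_cast h
  interval_cases k <;> simp

/-- Half-open intervals make this hold at every point, including `m`, so that the slopes in the
constructions below are identities and not just almost everywhere statements. -/
theorem chi_split {a m b : ℝ} (h1 : a ≤ m) (h2 : m ≤ b) (s : ℝ) :
    chi [(a, b)] s = chi [(a, m)] s + chi [(m, b)] s := by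
  simp only [chi_singleton]
  rw [← Set.Ico_union_Ico_eq_Ico h1 h2, Set.indicator_union_of_disjoint]
  exact Set.disjoint_left.2 fun x hx hx' ↦ absurd hx.2 (not_lt.2 hx'.1)

/-- Data of a piecewise smooth function on the line whose weak derivative is `c' + P - N`. -/
structure IsJumpFun (T : Set ℝ) (p q : ℝ) (c c' : ℝ → ℝ) (P N : Measure ℝ) : Prop where
  countable : T.Countable
  pw : IsPw T p q c c'
  finP : IsFiniteMeasure P
  finN : IsFiniteMeasure N
  concP : ∀ᵐ t ∂P, t ∈ T
  concN : ∀ᵐ t ∂N, t ∈ T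
  weak : IsWeakDeriv c c' P N

theorem IsJumpFun.mono {T : Set ℝ} {p q p' q' : ℝ} {c c' : ℝ → ℝ} {P N : Measure ℝ}
    (h : IsJumpFun T p q c c' P N) (hp : p' ≤ p) (hq : q ≤ q') : IsJumpFun T p' q' c c' P N :=
  ⟨h.1, h.2.mono le_rfl hp hq, h.3, h.4, h.5, h.6, h.7⟩

theorem IsJumpFun.mono_set {T T' : Set ℝ} {p q : ℝ} {c c' : ℝ → ℝ} {P N : Measure ℝ}
    (h : IsJumpFun T p q c c' P N) (hT : T ⊆ T') (hT' : T'.Countable) :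
    IsJumpFun T' p q c c' P N :=
  ⟨hT', h.2.mono hT le_rfl le_rfl, h.3, h.4, h.5.mono fun _ h ↦ hT h, h.6.mono fun _ h ↦ hT h, h.7⟩

theorem IsJumpFun.add {T T' : Set ℝ} {p q : ℝ} {c c' d d' : ℝ → ℝ} {P N P' N' : Measure ℝ}
    (h : IsJumpFun T p q c c' P N) (h' : IsJumpFun T' p q d d' P' N') :
    IsJumpFun (T ∪ T') p q (fun s ↦ c s + d s) (fun s ↦ c' s + d' s) (P + P') (N + N') := by
  obtain ⟨h1, h2, h3, h4, h5, h6, h7⟩ := h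
  obtain ⟨h1', h2', h3', h4', h5', h6', h7'⟩ := h'
  refine ⟨h1.union h1', h2.add h2', inferInstance, inferInstance, ?_, ?_, h7.add h2 h2' h7'⟩
  · exact ae_add_measure_iff.2 ⟨h5.mono fun _ h ↦ .inl h, h5'.mono fun _ h ↦ .inr h⟩
  · exact ae_add_measure_iff.2 ⟨h6.mono fun _ h ↦ .inl h, h6'.mono fun _ h ↦ .inr h⟩

theorem IsJumpFun.const_mul {T : Set ℝ} {p q : ℝ} {c c' : ℝ → ℝ} {P N : Measure ℝ}
    (h : IsJumpFun T p q c c' P N) {k : ℝ} (hk : 0 ≤ k) :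
    IsJumpFun T p q (fun s ↦ k * c s) (fun s ↦ k * c' s) (ENNReal.ofReal k • P)
      (ENNReal.ofReal k • N) := by
  obtain ⟨h1, h2, h3, h4, h5, h6, h7⟩ := h
  refine ⟨h1, h2.const_mul k, P.smul_finite ENNReal.ofReal_ne_top,
    N.smul_finite ENNReal.ofReal_ne_top, ?_, ?_, fun ψ hψ hs ↦ ?_⟩
  · exact Measure.ae_smul_measure h5 _
  · exact Measure.ae_smul_measure h6 _
  · simp only [mul_assoc, integral_const_mul, integral_smul_measure, h7 ψ hψ hs,
      ENNReal.toReal_ofReal hk, smul_eq_mul]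
    ring

theorem isJumpFun_zero (p q : ℝ) : IsJumpFun ∅ p q (fun _ ↦ 0) (fun _ ↦ 0) 0 0 :=
  ⟨Set.countable_empty, IsPw.zero p q, inferInstance, inferInstance, by simp, by simp,
    isWeakDeriv_zero⟩

/-- The indicator function of an interval. -/
theorem isJumpFun_interval {a b : ℝ} (hab : a < b) :
    IsJumpFun {a, b} a b (chi [(a, b)]) (fun _ ↦ 0) (Measure.dirac a) (Measure.dirac b) := by
  have hpw := isPw_indicator (a := a) (b := b) (f := fun _ ↦ (1 : ℝ)) (f' := fun _ ↦ 0) contDiff_const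
    fun s ↦ hasDerivAt_const s 1
  have e : chi [(a, b)] = (Set.Ico a b).indicator fun _ ↦ (1 : ℝ) :=
    funext fun s ↦ chi_singleton _ s
  simp only [Set.indicator_zero] at hpw
  refine ⟨(Set.toFinite _).countable, e ▸ hpw, inferInstance, inferInstance, by simp [ae_dirac_eq],
    by simp [ae_dirac_eq], fun ψ hψ hs ↦ ?_⟩
  rw [e, integral_indicator_mul_deriv hab (f' := fun _ ↦ 0) (fun s ↦ hasDerivAt_const s 1)
    continuous_const hψ]
  simp
  ring

/-- The ramp `s - a` on an interval. -/
theorem isJumpFun_ramp {a b : ℝ} (hab : a < b) :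
    IsJumpFun {a, b} a b ((Set.Ico a b).indicator fun s ↦ s - a) (chi [(a, b)]) 0
      (ENNReal.ofReal (b - a) • Measure.dirac b) := by
  have hd : ∀ s : ℝ, HasDerivAt (fun s ↦ s - a) 1 s := fun s ↦ (hasDerivAt_id s).sub_const a
  have hpw := isPw_indicator (a := a) (b := b) (f := fun s ↦ s - a) (f' := fun _ ↦ 1) (by fun_prop) hd
  have e : chi [(a, b)] = (Set.Ico a b).indicator fun _ ↦ (1 : ℝ) :=
    funext fun s ↦ chi_singleton _ s
  refine ⟨(Set.toFinite _).countable, e ▸ hpw, inferInstance,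
    Measure.smul_finite _ ENNReal.ofReal_ne_top, by simp, ?_, fun ψ hψ hs ↦ ?_⟩
  · exact Measure.ae_smul_measure (by simp [ae_dirac_eq]) _
  · rw [e, integral_indicator_mul_deriv hab hd continuous_const hψ]
    simp [integral_smul_measure, ENNReal.toReal_ofReal (sub_nonneg.2 hab.le)]
    ring

theorem exists_isJumpFun_chi {p q : ℝ} {L : List (ℝ × ℝ)} (hL : IsIntervalList p q L) :
    ∃ T P N, IsJumpFun T p q (chi L) (fun _ ↦ 0) P N := by
  induction L with
  | nil => exact ⟨_, _, _, isJumpFun_zero p q⟩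
  | cons I L ih =>
    obtain ⟨T, P, N, h⟩ := ih fun J hJ ↦ hL J (List.mem_cons_of_mem _ hJ)
    obtain ⟨h1, h2, h3⟩ := hL I List.mem_cons_self
    have := ((isJumpFun_interval h2).mono h1 h3).add h
    simp only [add_zero] at this
    rw [show chi (I :: L) = fun s ↦ chi [(I.1, I.2)] s + chi L s from funext (chi_cons I L)]
    exact ⟨_, _, _, this⟩

/-- A small continuous sawtooth on an interval with slopes `1 - θ` and `-θ`. -/
theorem exists_sawtooth_interval {θ : ℝ} (h0 : 0 < θ) (h1 : θ < 1) {ε : ℝ} (k : ℕ) :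
    ∀ a b : ℝ, a < b → b - a ≤ 2 ^ k * ε → ∃ L T c, IsIntervalList a b L ∧
      (∀ s, chi L s ≤ chi [(a, b)] s) ∧
      IsJumpFun T a b c (fun s ↦ chi L s - θ * chi [(a, b)] s) 0 0 ∧
      ∀ s, |c s| ≤ ε * chi [(a, b)] s := by
  induction k with
  | zero =>
    intro a b hab hk
    -- One tooth falls with slope `-θ` on `[a, m)` and rises with slope `1 - θ` on `[m, b)`. For
    -- this `m` the two pieces meet at `m` and the tooth vanishes at `a` and `b`, so the boundary
    -- terms cancel and there are no jumps. The rising part has length `θ (b - a)`.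
    set m := a + (1 - θ) * (b - a) with hm
    have hba : 0 < b - a := sub_pos.2 hab
    have ham : a < m := by nlinarith
    have hmb : m < b := by nlinarith
    have d1 : ∀ s : ℝ, HasDerivAt (fun s ↦ -θ * (s - a)) (-θ) s := fun s ↦ by
      simpa using ((hasDerivAt_id s).sub_const a).const_mul (-θ)
    have d2 : ∀ s : ℝ, HasDerivAt (fun s ↦ (1 - θ) * (s - b)) (1 - θ) s := fun s ↦ by
      simpa using ((hasDerivAt_id s).sub_const b).const_mul (1 - θ)
    have p1 := (isPw_indicator (a := a) (b := m) (f := fun s ↦ -θ * (s - a)) (f' := fun _ ↦ -θ)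
      (by fun_prop) d1).mono le_rfl le_rfl hmb.le
    have p2 := (isPw_indicator (a := m) (b := b) (f := fun s ↦ (1 - θ) * (s - b)) (f' := fun _ ↦ 1 - θ)
      (by fun_prop) d2).mono le_rfl ham.le le_rfl
    have e : (fun s ↦ chi [(m, b)] s - θ * chi [(a, b)] s)
        = fun s ↦ (Set.Ico a m).indicator (fun _ ↦ -θ) s
          + (Set.Ico m b).indicator (fun _ ↦ 1 - θ) s := by
      ext s
      rw [chi_split ham.le hmb.le]
      simp only [chi_singleton]
      by_cases h : s ∈ Set.Ico a m <;> by_cases h' : s ∈ Set.Ico m b <;> (simp [h, h']; try ring)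
    refine ⟨[(m, b)], _, _, ?_, ?_, ⟨?_, e ▸ p1.add p2, inferInstance, inferInstance, by simp,
      by simp, fun ψ hψ hs ↦ ?_⟩, ?_⟩
    · simp [IsIntervalList, ham.le, hmb]
    · intro s
      rw [chi_split ham.le hmb.le]
      exact le_add_of_nonneg_left (chi_nonneg _ _)
    · exact (Set.toFinite _).countable
    · obtain ⟨K, hK⟩ := hs.exists_bound_of_continuous hψ.continuous
      obtain ⟨K', hK'⟩ := hs.deriv.exists_bound_of_continuous (hψ.continuous_deriv le_rfl)
      have i : ∀ g : ℝ → ℝ, Integrable g → Integrable fun s ↦ g s * ψ s := fun g hg ↦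
        hg.mul_bdd hψ.continuous.aestronglyMeasurable (Eventually.of_forall hK)
      have i' : ∀ g : ℝ → ℝ, Integrable g → Integrable fun s ↦ g s * deriv ψ s := fun g hg ↦
        hg.mul_bdd (hψ.continuous_deriv le_rfl).aestronglyMeasurable (Eventually.of_forall hK')
      simp only [congrFun e]
      simp only [add_mul]
      rw [integral_add (i' _ p1.integrable) (i' _ p2.integrable),
        integral_add (i _ p1.integrable') (i _ p2.integrable'),
        integral_indicator_mul_deriv ham d1 continuous_const hψ,
        integral_indicator_mul_deriv hmb d2 continuous_const hψ]
      simp only [integral_zero_measure, hm]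
      ring
    · intro s
      simp only [pow_zero, one_mul] at hk
      simp only [chi_singleton]
      by_cases h : s ∈ Set.Ico a b
      · rw [Set.indicator_of_mem h, mul_one]
        rcases lt_or_ge s m with hsm | hsm
        · rw [Set.indicator_of_mem (show s ∈ Set.Ico a m from ⟨h.1, hsm⟩),
            Set.indicator_of_notMem (fun h' ↦ absurd h'.1 (not_le.2 hsm)), add_zero, abs_le]
          have := h.1
          have := h.2
          constructor <;> nlinarith
        · rw [Set.indicator_of_notMem (fun h' ↦ absurd h'.2 (not_lt.2 hsm)),
            Set.indicator_of_mem (show s ∈ Set.Ico m b from ⟨hsm, h.2⟩), zero_add, abs_le]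
          have := h.1
          have := h.2
          constructor <;> nlinarith
      · rw [Set.indicator_of_notMem h,
          Set.indicator_of_notMem (fun h' ↦ h ⟨h'.1, h'.2.trans hmb⟩),
          Set.indicator_of_notMem (fun h' ↦ h ⟨ham.le.trans h'.1, h'.2⟩)]
        simp
  | succ k ih =>
    intro a b hab hk
    -- Bisection with the same slopes halves the length available to a tooth; teeth on adjacent
    -- intervals both vanish at the common end point, so no jump appears.
    set m := (a + b) / 2 with hm
    have ham : a < m := by linarith
    have hmb : m < b := by linarith
    rw [pow_succ] at hk
    obtain ⟨L, T, c, h1, h2, h3, h4⟩ := ih a m ham (by linarith)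
    obtain ⟨L', T', c', h1', h2', h3', h4'⟩ := ih m b hmb (by linarith)
    refine ⟨L ++ L', T ∪ T', fun s ↦ c s + c' s, ?_, ?_, ?_, ?_⟩
    · intro I hI
      rcases List.mem_append.1 hI with hI | hI
      · obtain ⟨e1, e2, e3⟩ := h1 I hI
        exact ⟨e1, e2, e3.trans hmb.le⟩
      · obtain ⟨e1, e2, e3⟩ := h1' I hI
        exact ⟨ham.le.trans e1, e2, e3⟩
    · intro s
      rw [chi_append, chi_split ham.le hmb.le]
      exact add_le_add (h2 s) (h2' s)
    · have := (h3.mono le_rfl hmb.le).add (h3'.mono ham.le le_rfl)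
      simp only [add_zero] at this
      convert this using 1
      ext s
      rw [chi_append, chi_split ham.le hmb.le]
      ring
    · intro s
      rw [chi_split ham.le hmb.le, mul_add]
      exact (abs_add_le _ _).trans (add_le_add (h4 s) (h4' s))

/-- A small continuous sawtooth on a union of intervals with slopes `1 - θ` and `-θ`. -/
theorem exists_sawtooth {θ : ℝ} (h0 : 0 < θ) (h1 : θ < 1) {ε : ℝ} (hε : 0 < ε) {p q : ℝ}
    {L : List (ℝ × ℝ)} (hL : IsIntervalList p q L) : ∃ L' T c, IsIntervalList p q L' ∧
      (∀ s, chi L' s ≤ chi L s) ∧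
      IsJumpFun T p q c (fun s ↦ chi L' s - θ * chi L s) 0 0 ∧
      ∀ s, |c s| ≤ ε * chi L s := by
  induction L with
  | nil =>
    refine ⟨[], ∅, fun _ ↦ 0, by simp [IsIntervalList], fun s ↦ le_rfl, ?_, by simp [chi_nil]⟩
    simpa [chi_nil] using isJumpFun_zero p q
  | cons I L ih =>
    obtain ⟨L₁, T₁, c₁, a1, a2, a3, a4⟩ := ih fun J hJ ↦ hL J (List.mem_cons_of_mem _ hJ)
    obtain ⟨i1, i2, i3⟩ := hL I List.mem_cons_self
    obtain ⟨k, hk⟩ := pow_unbounded_of_one_lt ((I.2 - I.1) / ε) (one_lt_two (α := ℝ))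
    obtain ⟨L₂, T₂, c₂, b1, b2, b3, b4⟩ := exists_sawtooth_interval h0 h1 k I.1 I.2 i2
      ((div_le_iff₀ hε).1 hk.le)
    refine ⟨L₂ ++ L₁, T₂ ∪ T₁, fun s ↦ c₂ s + c₁ s, ?_, ?_, ?_, ?_⟩
    · intro J hJ
      rcases List.mem_append.1 hJ with hJ | hJ
      · obtain ⟨e1, e2, e3⟩ := b1 J hJ
        exact ⟨i1.trans e1, e2, e3.trans i3⟩
      · exact a1 J hJ
    · intro s
      rw [chi_append, chi_cons]
      exact add_le_add (b2 s) (a2 s)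
    · have := (b3.mono i1 i3).add a3
      simp only [add_zero] at this
      convert this using 1
      ext s
      rw [chi_append, chi_cons]
      ring
    · intro s
      rw [chi_cons, mul_add]
      exact (abs_add_le _ _).trans (add_le_add (b4 s) (a4 s))

/-- A small function with slope `-1` on an interval, with jumps which make up for the slope. -/
theorem exists_descending_interval {ε : ℝ} (k : ℕ) :
    ∀ a b : ℝ, a < b → b - a ≤ 2 ^ k * ε → ∃ T c P,
      IsJumpFun T a b c (fun s ↦ -chi [(a, b)] s) P 0 ∧ P Set.univ = ENNReal.ofReal (b - a) ∧
      ∀ s, |c s| ≤ ε * chi [(a, b)] s := by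
  induction k with
  | zero =>
    intro a b hab hk
    have hd : ∀ s : ℝ, HasDerivAt (fun s ↦ -(s - a)) (-1) s := fun s ↦
      ((hasDerivAt_id s).sub_const a).neg
    have hpw := isPw_indicator (a := a) (b := b) (f := fun s ↦ -(s - a)) (f' := fun _ ↦ -1) (by fun_prop) hd
    have e : (fun s ↦ -chi [(a, b)] s) = (Set.Ico a b).indicator fun _ ↦ (-1 : ℝ) := by
      ext s; rw [chi_singleton]; by_cases h : s ∈ Set.Ico a b <;> simp [h]
    -- A descent by `b - a` is undone by one upward jump at `b`. Bisection makes the amplitude small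
    -- but keeps the total mass of the jumps equal to the total length.
    refine ⟨_, _, ENNReal.ofReal (b - a) • Measure.dirac b, ⟨(Set.toFinite _).countable, e ▸ hpw,
      Measure.smul_finite _ ENNReal.ofReal_ne_top, inferInstance,
      Measure.ae_smul_measure (by simp [ae_dirac_eq]) _, by simp, fun ψ hψ hs ↦ ?_⟩, by simp,
      fun s ↦ ?_⟩
    · simp only [congrFun e]
      rw [integral_indicator_mul_deriv hab hd continuous_const hψ]
      simp [integral_smul_measure, ENNReal.toReal_ofReal (sub_nonneg.2 hab.le)]
      ring
    · rw [chi_singleton]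
      simp only [pow_zero, one_mul] at hk
      by_cases h : s ∈ Set.Ico a b
      · simp only [Set.indicator_of_mem h, mul_one, abs_neg]
        rw [abs_of_nonneg (sub_nonneg.2 h.1)]
        have := h.2
        linarith
      · simp [h]
  | succ k ih =>
    intro a b hab hk
    set m := (a + b) / 2 with hm
    have ham : a < m := by linarith
    have hmb : m < b := by linarith
    rw [pow_succ] at hk
    obtain ⟨T, c, P, h3, h2, h4⟩ := ih a m ham (by linarith)
    obtain ⟨T', c', P', h3', h2', h4'⟩ := ih m b hmb (by linarith)
    refine ⟨T ∪ T', fun s ↦ c s + c' s, P + P', ?_, ?_, ?_⟩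
    · have := (h3.mono le_rfl hmb.le).add (h3'.mono ham.le le_rfl)
      simp only [add_zero] at this
      convert this using 1
      ext s
      rw [chi_split ham.le hmb.le]
      ring
    · rw [Measure.add_apply, h2, h2', ← ENNReal.ofReal_add (by linarith) (by linarith)]
      congr 1; ring
    · intro s
      rw [chi_split ham.le hmb.le, mul_add]
      exact (abs_add_le _ _).trans (add_le_add (h4 s) (h4' s))

/-- A small function with slope `-1` on a union of intervals, with jumps which make up for the
slope. -/
theorem exists_descending {ε : ℝ} (hε : 0 < ε) {p q : ℝ} {L : List (ℝ × ℝ)}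
    (hL : IsIntervalList p q L) : ∃ T c P, IsJumpFun T p q c (fun s ↦ -chi L s) P 0 ∧
      P Set.univ = ∫⁻ s, ENNReal.ofReal (chi L s) ∧ ∀ s, |c s| ≤ ε * chi L s := by
  induction L with
  | nil =>
    refine ⟨∅, fun _ ↦ 0, 0, ?_, by simp [chi_nil], by simp [chi_nil]⟩
    simpa [chi_nil] using isJumpFun_zero p q
  | cons I L ih =>
    obtain ⟨T₁, c₁, P₁, a3, a2, a4⟩ := ih fun J hJ ↦ hL J (List.mem_cons_of_mem _ hJ)
    obtain ⟨i1, i2, i3⟩ := hL I List.mem_cons_self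
    obtain ⟨k, hk⟩ := pow_unbounded_of_one_lt ((I.2 - I.1) / ε) (one_lt_two (α := ℝ))
    obtain ⟨T₂, c₂, P₂, b3, b2, b4⟩ := exists_descending_interval k I.1 I.2 i2
      ((div_le_iff₀ hε).1 hk.le)
    refine ⟨T₂ ∪ T₁, fun s ↦ c₂ s + c₁ s, P₂ + P₁, ?_, ?_, ?_⟩
    · have := (b3.mono i1 i3).add a3
      simp only [add_zero] at this
      convert this using 1
      ext s
      rw [chi_cons]
      ring
    · have hm : Measurable (chi [I]) := by
        have : chi [I] = (Set.Ico I.1 I.2).indicator fun _ ↦ (1 : ℝ) :=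
          funext fun s ↦ chi_singleton _ s
        rw [this]; exact measurable_const.indicator measurableSet_Ico
      simp only [fun s ↦ chi_cons I L s]
      simp only [ENNReal.ofReal_add (chi_nonneg _ _) (chi_nonneg _ _)]
      rw [lintegral_add_left hm.ennreal_ofReal, Measure.add_apply, a2, b2]
      congr 1
      have : ∀ s, ENNReal.ofReal (chi [I] s) = (Set.Ico I.1 I.2).indicator 1 s := fun s ↦ by
        rw [chi_singleton]; by_cases h : s ∈ Set.Ico I.1 I.2 <;> simp [h]
      simp_rw [this]
      rw [lintegral_indicator_one measurableSet_Ico, Real.volume_Ico]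
    · intro s
      rw [chi_cons, mul_add]
      exact (abs_add_le _ _).trans (add_le_add (b4 s) (a4 s))

end OneDim

/-! ### Piecewise `C¹` functions with respect to a grid of hyperplanes -/

section Grid
open scoped ENNReal

variable {n : ℕ}

/-- `F` is `C¹` off the hyperplanes `{x_m = t}`, `t ∈ T`, and at the points which lie on only one of
the hyperplanes it is `C¹` on both sides up to the hyperplane. -/
def GridC1 (T : Set ℝ) (F : Rn n → ℝ) : Prop :=
  ∀ (x : Rn n) (l : Fin n), (∀ m, m ≠ l → x m ∉ T) → ∃ f g : Rn n → ℝ,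
    ContDiff ℝ 1 f ∧ ContDiff ℝ 1 g ∧ (∀ᶠ y in 𝓝 x, x l < y l → F y = f y) ∧
    (∀ᶠ y in 𝓝 x, y l < x l → F y = g y) ∧ (x l ∉ T → F =ᶠ[𝓝 x] f)

/-- `F` has the partial derivative `a` in direction `l` at `x`. -/
def HasPartialAt (l : Fin n) (F : Rn n → ℝ) (a : ℝ) (x : Rn n) : Prop :=
  HasDerivAt (fun s ↦ F (setCoord l s x)) a (x l)

theorem GridC1.mono {T T' : Set ℝ} {F : Rn n → ℝ} (h : GridC1 T F) (hT : T ⊆ T') :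
    GridC1 T' F := by
  intro x l hx
  obtain ⟨f, g, hf, hg, h1, h2, h3⟩ := h x l fun m hm hm' ↦ hx m hm (hT hm')
  exact ⟨f, g, hf, hg, h1, h2, fun hl ↦ h3 fun hl' ↦ hl (hT hl')⟩

theorem gridC1_const (T : Set ℝ) (k : ℝ) : GridC1 T (fun _ : Rn n ↦ k) := fun x l _ ↦
  ⟨fun _ ↦ k, fun _ ↦ k, contDiff_const, contDiff_const, by simp, by simp, fun _ ↦ by rfl⟩

theorem GridC1.add {T : Set ℝ} {F G : Rn n → ℝ} (hF : GridC1 T F) (hG : GridC1 T G) :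
    GridC1 T fun x ↦ F x + G x := by
  intro x l hx
  obtain ⟨f, g, hf, hg, h1, h2, h3⟩ := hF x l hx
  obtain ⟨f', g', hf', hg', h1', h2', h3'⟩ := hG x l hx
  refine ⟨fun y ↦ f y + f' y, fun y ↦ g y + g' y, hf.add hf', hg.add hg', ?_, ?_, fun hl ↦ ?_⟩
  · filter_upwards [h1, h1'] with y e1 e2 e; rw [e1 e, e2 e]
  · filter_upwards [h2, h2'] with y e1 e2 e; rw [e1 e, e2 e]
  · filter_upwards [h3 hl, h3' hl] with y e1 e2; rw [e1, e2]

theorem GridC1.mul {T : Set ℝ} {F G : Rn n → ℝ} (hF : GridC1 T F) (hG : GridC1 T G) :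
    GridC1 T fun x ↦ F x * G x := by
  intro x l hx
  obtain ⟨f, g, hf, hg, h1, h2, h3⟩ := hF x l hx
  obtain ⟨f', g', hf', hg', h1', h2', h3'⟩ := hG x l hx
  refine ⟨fun y ↦ f y * f' y, fun y ↦ g y * g' y, hf.mul hf', hg.mul hg', ?_, ?_, fun hl ↦ ?_⟩
  · filter_upwards [h1, h1'] with y e1 e2 e; rw [e1 e, e2 e]
  · filter_upwards [h2, h2'] with y e1 e2 e; rw [e1 e, e2 e]
  · filter_upwards [h3 hl, h3' hl] with y e1 e2; rw [e1, e2]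

theorem GridC1.prod {T : Set ℝ} {ι : Type*} (s : Finset ι) {F : ι → Rn n → ℝ}
    (hF : ∀ i ∈ s, GridC1 T (F i)) : GridC1 T fun x ↦ ∏ i ∈ s, F i x := by
  classical
  induction s using Finset.induction_on with
  | empty => simpa using gridC1_const T 1
  | insert i s hi ih =>
    simp only [Finset.prod_insert hi]
    exact (hF i (Finset.mem_insert_self _ _)).mul
      (ih fun j hj ↦ hF j (Finset.mem_insert_of_mem hj))

theorem GridC1.sum {T : Set ℝ} {ι : Type*} (s : Finset ι) {F : ι → Rn n → ℝ}
    (hF : ∀ i ∈ s, GridC1 T (F i)) : GridC1 T fun x ↦ ∑ i ∈ s, F i x := by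
  classical
  induction s using Finset.induction_on with
  | empty => simpa using gridC1_const T 0
  | insert i s hi ih =>
    simp only [Finset.sum_insert hi]
    exact (hF i (Finset.mem_insert_self _ _)).add
      (ih fun j hj ↦ hF j (Finset.mem_insert_of_mem hj))

theorem continuous_coord (j : Fin n) : Continuous fun x : Rn n ↦ x j := by fun_prop

/-- If `x_j` is exceptional, then `j` must be the one direction `l` in which the grid may be met,
and the one-sided extensions of `c` serve. Otherwise `c (x_j)` is `C¹` near `x` and the same
function serves on both sides. -/
theorem IsPw.gridC1 {T : Set ℝ} {p q : ℝ} {c c' : ℝ → ℝ} (h : IsPw T p q c c') (j : Fin n) :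
    GridC1 T fun x : Rn n ↦ c (x j) := by
  have cj : ContDiff ℝ 1 fun x : Rn n ↦ x j := by fun_prop
  intro x l hx
  have ht : Tendsto (fun y : Rn n ↦ y j) (𝓝 x) (𝓝 (x j)) := (continuous_coord j).tendsto x
  by_cases hj : x j ∈ T
  · have hjl : j = l := by by_contra hne; exact hx j hne hj
    subst hjl
    obtain ⟨f, hf, hf'⟩ := h.right (x j)
    obtain ⟨g, hg, hg'⟩ := h.left (x j)
    exact ⟨fun y ↦ f (y j), fun y ↦ g (y j), hf.comp cj, hg.comp cj, ht.eventually hf',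
      ht.eventually hg', fun hh ↦ absurd hj hh⟩
  · obtain ⟨f, hf, hf'⟩ := h.loc (x j) hj
    have := ht.eventually hf'
    exact ⟨fun y ↦ f (y j), fun y ↦ f (y j), hf.comp cj, hf.comp cj, this.mono fun _ h _ ↦ h,
      this.mono fun _ h _ ↦ h, fun _ ↦ this⟩

end Grid

/-! ### Tensor products on boxes -/

section Tensor
open scoped ENNReal

variable {n : ℕ} {p q : Fin n → ℝ}

/-- The half-open box `∏ [p_m, q_m)`. -/
def hbox (p q : Fin n → ℝ) : Set (Rn n) := {x | ∀ m, x m ∈ Set.Ico (p m) (q m)}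

/-- The part of the slab `{0 < y_l < 1}` over the `l`-th face of the box. -/
def slabBox (p q : Fin n → ℝ) (l : Fin n) : Set (Rn n) :=
  {x | x ∈ slab l ∧ ∀ m, m ≠ l → x m ∈ Set.Ico (p m) (q m)}

theorem isBounded_of_coord {S : Set (Rn n)} (a b : Fin n → ℝ)
    (h : ∀ x ∈ S, ∀ m, x m ∈ Set.Icc (a m) (b m)) : Bornology.IsBounded S := by
  have h1 : Bornology.IsBounded (WithLp.ofLp '' S) :=
    (Metric.isBounded_Icc a b).subset (by
      rintro _ ⟨x, hx, rfl⟩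
      exact ⟨fun m ↦ (h x hx m).1, fun m ↦ (h x hx m).2⟩)
  have h2 := (PiLp.antilipschitzWith_ofLp 2 fun _ : Fin n ↦ ℝ).isBounded_preimage h1
  exact h2.subset (Set.subset_preimage_image _ _)

theorem isBounded_hbox (p q : Fin n → ℝ) : Bornology.IsBounded (hbox p q) :=
  isBounded_of_coord p q fun _ hx m ↦ Set.Ico_subset_Icc_self (hx m)

theorem isBounded_slabBox (p q : Fin n → ℝ) (l : Fin n) : Bornology.IsBounded (slabBox p q l) := by
  refine isBounded_of_coord (Function.update p l 0) (Function.update q l 1) fun x hx m ↦ ?_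
  by_cases h : m = l
  · subst h; simpa using Set.Ioo_subset_Icc_self hx.1
  · simpa [h] using Set.Ico_subset_Icc_self (hx.2 m h)

theorem measurableSet_hbox (p q : Fin n → ℝ) : MeasurableSet (hbox p q) := by
  have : hbox p q = ⋂ m, (fun x : Rn n ↦ x m) ⁻¹' Set.Ico (p m) (q m) := by
    ext x; simp [hbox]
  rw [this]
  exact MeasurableSet.iInter fun m ↦ measurableSet_Ico.preimage (continuous_coord m).measurable

/-- The sum of the areas of the pairs of faces of a box. -/
noncomputable def faceArea (p q : Fin n → ℝ) : ℝ≥0∞ := ∑ l, volume (slabBox p q l)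

theorem faceArea_lt_top (p q : Fin n → ℝ) : faceArea p q < ⊤ :=
  ENNReal.sum_lt_top.2 fun l _ ↦ (isBounded_slabBox p q l).measure_lt_top

theorem slabBox_le_faceArea (p q : Fin n → ℝ) (l : Fin n) :
    volume (slabBox p q l) ≤ faceArea p q :=
  Finset.single_le_sum (f := fun l ↦ volume (slabBox p q l)) (fun _ _ ↦ zero_le) (Finset.mem_univ l)

/-- A bounded measurable function with bounded support is integrable. -/
theorem integrable_of_bdd {F : Rn n → ℝ} (hm : Measurable F) {b : ℝ} (hb : ∀ x, |F x| ≤ b)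
    {S : Set (Rn n)} (hS : Bornology.IsBounded S) (hs : ∀ x, x ∉ S → F x = 0)
    (μ : Measure (Rn n)) [IsFiniteMeasureOnCompacts μ] : Integrable F μ := by
  have : IntegrableOn F S μ :=
    Measure.integrableOn_of_bounded (M := b) hS.measure_lt_top.ne hm.aestronglyMeasurable
      (Eventually.of_forall hb)
  refine (integrableOn_iff_integrable_of_support_subset fun s hs' ↦ ?_).1 this
  by_contra h; exact hs' (hs s h)

/-- The tensor product of functions of one variable. -/
noncomputable def tens (c : Fin n → ℝ → ℝ) (x : Rn n) : ℝ := ∏ m, c m (x m)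

/-- The tensor product without the `l`-th factor. -/
noncomputable def tensErase (c : Fin n → ℝ → ℝ) (l : Fin n) (x : Rn n) : ℝ :=
  ∏ m ∈ Finset.univ.erase l, c m (x m)

theorem tens_eq (c : Fin n → ℝ → ℝ) (l : Fin n) (x : Rn n) :
    tens c x = tensErase c l x * c l (x l) := by
  rw [tens, tensErase, Finset.prod_erase_mul _ _ (Finset.mem_univ l)]

theorem tensErase_setCoord (c : Fin n → ℝ → ℝ) (l : Fin n) (s : ℝ) (x : Rn n) :
    tensErase c l (setCoord l s x) = tensErase c l x := by
  refine Finset.prod_congr rfl fun m hm ↦ ?_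
  rw [setCoord_ne (Finset.ne_of_mem_erase hm)]

theorem measurable_tensErase {c : Fin n → ℝ → ℝ} (hc : ∀ m, Measurable (c m)) (l : Fin n) :
    Measurable (tensErase c l) :=
  Finset.measurable_prod _ fun m _ ↦ (hc m).comp (continuous_coord m).measurable

theorem exists_bdd_tensErase {c : Fin n → ℝ → ℝ} (hc : ∀ m, ∃ K, ∀ s, |c m s| ≤ K) (l : Fin n) :
    ∃ K, ∀ x, |tensErase c l x| ≤ K := by
  choose K hK using hc
  refine ⟨∏ m ∈ Finset.univ.erase l, K m, fun x ↦ ?_⟩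
  rw [tensErase, Finset.abs_prod]
  exact Finset.prod_le_prod (fun _ _ ↦ abs_nonneg _) fun m _ ↦ hK m _

/-- This is the factor that a jump in direction `l` is multiplied by: the remaining factors are
bounded by `b` and live over the `l`-th face of the box. It turns smallness of one factor into
smallness of the lateral jump mass. -/
theorem lintegral_slab_tensErase_le {c : Fin n → ℝ → ℝ} (l : Fin n)
    (hs : ∀ m, ∀ s, s ∉ Set.Ico (p m) (q m) → c m s = 0) {b : ℝ}
    (hb : ∀ x, |tensErase c l x| ≤ b) :
    ∫⁻ y, ENNReal.ofReal |tensErase c l y| ∂(slabMeasure l)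
      ≤ ENNReal.ofReal b * faceArea p q := by
  calc ∫⁻ y, ENNReal.ofReal |tensErase c l y| ∂(slabMeasure l)
      ≤ ∫⁻ y in slab l, (slabBox p q l).indicator (fun _ ↦ ENNReal.ofReal b) y := by
        refine setLIntegral_mono' (measurableSet_slab l) fun y hy ↦ ?_
        by_cases hyb : y ∈ slabBox p q l
        · rw [Set.indicator_of_mem hyb]; exact ENNReal.ofReal_le_ofReal (hb y)
        · simp only [slabBox, Set.mem_ofPred_eq, hy, true_and, not_forall] at hyb
          obtain ⟨m, hm, hm'⟩ := hyb
          have : tensErase c l y = 0 :=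
            Finset.prod_eq_zero (Finset.mem_erase.2 ⟨hm, Finset.mem_univ m⟩) (hs m _ hm')
          simp [this]
    _ ≤ ∫⁻ y, (slabBox p q l).indicator (fun _ ↦ ENNReal.ofReal b) y := setLIntegral_le_lintegral _ _
    _ ≤ ENNReal.ofReal b * volume (slabBox p q l) := lintegral_indicator_const_le _ _
    _ ≤ _ := by gcongr; exact slabBox_le_faceArea p q l

/-- The weak partial derivatives of a tensor product. -/
theorem isWeakPartial_tens {T : Set ℝ} {c c' : Fin n → ℝ → ℝ} {P N : Fin n → Measure ℝ}
    (h : ∀ m, IsJumpFun T (p m) (q m) (c m) (c' m) (P m) (N m)) (l : Fin n) :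
    IsWeakPartial T l (tens c) (fun x ↦ tensErase c l x * c' l (x l))
      ((∫⁻ y, ENNReal.ofReal |tensErase c l y| ∂(slabMeasure l)) *
        (P l Set.univ + N l Set.univ)) := by
  have hmE := measurable_tensErase (fun m ↦ (h m).pw.measurable) l
  obtain ⟨K, hK⟩ := exists_bdd_tensErase (fun m ↦ (h m).pw.bdd) l
  obtain ⟨K₁, hK₁⟩ := (h l).pw.bdd
  obtain ⟨K₂, hK₂⟩ := (h l).pw.bdd'
  have hEs : ∀ x, ∀ m, m ≠ l → x m ∉ Set.Ico (p m) (q m) → tensErase c l x = 0 :=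
    fun x m hm hx ↦ Finset.prod_eq_zero (Finset.mem_erase.2 ⟨hm, Finset.mem_univ m⟩)
      ((h m).pw.supp _ hx)
  have := (h l).finP
  have := (h l).finN
  have hmul : ∀ (g : ℝ → ℝ) (k : ℝ), Measurable g → (∀ s, |g s| ≤ k) →
      (∀ s, s ∉ Set.Ico (p l) (q l) → g s = 0) →
      Integrable fun x : Rn n ↦ tensErase c l x * g (x l) := by
    intro g k hg hk hs
    refine integrable_of_bdd (F := fun x ↦ tensErase c l x * g (x l)) (b := K * k) (hmE.mul (hg.comp (continuous_coord l).measurable))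
      (fun x ↦ ?_) (isBounded_hbox p q) (fun x hx ↦ ?_) _
    · rw [abs_mul]
      exact mul_le_mul (hK x) (hk _) (abs_nonneg _) ((abs_nonneg _).trans (hK x))
    · simp only [hbox, Set.mem_ofPred_eq, not_forall] at hx
      obtain ⟨m, hm⟩ := hx
      by_cases hml : m = l
      · subst hml; rw [hs _ hm, mul_zero]
      · rw [hEs x m hml hm, zero_mul]
  refine isWeakPartial_mul l hmE (fun s y ↦ tensErase_setCoord c l s y) ?_ (h l).concP (h l).concN
    (h l).weak ?_ (hmul _ K₂ (h l).pw.measurable' hK₂ (h l).pw.supp') (fun x ↦ tens_eq c l x)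
    fun x ↦ rfl
  · refine ⟨hmE.aestronglyMeasurable, (hasFiniteIntegral_iff_norm _).2 ?_⟩
    exact (lintegral_slab_tensErase_le l (fun m ↦ (h m).pw.supp) hK).trans_lt
      (ENNReal.mul_lt_top ENNReal.ofReal_lt_top (faceArea_lt_top p q))
  · have e : tens c = fun x ↦ tensErase c l x * c l (x l) := funext (tens_eq c l)
    rw [e]
    exact hmul _ K₁ (h l).pw.measurable hK₁ (h l).pw.supp

theorem hasPartialAt_tens {T : Set ℝ} {c c' : Fin n → ℝ → ℝ} {P N : Fin n → Measure ℝ}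
    (h : ∀ m, IsJumpFun T (p m) (q m) (c m) (c' m) (P m) (N m)) (l : Fin n) {x : Rn n}
    (hx : x l ∉ T) : HasPartialAt l (tens c) (tensErase c l x * c' l (x l)) x := by
  unfold HasPartialAt
  simp only [tens_eq c l, tensErase_setCoord, setCoord_same]
  exact ((h l).pw.deriv _ hx).const_mul _

end Tensor

/-! ### Bounded functions on a box with one absolutely continuous partial derivative -/

section BoxFun
open scoped ENNReal

variable {n : ℕ}

/-- `F` is a bounded function on the box `∏ [p_m, q_m)`, piecewise smooth with respect to the grid
generated by `T`, such that `∂_j F` has absolutely continuous part `a`, the other partial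
derivatives have none, and the singular parts have mass at most `C`. -/
structure IsBoxFun (T : Set ℝ) (p q : Fin n → ℝ) (C : ℝ≥0∞) (b : ℝ) (j : Fin n)
    (F a : Rn n → ℝ) : Prop where
  countable : T.Countable
  measurable : Measurable F
  measurable' : Measurable a
  bdd : ∀ x, |F x| ≤ b
  bdd' : ∃ K, ∀ x, |a x| ≤ K
  supp : ∀ x, x ∉ hbox p q → F x = 0
  supp' : ∀ x, x ∉ hbox p q → a x = 0
  grid : GridC1 T F
  partialAt : ∀ x : Rn n, x j ∉ T → HasPartialAt j F (a x) x
  weak : ∀ l, IsWeakPartial T l F (if l = j then a else fun _ ↦ 0) C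

namespace IsBoxFun

variable {T T' : Set ℝ} {p q : Fin n → ℝ} {C C' : ℝ≥0∞} {b b' : ℝ} {j : Fin n}
  {F a F' a' : Rn n → ℝ}

theorem integrable (h : IsBoxFun T p q C b j F a) (μ : Measure (Rn n))
    [IsFiniteMeasureOnCompacts μ] : Integrable F μ :=
  integrable_of_bdd h.measurable h.bdd (isBounded_hbox p q) h.supp μ

theorem integrable' (h : IsBoxFun T p q C b j F a) (μ : Measure (Rn n))
    [IsFiniteMeasureOnCompacts μ] : Integrable a μ := by
  obtain ⟨K, hK⟩ := h.bdd'
  exact integrable_of_bdd h.measurable' hK (isBounded_hbox p q) h.supp' μ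

theorem integrable_ite (h : IsBoxFun T p q C b j F a) (l : Fin n) :
    Integrable (if l = j then a else fun _ ↦ 0) := by
  split_ifs
  · exact h.integrable' _
  · exact integrable_zero _ _ _

theorem mono (h : IsBoxFun T p q C b j F a) (hT : T ⊆ T') (hT' : T'.Countable) (hC : C ≤ C')
    (hb : b ≤ b') : IsBoxFun T' p q C' b' j F a where
  countable := hT'
  measurable := h.measurable
  measurable' := h.measurable'
  bdd x := (h.bdd x).trans hb
  bdd' := h.bdd'
  supp := h.supp
  supp' := h.supp'
  grid := h.grid.mono hT
  partialAt x hx := h.partialAt x fun hx' ↦ hx (hT hx')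
  weak l := (h.weak l).mono hT hC

theorem add (h : IsBoxFun T p q C b j F a) (h' : IsBoxFun T' p q C' b' j F' a') :
    IsBoxFun (T ∪ T') p q (C + C') (b + b') j (fun x ↦ F x + F' x) (fun x ↦ a x + a' x) where
  countable := h.countable.union h'.countable
  measurable := h.measurable.add h'.measurable
  measurable' := h.measurable'.add h'.measurable'
  bdd x := (abs_add_le _ _).trans (add_le_add (h.bdd x) (h'.bdd x))
  bdd' := by
    obtain ⟨K, hK⟩ := h.bdd'
    obtain ⟨K', hK'⟩ := h'.bdd'
    exact ⟨K + K', fun s ↦ (abs_add_le _ _).trans (add_le_add (hK s) (hK' s))⟩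
  supp x hx := by simp [h.supp x hx, h'.supp x hx]
  supp' x hx := by simp [h.supp' x hx, h'.supp' x hx]
  grid := (h.grid.mono Set.subset_union_left).add (h'.grid.mono Set.subset_union_right)
  partialAt x hx := HasDerivAt.add (h.partialAt x fun hx' ↦ hx (.inl hx'))
    (h'.partialAt x fun hx' ↦ hx (.inr hx'))
  weak l := by
    have := ((h.weak l).mono Set.subset_union_left le_rfl).add
      ((h'.weak l).mono Set.subset_union_right le_rfl) (h.integrable _) (h'.integrable _) (h.integrable_ite l)
      (h'.integrable_ite l)
    convert this using 1
    split_ifs <;> simp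

theorem const_mul (h : IsBoxFun T p q C b j F a) {k : ℝ} (hk : 0 ≤ k) :
    IsBoxFun T p q (ENNReal.ofReal k * C) (k * b) j (fun x ↦ k * F x) (fun x ↦ k * a x) where
  countable := h.countable
  measurable := h.measurable.const_mul k
  measurable' := h.measurable'.const_mul k
  bdd x := by rw [abs_mul, abs_of_nonneg hk]; gcongr; exact h.bdd x
  bdd' := by
    obtain ⟨K, hK⟩ := h.bdd'
    exact ⟨|k| * K, fun s ↦ by rw [abs_mul]; gcongr; exact hK s⟩
  supp x hx := by simp [h.supp x hx]
  supp' x hx := by simp [h.supp' x hx]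
  grid := (gridC1_const T k).mul h.grid
  partialAt x hx := HasDerivAt.const_mul k (h.partialAt x hx)
  weak l := by
    have := (h.weak l).const_mul hk
    convert this using 1
    split_ifs <;> simp

theorem zero (p q : Fin n → ℝ) (j : Fin n) :
    IsBoxFun ∅ p q 0 0 j (fun _ ↦ 0) (fun _ ↦ 0) where
  countable := Set.countable_empty
  measurable := measurable_const
  measurable' := measurable_const
  bdd := by simp
  bdd' := ⟨0, by simp⟩
  supp := by simp
  supp' := by simp
  grid := gridC1_const _ 0
  partialAt x _ := hasDerivAt_const _ _
  weak l := by simpa using isWeakPartial_zero (n := n) ∅ l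

end IsBoxFun

variable {p q : Fin n → ℝ} {i j : Fin n}

/-- The factors of `f(x_i) g(x_j) ∏ 1_{[p_m, q_m)}(x_m)`. -/
noncomputable def fam (p q : Fin n → ℝ) (i j : Fin n) (f g : ℝ → ℝ) (m : Fin n) : ℝ → ℝ :=
  if m = i then f else if m = j then g else chi [(p m, q m)]

/-- The indicator function of the box in the variables other than `x_i` and `x_j`. -/
noncomputable def kap (p q : Fin n → ℝ) (i j : Fin n) (x : Rn n) : ℝ :=
  ∏ m ∈ Finset.univ.filter fun m ↦ m ≠ i ∧ m ≠ j, chi [(p m, q m)] (x m)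

/-- The function `f(x_i) g(x_j) ∏ 1_{[p_m, q_m)}(x_m)`. -/
noncomputable def tens₂ (p q : Fin n → ℝ) (i j : Fin n) (f g : ℝ → ℝ) (x : Rn n) : ℝ :=
  f (x i) * g (x j) * kap p q i j x

theorem kap_comm (p q : Fin n → ℝ) (i j : Fin n) (x : Rn n) : kap p q i j x = kap p q j i x := by
  simp only [kap, and_comm]

theorem tens₂_comm (p q : Fin n → ℝ) (i j : Fin n) (f g : ℝ → ℝ) (x : Rn n) :
    tens₂ p q i j f g x = tens₂ p q j i g f x := by
  rw [tens₂, tens₂, kap_comm]; ring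

theorem tensErase_fam (hij : i ≠ j) (f g : ℝ → ℝ) (x : Rn n) :
    tensErase (fam p q i j f g) j x = f (x i) * kap p q i j x := by
  rw [tensErase, ← Finset.mul_prod_erase _ _ (Finset.mem_erase.2 ⟨hij, Finset.mem_univ i⟩)]
  congr 1
  · simp [fam]
  · rw [kap]
    refine Finset.prod_congr ?_ fun m hm ↦ ?_
    · ext m; simp
    · simp only [Finset.mem_filter, Finset.mem_univ, true_and] at hm
      simp [fam, hm.1, hm.2]

theorem tens_fam (hij : i ≠ j) (f g : ℝ → ℝ) : tens (fam p q i j f g) = tens₂ p q i j f g := by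
  ext x
  rw [tens_eq _ j, tensErase_fam hij, tens₂]
  simp [fam, hij.symm]
  ring

theorem chi_singleton_eq_zero_or_one (I : ℝ × ℝ) (s : ℝ) : chi [I] s = 0 ∨ chi [I] s = 1 := by
  rw [chi_singleton]; by_cases h : s ∈ Set.Ico I.1 I.2 <;> simp [h]

theorem kap_eq_zero_or_one (p q : Fin n → ℝ) (i j : Fin n) (x : Rn n) :
    kap p q i j x = 0 ∨ kap p q i j x = 1 := by
  unfold kap
  by_cases h : ∃ m ∈ Finset.univ.filter fun m ↦ m ≠ i ∧ m ≠ j, chi [(p m, q m)] (x m) = 0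
  · obtain ⟨m, hm, h0⟩ := h
    exact .inl (Finset.prod_eq_zero hm h0)
  · refine .inr (Finset.prod_eq_one fun m hm ↦ ?_)
    exact (chi_singleton_eq_zero_or_one _ _).resolve_left fun h0 ↦ h ⟨m, hm, h0⟩

/-- A tensor product `f(x_i) g(x_j) ∏ 1_{[p_m, q_m)}(x_m)` of a step function `f` and a small
function `g`. -/
theorem isBoxFun_tens₂ (hij : i ≠ j) (hpq : ∀ m, p m < q m) {Tf Tg : Set ℝ} {f g g' : ℝ → ℝ}
    {Pf Nf Pg Ng : Measure ℝ} (hf : IsJumpFun Tf (p i) (q i) f (fun _ ↦ 0) Pf Nf)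
    (hg : IsJumpFun Tg (p j) (q j) g g' Pg Ng) (hf1 : ∀ s, |f s| ≤ 1) {ε : ℝ}
    (hgε : ∀ s, |g s| ≤ ε) :
    IsBoxFun (Tf ∪ Tg ∪ (Set.range p ∪ Set.range q)) p q
      (ENNReal.ofReal ε * faceArea p q * (Pf Set.univ + Nf Set.univ + 2)
        + (∫⁻ y, ENNReal.ofReal |f (y i) * kap p q i j y| ∂(slabMeasure j))
          * (Pg Set.univ + Ng Set.univ)) ε j
      (tens₂ p q i j f g) (tens₂ p q i j f g') := by
  set T := Tf ∪ Tg ∪ (Set.range p ∪ Set.range q) with hT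
  have hTc : T.Countable := (hf.countable.union hg.countable).union
    ((Set.countable_range p).union (Set.countable_range q))
  set c := fam p q i j f g with hc
  set c' : Fin n → ℝ → ℝ := fun m ↦ if m = j then g' else fun _ ↦ 0 with hc'
  set P : Fin n → Measure ℝ := fun m ↦
    if m = i then Pf else if m = j then Pg else Measure.dirac (p m) with hP
  set N : Fin n → Measure ℝ := fun m ↦
    if m = i then Nf else if m = j then Ng else Measure.dirac (q m) with hN
  have hε : 0 ≤ ε := (abs_nonneg _).trans (hgε 0)
  have h : ∀ m, IsJumpFun T (p m) (q m) (c m) (c' m) (P m) (N m) := by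
    intro m
    by_cases h1 : m = i
    · subst h1
      simp only [hc, hc', hP, hN, fam, if_true, if_neg hij]
      exact hf.mono_set (fun x hx ↦ .inl (.inl hx)) hTc
    · by_cases h2 : m = j
      · subst h2
        simp only [hc, hc', hP, hN, fam, if_true, if_neg h1]
        exact hg.mono_set (fun x hx ↦ .inl (.inr hx)) hTc
      · simp only [hc, hc', hP, hN, fam, if_neg h1, if_neg h2]
        refine (isJumpFun_interval (hpq m)).mono_set ?_ hTc
        rintro x (rfl | rfl)
        · exact .inr (.inl ⟨m, rfl⟩)
        · exact .inr (.inr ⟨m, rfl⟩)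
  have hc1 : ∀ m, m ≠ j → ∀ s, |c m s| ≤ 1 := by
    intro m hm s
    simp only [hc, fam, if_neg hm]
    split_ifs
    · exact hf1 s
    · rcases chi_singleton_eq_zero_or_one (p m, q m) s with h | h <;> simp [h]
  have hcj : c j = g := by simp [hc, fam, hij.symm]
  -- For `l ≠ j` the remaining product still contains the small factor `g`. So every jump in a
  -- direction other than `j` carries a factor `ε`, however many jumps `f` has.
  have hE : ∀ l, l ≠ j → ∀ x, |tensErase c l x| ≤ ε := by
    intro l hl x
    rw [tensErase, ← Finset.mul_prod_erase _ _ (Finset.mem_erase.2 ⟨hl.symm, Finset.mem_univ j⟩),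
      hcj, abs_mul, Finset.abs_prod]
    refine (mul_le_mul (hgε _) (Finset.prod_le_one (fun _ _ ↦ abs_nonneg _) fun m hm ↦
      hc1 m (Finset.ne_of_mem_erase hm) _) (Finset.prod_nonneg fun _ _ ↦ abs_nonneg _) hε).trans
      (mul_one ε).le
  have ht : ∀ x, tensErase c j x = f (x i) * kap p q i j x := fun x ↦ tensErase_fam hij f g x
  have ht1 : ∀ x, |tensErase c j x| ≤ 1 := by
    intro x
    rw [tensErase, Finset.abs_prod]
    exact Finset.prod_le_one (fun _ _ ↦ abs_nonneg _) fun m hm ↦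
      hc1 m (Finset.ne_of_mem_erase hm) _
  have e1 : tens₂ p q i j f g = tens c := (tens_fam hij f g).symm
  have e2 : tens₂ p q i j f g' = fun x ↦ tensErase c j x * c' j (x j) := by
    ext x; rw [ht]; simp only [hc', if_true, tens₂]; ring
  have hs : ∀ x, x ∉ hbox p q → x j ∈ Set.Ico (p j) (q j) → tensErase c j x = 0 := by
    intro x hx hxj
    simp only [hbox, Set.mem_ofPred_eq, not_forall] at hx
    obtain ⟨m, hm⟩ := hx
    have hmj : m ≠ j := by rintro rfl; exact hm hxj
    exact Finset.prod_eq_zero (Finset.mem_erase.2 ⟨hmj, Finset.mem_univ m⟩) ((h m).pw.supp _ hm)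
  have hm := measurable_tensErase (fun m ↦ (h m).pw.measurable) j
  have e1' : tens₂ p q i j f g = fun x ↦ tensErase c j x * g (x j) := by
    ext x; rw [ht]; simp only [tens₂]; ring
  have e2' : tens₂ p q i j f g' = fun x ↦ tensErase c j x * g' (x j) := by
    ext x; rw [ht]; simp only [tens₂]; ring
  refine ⟨hTc, ?_, ?_, ?_, ?_, ?_, ?_, ?_, ?_, ?_⟩
  · rw [e1']; exact hm.mul (hg.pw.measurable.comp (continuous_coord j).measurable)
  · rw [e2']; exact hm.mul (hg.pw.measurable'.comp (continuous_coord j).measurable)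
  · intro x
    rw [e1', abs_mul]
    exact (mul_le_mul (ht1 x) (hgε _) (abs_nonneg _) zero_le_one).trans (one_mul ε).le
  · obtain ⟨K, hK⟩ := hg.pw.bdd'
    refine ⟨K, fun x ↦ ?_⟩
    rw [e2', abs_mul]
    exact (mul_le_mul (ht1 x) (hK _) (abs_nonneg _) zero_le_one).trans (one_mul K).le
  · intro x hx
    rw [e1']
    by_cases hxj : x j ∈ Set.Ico (p j) (q j)
    · simp [hs x hx hxj]
    · simp [hg.pw.supp _ hxj]
  · intro x hx
    rw [e2']
    by_cases hxj : x j ∈ Set.Ico (p j) (q j)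
    · simp [hs x hx hxj]
    · simp [hg.pw.supp' _ hxj]
  · rw [e1]; exact GridC1.prod _ fun m _ ↦ (h m).pw.gridC1 m
  · intro x hx
    rw [e1, e2]
    exact hasPartialAt_tens h j hx
  · intro l
    have hw := isWeakPartial_tens h l
    by_cases hl : l = j
    · subst hl
      rw [if_pos rfl, e1, e2]
      refine hw.mono le_rfl ?_
      simp only [ht, hP, hN, if_true, if_neg hij.symm]
      exact le_add_self
    · rw [if_neg hl, e1]
      have e0 : (fun x ↦ tensErase c l x * c' l (x l)) = fun _ ↦ 0 := by
        ext x; simp [hc', hl]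
      rw [e0] at hw
      refine hw.mono le_rfl (le_trans ?_ le_self_add)
      refine mul_le_mul' (lintegral_slab_tensErase_le l (fun m ↦ (h m).pw.supp) (hE l hl)) ?_
      simp only [hP, hN]
      by_cases hli : l = i
      · simp [hli]
      -- In the directions other than `i` and `j` the factor is the indicator of an interval, with
      -- one unit jump at each end: this is the `2` in the bound.
      · simp only [if_neg hli, if_neg hl, measure_univ]
        rw [one_add_one_eq_two]
        exact le_add_self

/-- Fubini's theorem for `h(x) c(x_l)`, where `h` does not depend on `x_l`. -/
theorem integral_mul_coord (l : Fin n) {h : Rn n → ℝ} (hl : ∀ s y, h (setCoord l s y) = h y)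
    {c : ℝ → ℝ} (hi : Integrable fun x : Rn n ↦ h x * c (x l)) :
    ∫ x : Rn n, h x * c (x l) = (∫ y, h y ∂(slabMeasure l)) * ∫ s, c s := by
  rw [integral_slab l hi]
  simp only [hl, setCoord_same, integral_const_mul]
  rw [integral_mul_const]

theorem kap_setCoord {l : Fin n} (hl : l = i ∨ l = j) (s : ℝ) (x : Rn n) :
    kap p q i j (setCoord l s x) = kap p q i j x := by
  refine Finset.prod_congr rfl fun m hm ↦ ?_
  simp only [Finset.mem_filter, Finset.mem_univ, true_and] at hm
  rw [setCoord_ne]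
  rintro rfl
  tauto

/-- The derivative of a compactly supported continuous piecewise smooth function has mean zero. -/
theorem IsJumpFun.integral_deriv_eq_zero {T : Set ℝ} {a b : ℝ} {c c' : ℝ → ℝ}
    (h : IsJumpFun T a b c c' 0 0) : ∫ s, c' s = 0 := by
  set R := max |a| |b| + 1 with hR
  have hR0 : 0 < R := by positivity
  -- The test function equals one on a neighbourhood of the support of `c`. Hence the left side of
  -- the weak formulation vanishes, and what remains is the integral of `c'`.
  let ψ : ContDiffBump (0 : ℝ) := ⟨R, R + 1, hR0, by linarith⟩
  have hmem : ∀ s ∈ Set.Ico a b, |s| < R := fun s hs ↦ by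
    have h1 := neg_abs_le a
    have h2 := le_abs_self b
    have h3 := le_max_left |a| |b|
    have h4 := le_max_right |a| |b|
    rw [abs_lt]; constructor <;> linarith [hs.1, hs.2]
  have hw := h.weak ψ ψ.contDiff ψ.hasCompactSupport
  have e1 : ∀ s, c s * deriv (ψ : ℝ → ℝ) s = 0 := by
    intro s
    by_cases hs : s ∈ Set.Ico a b
    · have : (ψ : ℝ → ℝ) =ᶠ[𝓝 s] fun _ ↦ 1 := by
        filter_upwards [Metric.isOpen_ball.mem_nhds
          (show s ∈ Metric.ball (0 : ℝ) R by simpa using hmem s hs)] with t ht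
        exact ψ.one_of_mem_closedBall (Metric.ball_subset_closedBall ht)
      rw [this.deriv_eq]; simp
    · simp [h.pw.supp s hs]
  have e2 : ∀ s, c' s * ψ s = c' s := by
    intro s
    by_cases hs : s ∈ Set.Ico a b
    · rw [ψ.one_of_mem_closedBall (by simpa using (hmem s hs).le), mul_one]
    · simp [h.pw.supp' s hs]
  simp only [e1, e2, integral_zero, integral_zero_measure, sub_zero, add_zero] at hw
  linarith

theorem IsIntervalList.chi_measurable {a b : ℝ} {L : List (ℝ × ℝ)} (hL : IsIntervalList a b L) :
    Measurable (chi L) := by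
  obtain ⟨T, P, N, h⟩ := exists_isJumpFun_chi hL
  exact h.pw.measurable

theorem IsIntervalList.chi_integrable {a b : ℝ} {L : List (ℝ × ℝ)} (hL : IsIntervalList a b L) :
    Integrable (chi L) := by
  obtain ⟨T, P, N, h⟩ := exists_isJumpFun_chi hL
  exact h.pw.integrable

/-- The sawtooth has no jumps, so its slope has mean zero; this forces the rising part to fill the
fraction `θ` of the total length. -/
theorem exists_sawtooth_integral {θ : ℝ} (h0 : 0 < θ) (h1 : θ < 1) {ε : ℝ} (hε : 0 < ε) {a b : ℝ}
    {L : List (ℝ × ℝ)} (hL : IsIntervalList a b L) : ∃ L' T c, IsIntervalList a b L' ∧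
      (∀ s, chi L' s ≤ chi L s) ∧ IsJumpFun T a b c (fun s ↦ chi L' s - θ * chi L s) 0 0 ∧
      (∀ s, |c s| ≤ ε * chi L s) ∧ ∫ s, chi L' s = θ * ∫ s, chi L s := by
  obtain ⟨L', T, c, e1, e2, e3, e4⟩ := exists_sawtooth h0 h1 hε hL
  refine ⟨L', T, c, e1, e2, e3, e4, ?_⟩
  have := e3.integral_deriv_eq_zero
  rw [integral_sub e1.chi_integrable (hL.chi_integrable.const_mul θ), integral_const_mul] at this
  linarith

end BoxFun

/-! ### The staircase of laminates: large rotation at small cost -/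

section Staircase
open scoped ENNReal

variable {n : ℕ} {p q : Fin n → ℝ} {i j : Fin n}

/-- The volume of the box, written as the integral of a tensor product. -/
noncomputable def boxVol (p q : Fin n → ℝ) (i j : Fin n) : ℝ :=
  ∫ x : Rn n, tens₂ p q i j (chi [(p i, q i)]) (chi [(p j, q j)]) x

theorem tens₂_eq_zero_or_one {f g : ℝ → ℝ} (hf : ∀ s, f s = 0 ∨ f s = 1)
    (hg : ∀ s, g s = 0 ∨ g s = 1) (x : Rn n) :
    tens₂ p q i j f g x = 0 ∨ tens₂ p q i j f g x = 1 := by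
  unfold tens₂
  rcases hf (x i) with h1 | h1 <;> rcases hg (x j) with h2 | h2 <;>
    rcases kap_eq_zero_or_one p q i j x with h3 | h3 <;> simp [h1, h2, h3]

theorem boxVol_pos (hij : i ≠ j) (hpq : ∀ m, p m < q m) : 0 < boxVol p q i j := by
  have e : ∀ x : Rn n, tens₂ p q i j (chi [(p i, q i)]) (chi [(p j, q j)]) x
      = (hbox p q).indicator 1 x := by
    intro x
    rw [← tens_fam hij]
    have hf : ∀ m, fam p q i j (chi [(p i, q i)]) (chi [(p j, q j)]) m = chi [(p m, q m)] := by
      intro m; unfold fam; split_ifs with h1 h2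
      · rw [h1]
      · rw [h2]
      · rfl
    simp only [tens, hf]
    by_cases hx : x ∈ hbox p q
    · rw [Set.indicator_of_mem hx]
      exact Finset.prod_eq_one fun m _ ↦ by
        rw [chi_singleton]; exact Set.indicator_of_mem (hx m) _
    · rw [Set.indicator_of_notMem hx]
      simp only [hbox, Set.mem_ofPred_eq, not_forall] at hx
      obtain ⟨m, hm⟩ := hx
      exact Finset.prod_eq_zero (Finset.mem_univ m) (by
        rw [chi_singleton]; exact Set.indicator_of_notMem hm _)
  rw [boxVol]
  simp_rw [e]
  rw [integral_indicator_one (measurableSet_hbox p q), measureReal_def]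
  refine ENNReal.toReal_pos ?_ (isBounded_hbox p q).measure_lt_top.ne
  have hopen : IsOpen {x : Rn n | ∀ m, x m ∈ Set.Ioo (p m) (q m)} := by
    simp only [Set.ofPred_forall]
    exact isOpen_iInter_of_finite fun m ↦ isOpen_Ioo.preimage (continuous_coord m)
  refine (lt_of_lt_of_le (hopen.measure_pos volume ?_) (measure_mono fun x hx m ↦
    Set.Ioo_subset_Ico_self (hx m))).ne'
  exact ⟨WithLp.toLp 2 fun m ↦ (p m + q m) / 2, fun m ↦ by
    constructor <;> simp <;> linarith [hpq m]⟩

/-- The `k`-th stage of the staircase: away from a set with indicator function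
`L = 1_B(x_i) 1_A(x_j)` (in the box) of relative measure `2⁻ᵏ` the absolutely continuous parts `a`
of `∂_j F` and `d` of `∂_i H` are opposite, and on this set both are `2ᵏ`. -/
def HasStage (p q : Fin n → ℝ) (i j : Fin n) (C : ℝ≥0∞) (b : ℝ) (k : ℕ) : Prop :=
  ∃ (T : Set ℝ) (A B : List (ℝ × ℝ)) (F H a d : Rn n → ℝ),
    IsIntervalList (p j) (q j) A ∧ IsIntervalList (p i) (q i) B ∧
    (∀ s, chi A s ≤ 1) ∧ (∀ s, chi B s ≤ 1) ∧
    IsBoxFun T p q C b j F a ∧ IsBoxFun T p q C b i H d ∧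
    (∀ x, a x + d x = 2 * 2 ^ k * tens₂ p q i j (chi B) (chi A) x) ∧
    (∀ x, tens₂ p q i j (chi B) (chi A) x = 1 → a x = 2 ^ k) ∧
    2 ^ k * ∫ x, tens₂ p q i j (chi B) (chi A) x = boxVol p q i j ∧
    k * boxVol p q i j / 2 ≤ ∫ x, |a x| * (1 - tens₂ p q i j (chi B) (chi A) x)

theorem integrable_tens₂_chi (hij : i ≠ j) (hpq : ∀ m, p m < q m) {A B : List (ℝ × ℝ)}
    (hA : IsIntervalList (p j) (q j) A) (hB : IsIntervalList (p i) (q i) B)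
    (hB1 : ∀ s, chi B s ≤ 1) : Integrable (tens₂ p q i j (chi B) (chi A)) := by
  obtain ⟨T, P, N, h⟩ := exists_isJumpFun_chi hB
  obtain ⟨T', P', N', h'⟩ := exists_isJumpFun_chi hA
  obtain ⟨K, hK⟩ := h'.pw.bdd
  exact (isBoxFun_tens₂ hij hpq h h'
    (fun s ↦ by rw [abs_of_nonneg (chi_nonneg _ _)]; exact hB1 s) hK).integrable _

/-- By Fubini, refining the set in one variable by the fraction `θ` multiplies the volume of the
product set by `θ`. -/
theorem integral_tens₂_of_integral_eq (hij : i ≠ j) (hpq : ∀ m, p m < q m)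
    {A A' B : List (ℝ × ℝ)} (hA : IsIntervalList (p j) (q j) A)
    (hA' : IsIntervalList (p j) (q j) A') (hB : IsIntervalList (p i) (q i) B)
    (hB1 : ∀ s, chi B s ≤ 1) {θ : ℝ} (h : ∫ s, chi A' s = θ * ∫ s, chi A s) :
    ∫ x, tens₂ p q i j (chi B) (chi A') x = θ * ∫ x, tens₂ p q i j (chi B) (chi A) x := by
  have e : ∀ A : List (ℝ × ℝ), tens₂ p q i j (chi B) (chi A)
      = fun x ↦ (chi B (x i) * kap p q i j x) * chi A (x j) := by
    intro A; ext x; rw [tens₂]; ring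
  have hl : ∀ (s : ℝ) (y : Rn n), chi B (setCoord j s y i) * kap p q i j (setCoord j s y)
      = chi B (y i) * kap p q i j y := fun s y ↦ by
    rw [kap_setCoord (.inr rfl), setCoord_ne hij]
  have i1 := integrable_tens₂_chi hij hpq hA hB hB1
  have i2 := integrable_tens₂_chi hij hpq hA' hB hB1
  rw [e] at i1 i2
  rw [e A, e A', integral_mul_coord j (h := fun x ↦ chi B (x i) * kap p q i j x) hl i1,
    integral_mul_coord j (h := fun x ↦ chi B (x i) * kap p q i j x) hl i2, h]
  ring

/-- The ramps `F = x_j - p_j` and `H = x_i - p_i`, cut off to the box, have slope one everywhere in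
the box, so the leftover set is the whole box. The cutoff jumps have some finite mass, independent
of later stages. -/
theorem hasStage_zero (hij : i ≠ j) (hpq : ∀ m, p m < q m) :
    ∃ (C : ℝ≥0∞) (b : ℝ), C < ⊤ ∧ 0 ≤ b ∧ HasStage p q i j C b 0 := by
  have key : ∀ i j : Fin n, i ≠ j → ∃ (T : Set ℝ) (C : ℝ≥0∞) (b : ℝ) (F : Rn n → ℝ), C < ⊤ ∧
      0 ≤ b ∧ IsBoxFun T p q C b j F (tens₂ p q i j (chi [(p i, q i)]) (chi [(p j, q j)])) := by
    intro i j hij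
    have hr := isJumpFun_ramp (hpq j)
    obtain ⟨K, hK⟩ := hr.pw.bdd
    have hb : ∀ s, |chi [(p i, q i)] s| ≤ 1 := fun s ↦ by
      rcases chi_singleton_eq_zero_or_one (p i, q i) s with h | h <;> simp [h]
    have hB := isJumpFun_interval (hpq i)
    have hF := isBoxFun_tens₂ hij hpq hB hr hb hK
    refine ⟨_, _, K, _, ?_, (abs_nonneg _).trans (hK 0), hF⟩
    have h1 : ∀ x : Rn n, |chi [(p i, q i)] (x i) * kap p q i j x| ≤ 1 := fun x ↦ by
      rcases chi_singleton_eq_zero_or_one (p i, q i) (x i) with h | h <;>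
        rcases kap_eq_zero_or_one p q i j x with h' | h' <;> simp [h, h']
    have h2 := lintegral_slab_tensErase_le (p := p) (q := q)
      (c := fam p q i j (chi [(p i, q i)]) (chi [(p j, q j)])) j (fun m s hs ↦ by
        unfold fam; split_ifs with h1 h2
        · subst h1; exact hB.pw.supp s hs
        · subst h2; exact (isJumpFun_interval (hpq m)).pw.supp s hs
        · exact (isJumpFun_interval (hpq m)).pw.supp s hs)
      (b := 1) (fun x ↦ by rw [tensErase_fam hij]; exact h1 x)
    simp only [tensErase_fam hij] at h2
    have hlt := h2.trans_lt (ENNReal.mul_lt_top ENNReal.ofReal_lt_top (faceArea_lt_top p q))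
    simp only [measure_univ]
    refine ENNReal.add_lt_top.2 ⟨ENNReal.mul_lt_top (ENNReal.mul_lt_top ENNReal.ofReal_lt_top
      (faceArea_lt_top p q)) (by simp), ENNReal.mul_lt_top hlt ?_⟩
    simp
  obtain ⟨T, C, b, F, hC, hb, hF⟩ := key i j hij
  obtain ⟨T', C', b', H, hC', hb', hH⟩ := key j i hij.symm
  have e : tens₂ p q j i (chi [(p j, q j)]) (chi [(p i, q i)])
      = tens₂ p q i j (chi [(p i, q i)]) (chi [(p j, q j)]) := funext fun x ↦ tens₂_comm _ _ _ _ _ _ x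
  rw [e] at hH
  have hle : ∀ l s, chi [(p l, q l)] s ≤ 1 := fun l s ↦ by
    rcases chi_singleton_eq_zero_or_one (p l, q l) s with h | h <;> simp [h]
  refine ⟨C + C', b + b', ENNReal.add_lt_top.2 ⟨hC, hC'⟩, by positivity, T ∪ T', [(p j, q j)],
    [(p i, q i)], F, H, _, _, by simp [IsIntervalList, hpq], by simp [IsIntervalList, hpq],
    hle j, hle i,
    hF.mono Set.subset_union_left (hF.countable.union hH.countable) le_self_add (by linarith),
    hH.mono Set.subset_union_right (hF.countable.union hH.countable) le_add_self (by linarith), fun x ↦ by ring,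
    fun x hx ↦ by simpa using hx, by simp [boxVol], ?_⟩
  simp only [Nat.cast_zero, zero_mul, zero_div]
  refine integral_nonneg fun x ↦ mul_nonneg (abs_nonneg _) ?_
  rcases tens₂_eq_zero_or_one (p := p) (q := q) (i := i) (j := j)
    (chi_singleton_eq_zero_or_one (p i, q i)) (chi_singleton_eq_zero_or_one (p j, q j)) x
    with h | h <;> simp [h]

/-- A sawtooth contribution of small size and small cost. -/
theorem exists_isBoxFun_sawtooth (hij : i ≠ j) (hpq : ∀ m, p m < q m) {A B : List (ℝ × ℝ)}
    (hA : IsIntervalList (p j) (q j) A) (hA1 : ∀ s, chi A s ≤ 1)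
    (hB : IsIntervalList (p i) (q i) B) (hB1 : ∀ s, chi B s ≤ 1) {θ : ℝ} (h0 : 0 < θ) (h1 : θ < 1)
    {k : ℝ} (hk : 0 ≤ k) {η : ℝ} (hη : 0 < η) :
    ∃ A' T F, IsIntervalList (p j) (q j) A' ∧ (∀ s, chi A' s ≤ chi A s) ∧
      (∫ s, chi A' s = θ * ∫ s, chi A s) ∧
      IsBoxFun T p q (ENNReal.ofReal η) η j F
        fun x ↦ k * tens₂ p q i j (chi B) (fun s ↦ chi A' s - θ * chi A s) x := by
  obtain ⟨TB, PB, NB, hBJ⟩ := exists_isJumpFun_chi hB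
  have := hBJ.finP
  have := hBJ.finN
  set M : ℝ≥0∞ := faceArea p q * (PB Set.univ + NB Set.univ + 2) with hM
  have hMt : M < ⊤ := ENNReal.mul_lt_top (faceArea_lt_top p q)
    (by simp [ENNReal.add_lt_top, measure_lt_top])
  -- The jumps of `chi B` have finite but uncontrolled mass, so the amplitude of the teeth is chosen
  -- after `B`. Adding one to both factors keeps the denominator positive and bounds both `k ε M`
  -- and `k ε` by `η`.
  set ε : ℝ := η / ((k + 1) * (M.toReal + 1)) with hε
  have hM0 : 0 ≤ M.toReal := ENNReal.toReal_nonneg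
  have hε0 : 0 < ε := by positivity
  have hkε : k * ε * (M.toReal + 1) ≤ η := by
    have : (k + 1) * ε * (M.toReal + 1) = η := by rw [hε]; field_simp
    nlinarith [mul_pos hε0 (by linarith : 0 < M.toReal + 1)]
  obtain ⟨A', T, c, a1, a2, a3, a4, a5⟩ := exists_sawtooth_integral h0 h1 hε0 hA
  have hF := (isBoxFun_tens₂ hij hpq hBJ a3
    (fun s ↦ by rw [abs_of_nonneg (chi_nonneg _ _)]; exact hB1 s)
    (ε := ε) fun s ↦ (a4 s).trans (by nlinarith [hA1 s])).const_mul hk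
  refine ⟨A', _, _, a1, a2, a5, hF.mono le_rfl hF.countable ?_ ?_⟩
  · simp only [Measure.coe_zero, Pi.zero_apply, add_zero, mul_zero, mul_assoc, ← hM]
    rw [← ENNReal.ofReal_toReal hMt.ne, ← ENNReal.ofReal_mul hε0.le, ← ENNReal.ofReal_mul hk]
    refine ENNReal.ofReal_le_ofReal ?_
    nlinarith [mul_nonneg hk hε0.le]
  · nlinarith [mul_nonneg hk hε0.le]

/-- Two laminations, one for each component, double the slopes on half of the leftover set and make
them opposite on the other half. Only arbitrarily small lateral jumps are added. -/
theorem HasStage.succ (hij : i ≠ j) (hpq : ∀ m, p m < q m) {C : ℝ≥0∞} {b : ℝ} {k : ℕ}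
    (h : HasStage p q i j C b k) {η : ℝ} (hη : 0 < η) :
    HasStage p q i j (C + ENNReal.ofReal η) (b + η) (k + 1) := by
  obtain ⟨T, A, B, F, H, a, d, hA, hB, hA1, hB1, hF, hH, had, ha, hV, hg⟩ := h
  have h2k : (0 : ℝ) < 2 ^ k := by positivity
  -- With factor `3 · 2^k` and `θ = 2/3` the added slopes are `2^k` on `A'` and `-2 · 2^k` on the
  -- rest of `A`. So `a` becomes `2 · 2^k` on `A'`, and `-2^k = -d` on the rest.
  obtain ⟨A', T₁, F₁, hA', hAA, hAi, hF₁⟩ := exists_isBoxFun_sawtooth hij hpq hA hA1 hB hB1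
    (θ := 2 / 3) (by norm_num) (by norm_num) (k := 3 * 2 ^ k) (by positivity) hη
  have hA1' : ∀ s, chi A' s ≤ 1 := fun s ↦ (hAA s).trans (hA1 s)
  -- With factor `4 · 2^k` and `θ = 3/4`, only over `A'`, the added slopes are `2^k` on `B'` and `-3
  -- · 2^k` on the rest of `B`. So `d` becomes `2 · 2^k` on `B'`, and `-2 · 2^k = -a` on the rest.
  obtain ⟨B', T₂, H₁, hB', hBB, hBi, hH₁⟩ := exists_isBoxFun_sawtooth hij.symm hpq hB hB1 hA' hA1'
    (θ := 3 / 4) (by norm_num) (by norm_num) (k := 4 * 2 ^ k) (by positivity) hη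
  have hB1' : ∀ s, chi B' s ≤ 1 := fun s ↦ (hBB s).trans (hB1 s)
  have iL := integrable_tens₂_chi hij hpq hA hB hB1
  have iL' := integrable_tens₂_chi hij hpq hA' hB' hB1'
  have hF' := hF.add hF₁
  have hH' := hH.add hH₁
  have hc := hF'.countable.union hH'.countable
  have v01 : ∀ {L : List (ℝ × ℝ)}, (∀ s, chi L s ≤ 1) → ∀ s, chi L s = 0 ∨ chi L s = 1 :=
    fun h s ↦ chi_eq_zero_or_one (h s)
  -- The leftover fraction is `2/3 · 3/4 = 1/2`, which exactly balances the doubling of the slope.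
  have hIV : 2 ^ k * ∫ x, tens₂ p q i j (chi B') (chi A') x = boxVol p q i j / 2 := by
    have e1 := integral_tens₂_of_integral_eq hij hpq hA hA' hB hB1 hAi
    have e2 := integral_tens₂_of_integral_eq hij.symm hpq hB hB' hA' hA1' hBi
    simp only [tens₂_comm p q j i] at e2
    rw [e2, e1, ← hV]; ring
  refine ⟨_, A', B', _, _, _, _, hA', hB', hA1', hB1',
    hF'.mono Set.subset_union_left hc le_rfl le_rfl,
    hH'.mono Set.subset_union_right hc le_rfl le_rfl, fun x ↦ ?_, fun x hx ↦ ?_, ?_, ?_⟩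
  · have := had x
    rw [tens₂_comm p q j i]
    simp only [tens₂] at this ⊢
    rw [pow_succ]
    linear_combination this
  · have hx' := hx
    have ha' := ha x
    simp only [tens₂] at hx ha' ⊢
    have h1 := hBB (x i)
    have h2 := hAA (x j)
    rcases kap_eq_zero_or_one p q i j x with h3 | h3
    · simp [h3] at hx
    rcases v01 hA1' (x j) with h4 | h4
    · simp [h4] at hx
    rcases v01 hB1' (x i) with h5 | h5
    · simp [h5] at hx
    have h6 : chi A (x j) = 1 := le_antisymm (hA1 _) (h4 ▸ h2)
    have h7 : chi B (x i) = 1 := le_antisymm (hB1 _) (h5 ▸ h1)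
    rw [ha' (by rw [h3, h6, h7]; ring), h3, h4, h6, h7, pow_succ]
    ring
  · rw [pow_succ]; linarith
  -- On the part of the old leftover set that is now settled, the new slope of `F` has modulus at
  -- least `2^k`; outside the old leftover set nothing has changed. Integrating gains `2^k` times
  -- half the old leftover volume, which is `V/2`.
  · have pt : ∀ x, |a x| * (1 - tens₂ p q i j (chi B) (chi A) x)
        + 2 ^ k * (tens₂ p q i j (chi B) (chi A) x - tens₂ p q i j (chi B') (chi A') x)
        ≤ |a x + 3 * 2 ^ k * tens₂ p q i j (chi B) (fun s ↦ chi A' s - 2 / 3 * chi A s) x|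
          * (1 - tens₂ p q i j (chi B') (chi A') x) := by
      intro x
      have h1 := hBB (x i)
      have h2 := hAA (x j)
      have ha' := ha x
      simp only [tens₂] at ha' ⊢
      rcases kap_eq_zero_or_one p q i j x with h3 | h3
      · simp [h3]
      rcases v01 hB1 (x i) with h4 | h4
      · have h5 : chi B' (x i) = 0 := le_antisymm (h4 ▸ h1) (chi_nonneg _ _)
        simp [h4, h5]
      rcases v01 hA1 (x j) with h6 | h6
      · have h7 : chi A' (x j) = 0 := le_antisymm (h6 ▸ h2) (chi_nonneg _ _)
        simp [h6, h7]
      rw [ha' (by rw [h3, h4, h6]; ring), h3, h4, h6]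
      rcases v01 hA1' (x j) with h8 | h8
      · rw [h8]
        have : |(2 : ℝ) ^ k + 3 * 2 ^ k * (1 * (0 - 2 / 3 * 1) * 1)| = 2 ^ k := by
          rw [show (2 : ℝ) ^ k + 3 * 2 ^ k * (1 * (0 - 2 / 3 * 1) * 1) = -2 ^ k by ring, abs_neg,
            abs_of_pos h2k]
        rw [this]; linarith
      · rw [h8]
        have : |(2 : ℝ) ^ k + 3 * 2 ^ k * (1 * (1 - 2 / 3 * 1) * 1)| = 2 * 2 ^ k := by
          rw [show (2 : ℝ) ^ k + 3 * 2 ^ k * (1 * (1 - 2 / 3 * 1) * 1) = 2 * 2 ^ k by ring,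
            abs_of_pos (by positivity)]
        rw [this]
        have := mul_nonneg h2k.le (sub_nonneg.2 (hB1' (x i)))
        nlinarith
    have bd : ∀ L : Rn n → ℝ, (∀ x, L x = 0 ∨ L x = 1) → ∀ x, ‖1 - L x‖ ≤ 1 := fun L hL x ↦ by
      rcases hL x with h | h <;> simp [h]
    have L01 := tens₂_eq_zero_or_one (p := p) (q := q) (i := i) (j := j) (v01 hB1) (v01 hA1)
    have L01' := tens₂_eq_zero_or_one (p := p) (q := q) (i := i) (j := j) (v01 hB1') (v01 hA1')
    have i1 : Integrable fun x ↦ |a x| * (1 - tens₂ p q i j (chi B) (chi A) x) :=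
      (hF.integrable' _).abs.mul_bdd (aestronglyMeasurable_const.sub iL.1)
        (Eventually.of_forall (bd _ L01))
    have i2 := (hF'.integrable' volume).abs.mul_bdd (c := 1)
      (aestronglyMeasurable_const.sub iL'.1) (Eventually.of_forall (bd _ L01'))
    have i3 : Integrable fun x ↦ (2 : ℝ) ^ k * (tens₂ p q i j (chi B) (chi A) x
        - tens₂ p q i j (chi B') (chi A') x) := (iL.sub iL').const_mul (2 ^ k)
    have := integral_mono (i1.add i3) i2 pt
    simp only [Pi.add_apply] at this
    rw [integral_add i1 i3, integral_const_mul, integral_sub iL iL', mul_sub, hV, hIV] at this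
    refine le_trans ?_ this
    push_cast
    linarith

/-- The cost and the size do not grow with the stage: the budget `η` is halved at every step, so `C`
and `b` are those of the initial ramps. -/
theorem exists_hasStage (hij : i ≠ j) (hpq : ∀ m, p m < q m) : ∃ (C : ℝ≥0∞) (b : ℝ), C < ⊤ ∧
    0 ≤ b ∧ ∀ (k : ℕ) (η : ℝ), 0 < η → HasStage p q i j (C + ENNReal.ofReal η) (b + η) k := by
  obtain ⟨C, b, hC, hb, h⟩ := hasStage_zero hij hpq
  refine ⟨C, b, hC, hb, fun k ↦ ?_⟩
  induction k with
  | zero =>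
    intro η hη
    obtain ⟨T, A, B, F, H, a, d, h1, h2, h3, h4, h5, h6, h7⟩ := h
    exact ⟨T, A, B, F, H, a, d, h1, h2, h3, h4, h5.mono le_rfl h5.countable le_self_add
      (by linarith), h6.mono le_rfl h6.countable le_self_add (by linarith), h7⟩
  | succ k ih =>
    intro η hη
    have := (ih (η / 2) (by linarith)).succ hij hpq (η := η / 2) (by linarith)
    rwa [add_assoc, add_assoc, ← ENNReal.ofReal_add (by linarith) (by linarith), add_halves]
      at this

/-- The function which removes the slope `1` in the leftover set of a stage. -/
theorem exists_isBoxFun_descending (hij : i ≠ j) (hpq : ∀ m, p m < q m) {A B : List (ℝ × ℝ)}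
    (hA : IsIntervalList (p j) (q j) A) (hA1 : ∀ s, chi A s ≤ 1)
    (hB : IsIntervalList (p i) (q i) B) (hB1 : ∀ s, chi B s ≤ 1)
    {k : ℝ} (hk : 0 ≤ k) :
    ∃ T F, IsBoxFun T p q
      (ENNReal.ofReal (1 + k * ∫ x, tens₂ p q i j (chi B) (chi A) x)) 1 j F
      fun x ↦ k * tens₂ p q i j (chi B) (fun s ↦ -chi A s) x := by
  obtain ⟨TB, PB, NB, hBJ⟩ := exists_isJumpFun_chi hB
  have := hBJ.finP
  have := hBJ.finN
  set M : ℝ≥0∞ := faceArea p q * (PB Set.univ + NB Set.univ + 2) with hM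
  have hMt : M < ⊤ := ENNReal.mul_lt_top (faceArea_lt_top p q)
    (by simp [ENNReal.add_lt_top, measure_lt_top])
  set ε : ℝ := 1 / ((k + 1) * (M.toReal + 1)) with hε
  have hM0 : 0 ≤ M.toReal := ENNReal.toReal_nonneg
  have hε0 : 0 < ε := by positivity
  have hkε : k * ε * (M.toReal + 1) ≤ 1 := by
    have : (k + 1) * ε * (M.toReal + 1) = 1 := by rw [hε]; field_simp
    nlinarith [mul_pos hε0 (by linarith : 0 < M.toReal + 1)]
  obtain ⟨T, c, P, a3, a2, a4⟩ := exists_descending hε0 hA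
  have hF := (isBoxFun_tens₂ hij hpq hBJ a3
    (fun s ↦ by rw [abs_of_nonneg (chi_nonneg _ _)]; exact hB1 s)
    (ε := ε) fun s ↦ (a4 s).trans (by nlinarith [hA1 s])).const_mul hk
  have iL := integrable_tens₂_chi hij hpq hA hB hB1
  have hL0 : ∀ x, 0 ≤ tens₂ p q i j (chi B) (chi A) x := fun x ↦ by
    rcases tens₂_eq_zero_or_one (p := p) (q := q) (i := i) (j := j)
      (fun s ↦ chi_eq_zero_or_one (hB1 s)) (fun s ↦ chi_eq_zero_or_one (hA1 s)) x with h | h <;>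
      simp [h]
  have hmL : Measurable (tens₂ p q i j (chi B) (chi A)) := by
    obtain ⟨T', P', N', h'⟩ := exists_isJumpFun_chi hA
    obtain ⟨K, hK⟩ := h'.pw.bdd
    exact (isBoxFun_tens₂ hij hpq hBJ h'
      (fun s ↦ by rw [abs_of_nonneg (chi_nonneg _ _)]; exact hB1 s) hK).measurable
  -- The mass of the one-dimensional jumps is the length of `A`. Multiplied by the area of the
  -- section in the other variables, it is the volume of the leftover set.
  have key : (∫⁻ y, ENNReal.ofReal |chi B (y i) * kap p q i j y| ∂(slabMeasure j)) * P Set.univ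
      = ENNReal.ofReal (∫ x, tens₂ p q i j (chi B) (chi A) x) := by
    rw [ofReal_integral_eq_lintegral_ofReal iL (Eventually.of_forall hL0),
      ← lintegral_slab j hmL.ennreal_ofReal, a2]
    have : ∀ (y : Rn n) (s : ℝ), ENNReal.ofReal (tens₂ p q i j (chi B) (chi A) (setCoord j s y))
        = ENNReal.ofReal |chi B (y i) * kap p q i j y| * ENNReal.ofReal (chi A s) := by
      intro y s
      rw [tens₂, setCoord_same, setCoord_ne hij, kap_setCoord (.inr rfl),
        ← ENNReal.ofReal_mul (abs_nonneg _), abs_of_nonneg]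
      · ring_nf
      · refine mul_nonneg (chi_nonneg _ _) ?_
        rcases kap_eq_zero_or_one p q i j y with h | h <;> simp [h]
    simp_rw [this]
    simp_rw [lintegral_const_mul _ hA.chi_measurable.ennreal_ofReal]
    rw [lintegral_mul_const']
    exact (hA.chi_integrable.lintegral_lt_top).ne
  refine ⟨_, _, hF.mono le_rfl hF.countable ?_ ?_⟩
  · simp only [Measure.coe_zero, Pi.zero_apply, add_zero, mul_assoc, ← hM, key]
    rw [← ENNReal.ofReal_toReal hMt.ne, ← ENNReal.ofReal_mul hε0.le,
      ← ENNReal.ofReal_add (by positivity) (integral_nonneg hL0), ← ENNReal.ofReal_mul hk]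
    refine ENNReal.ofReal_le_ofReal ?_
    nlinarith [mul_nonneg hk hε0.le]
  · nlinarith [mul_nonneg hk hε0.le]

/-- Functions `F`, `H` on a box, with small singular derivatives and opposite absolutely continuous
parts of `∂_j F` and `∂_i H` which are large in `L¹`. -/
theorem exists_large_rotation (hij : i ≠ j) (hpq : ∀ m, p m < q m) {ε : ℝ} (hε : 0 < ε) :
    ∃ (T : Set ℝ) (F H a : Rn n → ℝ), IsBoxFun T p q (ENNReal.ofReal ε) ε j F a ∧
      IsBoxFun T p q (ENNReal.ofReal ε) ε i H (fun x ↦ -a x) ∧ 1 ≤ ∫ x, |a x| := by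
  obtain ⟨C, b, hC, hb, h⟩ := exists_hasStage (p := p) (q := q) hij hpq
  set V := boxVol p q i j with hV
  have hV0 : 0 < V := boxVol_pos hij hpq
  -- After the descents the cost is at most `C + 1 + (1 + V)` and the size at most `b + 2`. Both are
  -- below `M`, so scaling by `ε / M` makes them at most `ε`.
  set M := C.toReal + V + b + 3 with hM
  have hC0 : 0 ≤ C.toReal := ENNReal.toReal_nonneg
  have hM0 : 0 < M := by positivity
  set r := ε / M with hr
  have hr0 : 0 < r := by positivity
  -- The rotation collected in `k` stages is at least `k V / 2`, and its multiple by `r` must reach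
  -- one. The scale `r` may be fixed before `k` because `M` does not depend on `k`.
  obtain ⟨k, hk⟩ := exists_nat_gt (2 / (V * r))
  obtain ⟨T, A, B, F, H, a, d, hA, hB, hA1, hB1, hF, hH, had, ha, hVk, hg⟩ := h k 1 one_pos
  have h2k : (0 : ℝ) < 2 ^ k := by positivity
  -- On the leftover set both slopes equal `2^k`; the descents reduce both to zero, and outside this
  -- set the slopes are already opposite.
  obtain ⟨T₁, F₁, hF₁⟩ := exists_isBoxFun_descending hij hpq hA hA1 hB hB1 h2k.le
  obtain ⟨T₂, H₁, hH₁⟩ := exists_isBoxFun_descending hij.symm hpq hB hB1 hA hA1 h2k.le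
  have ecomm : (fun x ↦ tens₂ p q j i (chi A) (chi B) x)
      = fun x ↦ tens₂ p q i j (chi B) (chi A) x := funext fun x ↦ tens₂_comm _ _ _ _ _ _ x
  rw [ecomm, hVk] at hH₁
  rw [hVk] at hF₁
  have hF' := (hF.add hF₁).const_mul hr0.le
  have hH' := (hH.add hH₁).const_mul hr0.le
  have hc := hF'.countable.union hH'.countable
  have hcost : ENNReal.ofReal r * (C + ENNReal.ofReal 1 + ENNReal.ofReal (1 + V))
      ≤ ENNReal.ofReal ε := by
    rw [← ENNReal.ofReal_toReal hC.ne, ← ENNReal.ofReal_add hC0 (by norm_num),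
      ← ENNReal.ofReal_add (by positivity) (by positivity), ← ENNReal.ofReal_mul hr0.le]
    refine ENNReal.ofReal_le_ofReal ?_
    have : r * M = ε := by rw [hr]; field_simp
    nlinarith
  have hsize : r * (b + 1 + 1) ≤ ε := by
    have : r * M = ε := by rw [hr]; field_simp
    nlinarith
  have eH : (fun x ↦ r * (d x + 2 ^ k * tens₂ p q j i (chi A) (fun s ↦ -chi B s) x))
      = fun x ↦ -(r * (a x + 2 ^ k * tens₂ p q i j (chi B) (fun s ↦ -chi A s) x)) := by
    ext x
    have := had x
    rw [tens₂_comm p q j i]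
    simp only [tens₂] at this ⊢
    linear_combination r * this
  refine ⟨_, _, _, _, hF'.mono Set.subset_union_left hc hcost hsize,
    eH ▸ hH'.mono Set.subset_union_right hc hcost hsize, ?_⟩
  have iL := integrable_tens₂_chi hij hpq hA hB hB1
  have L01 := tens₂_eq_zero_or_one (p := p) (q := q) (i := i) (j := j)
    (fun s ↦ chi_eq_zero_or_one (hB1 s)) (fun s ↦ chi_eq_zero_or_one (hA1 s))
  have i1 : Integrable fun x ↦ |a x| * (1 - tens₂ p q i j (chi B) (chi A) x) :=
    (hF.integrable' _).abs.mul_bdd (c := 1) (aestronglyMeasurable_const.sub iL.1)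
      (Eventually.of_forall fun x ↦ by rcases L01 x with h | h <;> simp [h])
  have pt : ∀ x, r * (|a x| * (1 - tens₂ p q i j (chi B) (chi A) x))
      ≤ |r * (a x + 2 ^ k * tens₂ p q i j (chi B) (fun s ↦ -chi A s) x)| := by
    intro x
    have e : tens₂ p q i j (chi B) (fun s ↦ -chi A s) x = -tens₂ p q i j (chi B) (chi A) x := by
      simp only [tens₂]; ring
    rw [e, abs_mul, abs_of_pos hr0]
    rcases L01 x with h | h
    · simp [h]
    · rw [h]; simp only [sub_self, mul_zero]; positivity
  have := integral_mono (i1.const_mul r) (hF'.integrable' volume).abs pt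
  rw [integral_const_mul] at this
  refine le_trans ?_ this
  rw [div_lt_iff₀ (by positivity)] at hk
  nlinarith

end Staircase

/-! ### Step functions with a large jump set -/

section Jumps
open scoped ENNReal

theorem chi_le_length (L : List (ℝ × ℝ)) (s : ℝ) : chi L s ≤ L.length := by
  induction L with
  | nil => simp [chi_nil]
  | cons I L ih =>
    rw [chi_cons, List.length_cons]
    push_cast
    rcases chi_singleton_eq_zero_or_one I s with h | h <;> rw [h] <;> linarith

/-- The one-sided limits at `s` of a sum of indicator functions of intervals with the same left
endpoint. -/
theorem exists_sides_chi {a s : ℝ} (has : a < s) (L : List (ℝ × ℝ)) (hL : ∀ I ∈ L, I.1 = a) :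
    ∃ α β : ℝ, α ≤ β ∧ ((∃ I ∈ L, I.2 = s) → α < β) ∧ (∀ᶠ y in 𝓝 s, s < y → chi L y = α) ∧
      ∀ᶠ y in 𝓝 s, y < s → chi L y = β := by
  -- With a common left end point `a < s`, the only jumps at `s` are downward jumps at right end
  -- points. Jumps of different intervals therefore add up and cannot cancel.
  induction L with
  | nil => exact ⟨0, 0, le_rfl, by simp, by simp [chi_nil], by simp [chi_nil]⟩
  | cons I L ih =>
    obtain ⟨α, β, h1, h2, h3, h4⟩ := ih fun J hJ ↦ hL J (List.mem_cons_of_mem _ hJ)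
    have hI : I.1 = a := hL I List.mem_cons_self
    have hn : ∀ᶠ y in 𝓝 s, a < y := lt_mem_nhds has
    simp only [chi_cons I L, chi_singleton, hI]
    rcases lt_trichotomy I.2 s with h | h | h
    · have hn' : ∀ᶠ y in 𝓝 s, I.2 < y := lt_mem_nhds h
      refine ⟨α, β, h1, ?_, ?_, ?_⟩
      · rintro ⟨J, hJ, hJs⟩
        rcases List.mem_cons.1 hJ with rfl | hJ
        · exact absurd hJs h.ne
        · exact h2 ⟨J, hJ, hJs⟩
      · filter_upwards [h3, hn'] with y e1 e2 e3
        rw [e1 e3, Set.indicator_of_notMem (fun h ↦ absurd h.2 (not_lt.2 e2.le)), zero_add]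
      · filter_upwards [h4, hn'] with y e1 e2 e3
        rw [e1 e3, Set.indicator_of_notMem (fun h ↦ absurd h.2 (not_lt.2 e2.le)), zero_add]
    · refine ⟨α, 1 + β, by linarith, fun _ ↦ by linarith, ?_, ?_⟩
      · filter_upwards [h3] with y e1 e3
        rw [e1 e3, Set.indicator_of_notMem (fun h' ↦ absurd h'.2 (not_lt.2 (h ▸ e3.le))), zero_add]
      · filter_upwards [h4, hn] with y e1 e2 e3
        rw [e1 e3, Set.indicator_of_mem (show y ∈ Set.Ico a I.2 from ⟨e2.le, h ▸ e3⟩)]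
    · have hn' : ∀ᶠ y in 𝓝 s, y < I.2 := gt_mem_nhds h
      refine ⟨1 + α, 1 + β, by linarith, ?_, ?_, ?_⟩
      · rintro ⟨J, hJ, hJs⟩
        rcases List.mem_cons.1 hJ with rfl | hJ
        · exact absurd hJs h.ne'
        · linarith [h2 ⟨J, hJ, hJs⟩]
      · filter_upwards [h3, hn, hn'] with y e1 e2 e4 e3
        rw [e1 e3, Set.indicator_of_mem (show y ∈ Set.Ico a I.2 from ⟨e2.le, e4⟩)]
      · filter_upwards [h4, hn, hn'] with y e1 e2 e4 e3
        rw [e1 e3, Set.indicator_of_mem (show y ∈ Set.Ico a I.2 from ⟨e2.le, e4⟩)]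

variable {n : ℕ} {p q : Fin n → ℝ} {i j : Fin n}

/-- The section `{x_i = t}` of the open box. -/
def boxSection (p q : Fin n → ℝ) (i : Fin n) (t : ℝ) : Set (Rn n) :=
  {x | x i = t ∧ ∀ m, m ≠ i → x m ∈ Set.Ioo (p m) (q m)}

theorem boxSection_area_eq (p q : Fin n → ℝ) (i : Fin n) (t : ℝ) :
    Measure.euclideanHausdorffMeasure (n - 1) (boxSection p q i t)
      = Measure.euclideanHausdorffMeasure (n - 1) (boxSection p q i 0) := by
  have hiso : Isometry fun x : Rn n ↦ x + t • EuclideanSpace.single i (1 : ℝ) :=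
    (IsometryEquiv.addRight _).isometry
  rw [← hiso.euclideanHausdorffMeasure_image (boxSection p q i 0)]
  congr 1
  ext x
  simp only [boxSection, Set.mem_ofPred_eq, Set.mem_image]
  constructor
  · rintro ⟨h1, h2⟩
    refine ⟨x - t • EuclideanSpace.single i (1 : ℝ), ⟨by simp [h1], fun m hm ↦ ?_⟩, by simp⟩
    simpa [hm] using h2 m hm
  · rintro ⟨y, ⟨h1, h2⟩, rfl⟩
    refine ⟨by simp [h1], fun m hm ↦ ?_⟩
    simpa [hm] using h2 m hm

/-- Inserting the coordinate `0` embeds `ℝⁿ⁻¹` isometrically, and the section is the image of a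
nonempty open box, whose Lebesgue measure is positive. -/
theorem boxSection_area_pos (hpq : ∀ m, p m < q m) (i : Fin n) :
    0 < Measure.euclideanHausdorffMeasure (n - 1) (boxSection p q i 0) := by
  obtain ⟨k, rfl⟩ : ∃ k, n = k + 1 := ⟨n - 1, by have := i.pos; omega⟩
  simp only [Nat.add_sub_cancel]
  let ι : Rn k → Rn (k + 1) := fun x ↦ WithLp.toLp 2 (i.insertNth (0 : ℝ) x.ofLp)
  have hι : Isometry ι := by
    refine Isometry.of_dist_eq fun x y ↦ ?_
    rw [EuclideanSpace.dist_eq, EuclideanSpace.dist_eq, Fin.sum_univ_succAbove _ i]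
    simp [ι]
  have himg : boxSection p q i 0
      = ι '' {x | ∀ m, x m ∈ Set.Ioo (p (i.succAbove m)) (q (i.succAbove m))} := by
    ext x
    simp only [boxSection, Set.mem_ofPred_eq, Set.mem_image]
    constructor
    · rintro ⟨h1, h2⟩
      refine ⟨WithLp.toLp 2 fun m ↦ x (i.succAbove m), fun m ↦ h2 _ (Fin.succAbove_ne i m), ?_⟩
      ext m
      rcases Fin.eq_self_or_eq_succAbove i m with rfl | ⟨m', rfl⟩ <;> simp [ι, h1]
    · rintro ⟨y, hy, rfl⟩
      refine ⟨by simp [ι], fun m hm ↦ ?_⟩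
      obtain ⟨m', rfl⟩ := Fin.exists_succAbove_eq hm
      simpa [ι] using hy m'
  rw [himg, hι.euclideanHausdorffMeasure_image, EuclideanSpace.euclideanHausdorffMeasure_eq_volume]
  have hopen : IsOpen {x : Rn k | ∀ m, x m ∈ Set.Ioo (p (i.succAbove m)) (q (i.succAbove m))} := by
    simp only [Set.ofPred_forall]
    exact isOpen_iInter_of_finite fun m ↦ isOpen_Ioo.preimage (continuous_coord m)
  refine hopen.measure_pos volume ⟨WithLp.toLp 2 fun m ↦
    (p (i.succAbove m) + q (i.succAbove m)) / 2, fun m ↦ ?_⟩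
  constructor <;> simp <;> linarith [hpq (i.succAbove m)]

theorem measurableSet_boxSection (p q : Fin n → ℝ) (i : Fin n) (t : ℝ) :
    MeasurableSet (boxSection p q i t) := by
  have : boxSection p q i t = (fun x : Rn n ↦ x i) ⁻¹' {t} ∩
      ⋂ m, ⋂ _ : m ≠ i, (fun x : Rn n ↦ x m) ⁻¹' Set.Ioo (p m) (q m) := by
    ext x; simp [boxSection]
  rw [this]
  exact ((measurableSet_singleton t).preimage (continuous_coord i).measurable).inter
    (MeasurableSet.iInter fun m ↦ MeasurableSet.iInter fun _ ↦
      measurableSet_Ioo.preimage (continuous_coord m).measurable)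

/-- A step function on a box with small derivative and a jump set of large area. -/
theorem exists_many_jumps (hij : i ≠ j) (hpq : ∀ m, p m < q m) {ε : ℝ} (hε : 0 < ε) :
    ∃ (T : Set ℝ) (F : Rn n → ℝ) (J : Set (Rn n)),
      IsBoxFun T p q (ENNReal.ofReal ε) ε j F (fun _ ↦ 0) ∧
      1 ≤ Measure.euclideanHausdorffMeasure (n - 1) J ∧
      ∀ x ∈ J, (∀ m, x m ∈ Set.Ioo (p m) (q m)) ∧ ∃ α β : ℝ, α ≠ β ∧
        (∀ᶠ y in 𝓝 x, x i < y i → F y = α) ∧ ∀ᶠ y in 𝓝 x, y i < x i → F y = β := by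
  -- All sections of the box by `{x_i = t}` have the same positive area, so `M` of them have total
  -- area greater than one.
  obtain ⟨M, hM⟩ := ENNReal.exists_nat_mul_gt (boxSection_area_pos hpq i).ne' ENNReal.one_ne_top
  have hM0 : 0 < M := by
    rcases Nat.eq_zero_or_pos M with rfl | h
    · simp at hM
    · exact h
  have hM0' : (0 : ℝ) < M := by exact_mod_cast hM0
  -- These `M` equally spaced points lie strictly inside `(p_i, q_i)`, so the jumps occur inside the
  -- open box.
  set t : ℕ → ℝ := fun k ↦ p i + (k + 1) / (M + 1) * (q i - p i) with ht
  have hl : 0 < q i - p i := sub_pos.2 (hpq i)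
  have ht1 : ∀ k, p i < t k := fun k ↦ by simp only [ht]; linarith [show
    0 < ((k : ℝ) + 1) / (M + 1) * (q i - p i) by positivity]
  have ht2 : ∀ k < M, t k < q i := fun k hk ↦ by
    have : ((k : ℝ) + 1) / (M + 1) < 1 := by
      rw [div_lt_one (by positivity)]
      have : (k : ℝ) < M := by exact_mod_cast hk
      linarith
    simp only [ht]; nlinarith
  have hinj : Function.Injective t := fun k l hkl ↦ by
    have h1 : ((k : ℝ) + 1) / (M + 1) = (l + 1) / (M + 1) := by
      simp only [ht, add_right_inj] at hkl
      exact mul_right_cancel₀ hl.ne' hkl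
    rw [div_left_inj' (by positivity)] at h1
    exact_mod_cast add_right_cancel h1
  set L : List (ℝ × ℝ) := (List.range M).map fun k ↦ (p i, t k) with hL
  have hLi : IsIntervalList (p i) (q i) L := by
    intro I hI
    obtain ⟨k, hk, rfl⟩ := List.mem_map.1 hI
    exact ⟨le_rfl, ht1 k, (ht2 k (List.mem_range.1 hk)).le⟩
  obtain ⟨T, P, N, hJ⟩ := exists_isJumpFun_chi hLi
  have hf := hJ.const_mul (k := 1 / M) (by positivity)
  simp only [mul_zero] at hf
  have := hf.finP
  have := hf.finN
  have hf1 : ∀ s, |1 / (M : ℝ) * chi L s| ≤ 1 := fun s ↦ by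
    rw [abs_of_nonneg (mul_nonneg (by positivity) (chi_nonneg _ _)), one_div,
      inv_mul_le_iff₀ hM0', mul_one]
    simpa [hL] using chi_le_length L s
  have hg := isJumpFun_interval (hpq j)
  have hg1 : ∀ s, |chi [(p j, q j)] s| ≤ 1 := fun s ↦ by
    rcases chi_singleton_eq_zero_or_one (p j, q j) s with h | h <;> simp [h]
  have hF := isBoxFun_tens₂ hij hpq hf hg hf1 hg1
  set C := ENNReal.ofReal 1 * faceArea p q * ((ENNReal.ofReal (1 / M) • P) Set.univ
    + (ENNReal.ofReal (1 / M) • N) Set.univ + 2)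
    + (∫⁻ y, ENNReal.ofReal |1 / (M : ℝ) * chi L (y i) * kap p q i j y| ∂(slabMeasure j))
          * ((Measure.dirac (p j)) Set.univ + (Measure.dirac (q j)) Set.univ) with hC
  have hCt : C < ⊤ := by
    have h1 : ∀ x : Rn n, |1 / (M : ℝ) * chi L (x i) * kap p q i j x| ≤ 1 := fun x ↦ by
      rw [abs_mul]
      rcases kap_eq_zero_or_one p q i j x with h' | h'
      · simp [h']
      · simpa [h'] using hf1 (x i)
    have h2 := lintegral_slab_tensErase_le (p := p) (q := q)
      (c := fam p q i j (fun s ↦ 1 / (M : ℝ) * chi L s) (chi [(p j, q j)])) j (fun m s hs ↦ by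
        unfold fam; split_ifs with h1 h2
        · subst h1; exact hf.pw.supp s hs
        · subst h2; exact hg.pw.supp s hs
        · exact (isJumpFun_interval (hpq m)).pw.supp s hs)
      (b := 1) (fun x ↦ by rw [tensErase_fam hij]; exact h1 x)
    simp only [tensErase_fam hij] at h2
    have hlt := h2.trans_lt (ENNReal.mul_lt_top ENNReal.ofReal_lt_top (faceArea_lt_top p q))
    refine ENNReal.add_lt_top.2 ⟨ENNReal.mul_lt_top (ENNReal.mul_lt_top ENNReal.ofReal_lt_top
      (faceArea_lt_top p q)) ?_, ENNReal.mul_lt_top hlt ?_⟩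
    · simp only [ENNReal.add_lt_top, measure_lt_top, true_and]; simp
    · simp
  -- Multiplication by a small positive constant makes size and jump mass small and leaves the jump
  -- set as it is.
  set r := ε / (C.toReal + 1) with hr
  have hC0 : 0 ≤ C.toReal := ENNReal.toReal_nonneg
  have hr0 : 0 < r := by positivity
  have hrC : r * (C.toReal + 1) = ε := by rw [hr]; field_simp
  have hF' := hF.const_mul hr0.le
  have e0 : (fun x ↦ r * tens₂ p q i j (fun s ↦ 1 / (M : ℝ) * chi L s) (fun _ ↦ 0) x)
      = fun _ : Rn n ↦ (0 : ℝ) := by ext x; simp [tens₂]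
  rw [e0] at hF'
  refine ⟨_, _, ⋃ k ∈ Finset.range M, boxSection p q i (t k), hF'.mono le_rfl hF'.countable ?_ ?_,
    ?_, ?_⟩
  · rw [← ENNReal.ofReal_toReal hCt.ne, ← ENNReal.ofReal_mul hr0.le]
    exact ENNReal.ofReal_le_ofReal (by nlinarith)
  · nlinarith
  · rw [measure_biUnion_finset]
    · simp only [boxSection_area_eq, Finset.sum_const, Finset.card_range, nsmul_eq_mul]
      exact hM.le
    · intro k _ l _ hkl
      refine Set.disjoint_left.2 fun x hx hx' ↦ hkl (hinj ?_)
      rw [← hx.1, ← hx'.1]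
    · exact fun k _ ↦ measurableSet_boxSection p q i (t k)
  · intro x hx
    simp only [Set.mem_iUnion, Finset.mem_range] at hx
    obtain ⟨k, hk, hxi, hxm⟩ := hx
    have hxb : ∀ m, x m ∈ Set.Ioo (p m) (q m) := fun m ↦ by
      by_cases hm : m = i
      · subst hm; rw [hxi]; exact ⟨ht1 k, ht2 k hk⟩
      · exact hxm m hm
    obtain ⟨α, β, -, hαβ, h1, h2⟩ := exists_sides_chi (a := p i) (s := x i) (hxi ▸ ht1 k) L
      (fun I hI ↦ by obtain ⟨k, -, rfl⟩ := List.mem_map.1 hI; rfl)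
    have hlt := hαβ ⟨(p i, t k), List.mem_map.2 ⟨k, List.mem_range.2 hk, rfl⟩, hxi.symm⟩
    have hopen : IsOpen {x : Rn n | ∀ m, x m ∈ Set.Ioo (p m) (q m)} := by
      simp only [Set.ofPred_forall]
      exact isOpen_iInter_of_finite fun m ↦ isOpen_Ioo.preimage (continuous_coord m)
    have hev : ∀ᶠ y in 𝓝 x, ∀ m, y m ∈ Set.Ioo (p m) (q m) := hopen.mem_nhds hxb
    have hone : ∀ (m : Fin n) (y : Rn n), y m ∈ Set.Ioo (p m) (q m) →
        chi [(p m, q m)] (y m) = 1 := fun m y hy ↦ by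
      rw [chi_singleton, Set.indicator_of_mem (Set.Ioo_subset_Ico_self hy)]
    have hval : ∀ y : Rn n, (∀ m, y m ∈ Set.Ioo (p m) (q m)) →
        r * tens₂ p q i j (fun s ↦ 1 / (M : ℝ) * chi L s) (chi [(p j, q j)]) y
          = r / M * chi L (y i) := fun y hy ↦ by
      have hk1 : kap p q i j y = 1 := Finset.prod_eq_one fun m _ ↦ hone m y (hy m)
      rw [tens₂, hone j y (hy j), hk1]; ring
    have hti : Tendsto (fun y : Rn n ↦ y i) (𝓝 x) (𝓝 (x i)) := (continuous_coord i).tendsto x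
    refine ⟨hxb, r / M * α, r / M * β, ?_, ?_, ?_⟩
    · exact (mul_lt_mul_of_pos_left hlt (by positivity)).ne
    · filter_upwards [hev, hti.eventually h1] with y e1 e2 e3
      rw [hval y e1, e2 e3]
    · filter_upwards [hev, hti.eventually h2] with y e1 e2 e3
      rw [hval y e1, e2 e3]

end Jumps

/-! ### Integration by parts on both sides of a hyperplane -/

section HalfSpace
open scoped ENNReal

variable {n : ℕ}

theorem integral_faceMeasure (l : Fin n) (t : ℝ) {k : Rn n → ℝ} (hk : Continuous k) :
    ∫ x, k x ∂(faceMeasure l t) = ∫ y, k (setCoord l t y) ∂(slabMeasure l) :=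
  integral_map (continuous_setCoord_const l t).measurable.aemeasurable
    hk.aestronglyMeasurable

theorem faceMeasure_apply_lt_top {l : Fin n} {t : ℝ} {S : Set (Rn n)} (hS : MeasurableSet S)
    (hb : Bornology.IsBounded S) : faceMeasure l t S < ⊤ := by
  obtain ⟨R, hR⟩ := hb.subset_closedBall 0
  rw [faceMeasure, Measure.map_apply (continuous_setCoord_const l t).measurable hS,
    Measure.restrict_apply ((continuous_setCoord_const l t).measurable hS)]
  refine (isBounded_of_coord (fun _ ↦ -(|R| + 1)) (fun _ ↦ |R| + 1)
    fun y hy m ↦ ?_).measure_lt_top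
  have hR0 : R ≤ |R| := le_abs_self R
  have hR1 : 0 ≤ |R| := abs_nonneg R
  by_cases hm : m = l
  · subst hm
    have := hy.2
    simp only [slab, Set.mem_ofPred_eq, Set.mem_Ioo] at this
    constructor <;> linarith
  · have h1 := hR hy.1
    rw [mem_closedBall_zero_iff] at h1
    have h2 := (PiLp.norm_apply_le (setCoord l t y) m).trans h1
    rw [setCoord_ne hm, Real.norm_eq_abs, abs_le] at h2
    constructor <;> linarith

theorem faceMeasure_compl_face (l : Fin n) (t : ℝ) :
    faceMeasure l t {x : Rn n | x l ≠ t} = 0 := by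
  have hm : MeasurableSet {x : Rn n | x l ≠ t} :=
    (measurableSet_singleton t).compl.preimage (continuous_coord l).measurable
  rw [faceMeasure, Measure.map_apply (continuous_setCoord_const l t).measurable hm]
  simp

theorem measurableSet_lt_coord (l : Fin n) (t : ℝ) : MeasurableSet {x : Rn n | t < x l} :=
  measurableSet_Ioi.preimage (continuous_coord l).measurable

theorem measurableSet_coord_lt (l : Fin n) (t : ℝ) : MeasurableSet {x : Rn n | x l < t} :=
  measurableSet_Iio.preimage (continuous_coord l).measurable

/-- Integration by parts on the half spaces `{y_l > t}` and `{y_l < t}`. -/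
theorem integral_halfSpace_partialDeriv {ψ : Rn n → ℝ} (hψ : ContDiff ℝ 1 ψ)
    (hc : HasCompactSupport ψ) (l j : Fin n) (t : ℝ) :
    (∫ x in {x | t < x l}, partialDeriv j ψ x
      = -(if j = l then ∫ x, ψ x ∂(faceMeasure l t) else 0)) ∧
    ∫ x in {x | x l < t}, partialDeriv j ψ x
      = if j = l then ∫ x, ψ x ∂(faceMeasure l t) else 0 := by
  have hi : Integrable (partialDeriv j ψ) :=
    (continuous_partialDeriv hψ j).integrable_of_hasCompactSupport
      (hasCompactSupport_partialDeriv hc j)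
  have hder : ∀ y : Rn n, deriv (fun s ↦ ψ (setCoord j s y))
      = fun s ↦ partialDeriv j ψ (setCoord j s y) := fun y ↦ funext fun s ↦
    (hasDerivAt_comp_setCoord (hψ.differentiable one_ne_zero) j y s).deriv
  have hcd : ∀ y : Rn n, ContDiff ℝ 1 fun s ↦ ψ (setCoord j s y) := fun y ↦
    hψ.comp (contDiff_setCoord j y)
  have hcs := hasCompactSupport_comp_setCoord hc j
  have m1 := measurableSet_lt_coord l t
  have m2 := measurableSet_coord_lt l t
  rw [← integral_indicator m1, ← integral_indicator m2, integral_slab j (hi.indicator m1),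
    integral_slab j (hi.indicator m2)]
  by_cases hjl : j = l
  · subst hjl
    rw [if_pos rfl, integral_faceMeasure j t hψ.continuous, ← integral_neg]
    constructor
    · refine integral_congr_ae (Eventually.of_forall fun y ↦ ?_)
      have e : (fun s ↦ Set.indicator {x : Rn n | t < x j} (partialDeriv j ψ) (setCoord j s y))
          = (Set.Ioi t).indicator fun s ↦ partialDeriv j ψ (setCoord j s y) := by
        ext s; simp [Set.indicator_apply]
      simp only [e]
      rw [integral_indicator measurableSet_Ioi, ← hder y, (hcs y).integral_Ioi_deriv_eq (hcd y)]
    · refine integral_congr_ae (Eventually.of_forall fun y ↦ ?_)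
      have e : (fun s ↦ Set.indicator {x : Rn n | x j < t} (partialDeriv j ψ) (setCoord j s y))
          = (Set.Iio t).indicator fun s ↦ partialDeriv j ψ (setCoord j s y) := by
        ext s; simp [Set.indicator_apply]
      simp only [e]
      rw [integral_indicator measurableSet_Iio, ← hder y, ← integral_Iic_eq_integral_Iio,
        (hcs y).integral_Iic_deriv_eq (hcd y)]
  -- For `j ≠ l` the lines in direction `j` do not cross the hyperplane, so there is no boundary
  -- term.
  · have z : ∀ y : Rn n, ∫ s, partialDeriv j ψ (setCoord j s y) = 0 := fun y ↦ by
      rw [← hder y]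
      exact integral_eq_zero_of_hasDerivAt_of_integrable
        (fun s ↦ ((hcd y).differentiable one_ne_zero s).hasDerivAt)
        ((((hcd y).continuous_deriv le_rfl)).integrable_of_hasCompactSupport (hcs y).deriv)
        ((hcd y).continuous.integrable_of_hasCompactSupport (hcs y))
    simp only [if_neg hjl, neg_zero]
    constructor
    · refine integral_eq_zero_of_ae (Eventually.of_forall fun y ↦ ?_)
      by_cases h : t < y l
      · simpa [Set.indicator_apply, setCoord_ne (Ne.symm hjl), h] using z y
      · simp [setCoord_ne (Ne.symm hjl), h]
    · refine integral_eq_zero_of_ae (Eventually.of_forall fun y ↦ ?_)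
      by_cases h : y l < t
      · simpa [Set.indicator_apply, setCoord_ne (Ne.symm hjl), h] using z y
      · simp [setCoord_ne (Ne.symm hjl), h]

theorem partialDeriv_mul {f φ : Rn n → ℝ} (hf : ContDiff ℝ 1 f) (hφ : ContDiff ℝ 1 φ) (j : Fin n)
    (x : Rn n) : partialDeriv j (fun y ↦ f y * φ y) x
      = f x * partialDeriv j φ x + partialDeriv j f x * φ x := by
  have h1 := hf.differentiable one_ne_zero x
  have h2 := hφ.differentiable one_ne_zero x
  unfold partialDeriv
  rw [fderiv_fun_mul h1 h2]
  simp; ring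

theorem volume_face (l : Fin n) (t : ℝ) : volume {x : Rn n | x l = t} = 0 := by
  have hm : MeasurableSet {x : Rn n | x l = t} :=
    (measurableSet_singleton t).preimage (continuous_coord l).measurable
  rw [← lintegral_indicator_one hm, ← lintegral_slab l (measurable_one.indicator hm)]
  have : ∀ (y : Rn n) (s : ℝ), Set.indicator {x : Rn n | x l = t} (1 : Rn n → ℝ≥0∞) (setCoord l s y)
      = ({t} : Set ℝ).indicator 1 s := fun y s ↦ by simp [Set.indicator_apply]
  simp_rw [this, lintegral_indicator_one (measurableSet_singleton t)]
  simp

/-- The partial derivative of the function which is `f` on `{y_l > t}` and `g` on `{y_l < t}`. -/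
noncomputable def sideDeriv (l : Fin n) (t : ℝ) (j : Fin n) (f g : Rn n → ℝ) (x : Rn n) : ℝ :=
  Set.indicator {x : Rn n | t < x l} (partialDeriv j f) x
    + Set.indicator {x : Rn n | x l < t} (partialDeriv j g) x

/-- The density of the jump part of the `j`-th weak partial derivative of the function which is
`f` on `{y_l > t}` and `g` on `{y_l < t}`. -/
noncomputable def sideJump (l j : Fin n) (f g : Rn n → ℝ) (x : Rn n) : ℝ :=
  if j = l then f x - g x else 0

instance isFiniteMeasureOnCompacts_faceMeasure (l : Fin n) (t : ℝ) :
    IsFiniteMeasureOnCompacts (faceMeasure l t) :=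
  ⟨fun _ hK ↦ faceMeasure_apply_lt_top hK.measurableSet hK.isBounded⟩

theorem integrableOn_sideDeriv {f g : Rn n → ℝ} (hf : ContDiff ℝ 1 f) (hg : ContDiff ℝ 1 g)
    (l : Fin n) (t : ℝ) (j : Fin n) {K : Set (Rn n)} (hK : IsCompact K) :
    IntegrableOn (sideDeriv l t j f g) K := by
  have h1 : IntegrableOn (partialDeriv j f) K :=
    (continuous_partialDeriv hf j).continuousOn.integrableOn_compact hK
  have h2 : IntegrableOn (partialDeriv j g) K :=
    (continuous_partialDeriv hg j).continuousOn.integrableOn_compact hK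
  exact (h1.indicator (measurableSet_lt_coord l t)).add (h2.indicator (measurableSet_coord_lt l t))

theorem continuous_sideJump {f g : Rn n → ℝ} (hf : ContDiff ℝ 1 f) (hg : ContDiff ℝ 1 g)
    (l j : Fin n) : Continuous (sideJump l j f g) := by
  unfold sideJump
  split_ifs
  · exact hf.continuous.sub hg.continuous
  · exact continuous_const

/-- The weak partial derivative of a function which is `C¹` on both sides of `{y_l = t}`, tested in
a set on which it agrees with two `C¹` functions. -/
theorem integral_twoSided_mul_partialDeriv {W : Set (Rn n)} {F f g : Rn n → ℝ}
    (hf : ContDiff ℝ 1 f) (hg : ContDiff ℝ 1 g) {l : Fin n} {t : ℝ}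
    (h1 : ∀ y ∈ W, t < y l → F y = f y) (h2 : ∀ y ∈ W, y l < t → F y = g y) {φ : Rn n → ℝ}
    (hφ : ContDiff ℝ 1 φ) (hc : HasCompactSupport φ) (hW : tsupport φ ⊆ W) (j : Fin n) :
    Integrable (fun x ↦ F x * partialDeriv j φ x) ∧
    Integrable (fun x ↦ sideDeriv l t j f g x * φ x) ∧
    ∫ x, F x * partialDeriv j φ x = -(∫ x, sideDeriv l t j f g x * φ x)
      - ∫ x, sideJump l j f g x * φ x ∂(faceMeasure l t) := by
  have m1 := measurableSet_lt_coord l t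
  have m2 := measurableSet_coord_lt l t
  have hp := continuous_partialDeriv hφ j
  have hpc := hasCompactSupport_partialDeriv hc j
  have hz : ∀ x, x ∉ W → partialDeriv j φ x = 0 := fun x hx ↦ by
    have : fderiv ℝ φ x = 0 := by
      by_contra hne
      exact hx (hW (support_fderiv_subset ℝ hne))
    simp [partialDeriv, this]
  have if1 : Integrable fun x ↦ f x * partialDeriv j φ x :=
    (hf.continuous.mul hp).integrable_of_hasCompactSupport hpc.mul_left
  have ig1 : Integrable fun x ↦ g x * partialDeriv j φ x :=
    (hg.continuous.mul hp).integrable_of_hasCompactSupport hpc.mul_left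
  have if2 : Integrable fun x ↦ partialDeriv j f x * φ x :=
    ((continuous_partialDeriv hf j).mul hφ.continuous).integrable_of_hasCompactSupport hc.mul_left
  have ig2 : Integrable fun x ↦ partialDeriv j g x * φ x :=
    ((continuous_partialDeriv hg j).mul hφ.continuous).integrable_of_hasCompactSupport hc.mul_left
  have ae : (fun x ↦ F x * partialDeriv j φ x) =ᵐ[volume] fun x ↦
      Set.indicator {x | t < x l} (fun x ↦ f x * partialDeriv j φ x) x
        + Set.indicator {x | x l < t} (fun x ↦ g x * partialDeriv j φ x) x := by
    have : ∀ᵐ x : Rn n, x l ≠ t := by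
      rw [ae_iff]; simpa using volume_face l t
    filter_upwards [this] with x hx
    by_cases hxW : x ∈ W
    · rcases lt_or_gt_of_ne hx with hlt | hlt
      · simp [hlt, hlt.not_gt, h2 x hxW hlt]
      · simp [hlt, hlt.not_gt, h1 x hxW hlt]
    · simp [Set.indicator_apply, hz x hxW]
  have es : (fun x ↦ sideDeriv l t j f g x * φ x) = fun x ↦
      Set.indicator {x | t < x l} (fun x ↦ partialDeriv j f x * φ x) x
        + Set.indicator {x | x l < t} (fun x ↦ partialDeriv j g x * φ x) x := by
    ext x; simp [sideDeriv, Set.indicator_apply, add_mul]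
  refine ⟨((if1.indicator m1).add (ig1.indicator m2)).congr ae.symm, ?_, ?_⟩
  · rw [es]; exact (if2.indicator m1).add (ig2.indicator m2)
  rw [integral_congr_ae ae, integral_add (if1.indicator m1) (ig1.indicator m2),
    integral_indicator m1, integral_indicator m2]
  have ef := (integral_halfSpace_partialDeriv (hf.mul hφ) hc.mul_left l j t).1
  have eg := (integral_halfSpace_partialDeriv (hg.mul hφ) hc.mul_left l j t).2
  simp only [partialDeriv_mul hf hφ] at ef
  simp only [partialDeriv_mul hg hφ] at eg
  rw [integral_add if1.integrableOn if2.integrableOn] at ef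
  rw [integral_add ig1.integrableOn ig2.integrableOn] at eg
  have i1 : ∫ x, sideDeriv l t j f g x * φ x = (∫ x in {x | t < x l}, partialDeriv j f x * φ x)
      + ∫ x in {x | x l < t}, partialDeriv j g x * φ x := by
    rw [es, integral_add (if2.indicator m1) (ig2.indicator m2), integral_indicator m1,
      integral_indicator m2]
  rw [i1]
  have i3 : ∫ x, sideJump l j f g x * φ x ∂(faceMeasure l t)
      = (if j = l then ∫ x, f x * φ x ∂(faceMeasure l t) else 0)
        - if j = l then ∫ x, g x * φ x ∂(faceMeasure l t) else 0 := by
    unfold sideJump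
    split_ifs
    · simp only [sub_mul]
      exact integral_sub
        ((hf.continuous.mul hφ.continuous).integrable_of_hasCompactSupport hc.mul_left)
        ((hg.continuous.mul hφ.continuous).integrable_of_hasCompactSupport hc.mul_left)
    · simp
  rw [i3]
  linarith

end HalfSpace

/-! ### Null sets of measures that are absolutely continuous on a grid -/

section Grid
open scoped ENNReal

variable {n : ℕ}

/-- The union of the hyperplanes `{x_m = t}`, `t ∈ T`. -/
def grid (n : ℕ) (T : Set ℝ) : Set (Rn n) := {x | ∃ m, x m ∈ T}

/-- The points which lie on at least two hyperplanes `{x_m = t}`, `t ∈ T`. -/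
def gridCorners (n : ℕ) (T : Set ℝ) : Set (Rn n) := {x | ∃ l m, m ≠ l ∧ x l ∈ T ∧ x m ∈ T}

variable {T : Set ℝ}

theorem measurableSet_grid (hT : T.Countable) : MeasurableSet (grid n T) := by
  have : grid n T = ⋃ m, (fun x : Rn n ↦ x m) ⁻¹' T := by ext x; simp [grid]
  rw [this]
  exact MeasurableSet.iUnion fun m ↦ hT.measurableSet.preimage (continuous_coord m).measurable

theorem volume_grid (hT : T.Countable) : volume (grid n T) = 0 := by
  have : grid n T = ⋃ m, ⋃ t ∈ T, {x : Rn n | x m = t} := by ext x; simp [grid]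
  rw [this, measure_iUnion_null_iff]
  exact fun m ↦ (measure_biUnion_null_iff hT).2 fun t _ ↦ volume_face m t

theorem measurableSet_gridCorners (hT : T.Countable) : MeasurableSet (gridCorners n T) := by
  have hm : ∀ m, MeasurableSet {x : Rn n | x m ∈ T} := fun m ↦
    hT.measurableSet.preimage (continuous_coord m).measurable
  have : gridCorners n T = ⋃ l, ⋃ m, ⋃ (_ : m ≠ l), {x | x l ∈ T} ∩ {x | x m ∈ T} := by
    ext x; simp only [gridCorners, Set.mem_ofPred_eq, Set.mem_iUnion, Set.mem_inter_iff, exists_prop]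
  rw [this]
  exact MeasurableSet.iUnion fun l ↦ MeasurableSet.iUnion fun m ↦ MeasurableSet.iUnion fun _ ↦
    (hm l).inter (hm m)

theorem FaceAC.compl_grid {P : Measure (Rn n)} (h : FaceAC T P) (hT : T.Countable) :
    P (grid n T)ᶜ = 0 := by
  refine h _ (measurableSet_grid hT).compl fun l t ht ↦ ?_
  refine measure_mono_null (fun x hx ↦ ?_) (faceMeasure_compl_face l t)
  rintro rfl
  exact hx ⟨l, ht⟩

/-- A corner on the hyperplane `{x_l = t}` has another coordinate in the countable set `T`, so
corners have zero area there. For this reason regularity is needed only at points on at most one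
hyperplane. -/
theorem FaceAC.gridCorners {P : Measure (Rn n)} (h : FaceAC T P) (hT : T.Countable) :
    P (gridCorners n T) = 0 := by
  refine h _ (measurableSet_gridCorners hT) fun l t ht ↦ ?_
  rw [faceMeasure, Measure.map_apply (continuous_setCoord_const l t).measurable
    (measurableSet_gridCorners hT)]
  refine Measure.absolutelyContinuous_of_le Measure.restrict_le_self
    (measure_mono_null (fun y hy ↦ ?_) (volume_grid hT))
  obtain ⟨i, j, hij, hi, hj⟩ := hy
  by_cases hjl : j = l
  · subst hjl
    exact ⟨i, by rwa [setCoord_ne hij.symm] at hi⟩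
  · exact ⟨j, by rwa [setCoord_ne hjl] at hj⟩

/-- Only the part of a `FaceAC` measure in the grid matters. -/
theorem FaceAC.inter_grid {P : Measure (Rn n)} (h : FaceAC T P) (hT : T.Countable)
    (S : Set (Rn n)) : P (S ∩ grid n T) = P S :=
  measure_inter_conull' (measure_mono_null (fun _ hx ↦ hx.2) (h.compl_grid hT))

end Grid

/-! ### Comparison of measures whose difference has a density -/

section Densities
open scoped ENNReal

variable {n : ℕ}

theorem integral_withDensity_sub {μ : Measure (Rn n)} {h φ : Rn n → ℝ} (hh : Integrable h μ)
    (hφ : Continuous φ) (hc : HasCompactSupport φ) :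
    (∫ x, φ x ∂(μ.withDensity fun x ↦ ENNReal.ofReal (h x)))
      - ∫ x, φ x ∂(μ.withDensity fun x ↦ ENNReal.ofReal (-h x)) = ∫ x, h x * φ x ∂μ := by
  obtain ⟨C, hC⟩ := hc.exists_bound_of_continuous hφ
  have hn : AEMeasurable (fun x ↦ -h x) μ := hh.neg.aemeasurable
  have b : ∀ k : Rn n → ℝ, Integrable k μ → Integrable (fun x ↦ k x * φ x) μ := fun k hk ↦
    hk.mul_bdd hφ.aestronglyMeasurable (Eventually.of_forall hC)
  rw [integral_withDensity_eq_integral_toReal_smul₀ hh.aemeasurable.ennreal_ofReal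
      (Eventually.of_forall fun _ ↦ ENNReal.ofReal_lt_top),
    integral_withDensity_eq_integral_toReal_smul₀ hn.ennreal_ofReal
      (Eventually.of_forall fun _ ↦ ENNReal.ofReal_lt_top)]
  simp only [ENNReal.toReal_ofReal', smul_eq_mul]
  rw [← integral_sub (b _ hh.pos_part) (b _ hh.neg_part)]
  refine integral_congr_ae (Eventually.of_forall fun x ↦ ?_)
  simp only [← sub_mul]
  congr 1
  rcases le_total (h x) 0 with h0 | h0
  · rw [max_eq_right h0, max_eq_left (by linarith)]; ring
  · rw [max_eq_left h0, max_eq_right (by linarith)]; ring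

/-- The identity `P + h μ = N` on test functions is rewritten between positive finite measures by
moving the negative part of `h` to the other side, so that no subtraction of measures occurs. -/
theorem measure_add_withDensity_eq {W : Set (Rn n)} (hW : IsOpen W) {P N : Measure (Rn n)}
    [IsFiniteMeasure P] [IsFiniteMeasure N] {μ : Measure (Rn n)} {h : Rn n → ℝ}
    (hh : Integrable h μ)
    (H : ∀ φ, IsTestFunction W φ → (∫ x, φ x ∂P) + ∫ x, h x * φ x ∂μ = ∫ x, φ x ∂N)
    {S : Set (Rn n)} (hSW : S ⊆ W) (hS : MeasurableSet S) :
    P S + (μ.withDensity fun x ↦ ENNReal.ofReal (h x)) S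
      = N S + (μ.withDensity fun x ↦ ENNReal.ofReal (-h x)) S := by
  have f1 : IsFiniteMeasure (μ.withDensity fun x ↦ ENNReal.ofReal (h x)) :=
    isFiniteMeasure_withDensity_ofReal hh.2
  have f2 : IsFiniteMeasure (μ.withDensity fun x ↦ ENNReal.ofReal (-h x)) :=
    isFiniteMeasure_withDensity_ofReal hh.neg.2
  rw [← Measure.add_apply, ← Measure.add_apply]
  refine measure_eq_of_integral_testFunction_eq hW _ _ (fun φ hφ ↦ ?_) hSW hS
  have e := integral_withDensity_sub hh hφ.smooth.continuous hφ.compact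
  rw [integral_add_measure (hφ.integrable _) (hφ.integrable _),
    integral_add_measure (hφ.integrable _) (hφ.integrable _)]
  have := H φ hφ
  linarith

theorem withDensity_apply_eq_zero_of_ae {μ : Measure (Rn n)} {k : Rn n → ℝ≥0∞} {S : Set (Rn n)}
    (hS : MeasurableSet S) (h0 : ∀ᵐ x ∂μ, x ∈ S → k x = 0) : (μ.withDensity k) S = 0 := by
  rw [withDensity_apply _ hS]
  exact (lintegral_congr_ae ((ae_restrict_iff' hS).2 h0)).trans (by simp)

/-- Two measures whose difference has densities with respect to two other measures agree on the sets
on which the densities vanish. -/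
theorem measure_eq_of_testFunction_densities {W : Set (Rn n)} (hW : IsOpen W)
    {P N : Measure (Rn n)} [IsFiniteMeasure P] [IsFiniteMeasure N] {μ ν : Measure (Rn n)}
    {h k : Rn n → ℝ} (hh : Integrable h μ) (hk : Integrable k ν)
    (H : ∀ φ, IsTestFunction W φ →
      (∫ x, φ x ∂P) + (∫ x, h x * φ x ∂μ) + ∫ x, k x * φ x ∂ν = ∫ x, φ x ∂N)
    {S : Set (Rn n)} (hSW : S ⊆ W) (hS : MeasurableSet S) (h0 : ∀ᵐ x ∂μ, x ∈ S → h x = 0)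
    (k0 : ∀ᵐ x ∂ν, x ∈ S → k x = 0) : P S = N S := by
  have f1 : IsFiniteMeasure (ν.withDensity fun x ↦ ENNReal.ofReal (k x)) :=
    isFiniteMeasure_withDensity_ofReal hk.2
  have f2 : IsFiniteMeasure (ν.withDensity fun x ↦ ENNReal.ofReal (-k x)) :=
    isFiniteMeasure_withDensity_ofReal hk.neg.2
  have := measure_add_withDensity_eq hW
    (P := P + ν.withDensity fun x ↦ ENNReal.ofReal (k x))
    (N := N + ν.withDensity fun x ↦ ENNReal.ofReal (-k x)) hh (fun φ hφ ↦ ?_) hSW hS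
  · rw [Measure.add_apply, Measure.add_apply, withDensity_apply_eq_zero_of_ae hS,
      withDensity_apply_eq_zero_of_ae hS, withDensity_apply_eq_zero_of_ae hS,
      withDensity_apply_eq_zero_of_ae hS] at this
    · simpa using this
    · filter_upwards [h0] with x hx hxS; simp [hx hxS]
    · filter_upwards [k0] with x hx hxS; simp [hx hxS]
    · filter_upwards [h0] with x hx hxS; simp [hx hxS]
    · filter_upwards [k0] with x hx hxS; simp [hx hxS]
  · have e := integral_withDensity_sub hk hφ.smooth.continuous hφ.compact
    rw [integral_add_measure (hφ.integrable _) (hφ.integrable _),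
      integral_add_measure (hφ.integrable _) (hφ.integrable _)]
    have := H φ hφ
    linarith

end Densities

/-! ### Classical one-sided limits and derivatives are approximate ones -/

section ApproxLimits
open scoped ENNReal

variable {n : ℕ}

theorem setLAverage_le_of_forall_le {S : Set (Rn n)} (hS : MeasurableSet S) {f : Rn n → ℝ≥0∞}
    {c : ℝ≥0∞} (h : ∀ y ∈ S, f y ≤ c) : ⨍⁻ y in S, f y ∂volume ≤ c := by
  rw [setLAverage_eq]
  refine ENNReal.div_le_of_le_mul ?_
  exact (setLIntegral_mono' hS h).trans (by simp)

theorem isOneSidedApproxLimit_of_eventually_eq {u f : Rn n → Rn n} {x ν : Rn n}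
    (hf : ContinuousAt f x) (h : ∀ᶠ y in 𝓝 x, 0 < inner ℝ (y - x) ν → u y = f y) :
    IsOneSidedApproxLimit u x ν (f x) := by
  refine ENNReal.tendsto_nhds_zero.2 fun ε hε ↦ ?_
  have h1 : ∀ᶠ y in 𝓝 x, ‖f y - f x‖ₑ < ε := by
    have : Tendsto (fun y ↦ ‖f y - f x‖ₑ) (𝓝 x) (𝓝 0) := by
      have h2 : ContinuousAt (fun y ↦ ‖f y - f x‖ₑ) x := by fun_prop
      simpa [ContinuousAt] using h2
    exact this.eventually_lt_const hε
  obtain ⟨δ, hδ, hball⟩ := Metric.eventually_nhds_iff_ball.1 (h1.and h)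
  filter_upwards [Ioo_mem_nhdsGT hδ] with r hr
  have hc : Continuous fun y : Rn n ↦ inner ℝ (y - x) ν :=
    (continuous_id.sub continuous_const).inner continuous_const
  have hm : MeasurableSet {y ∈ Metric.ball x r | 0 < inner ℝ (y - x) ν} :=
    Metric.isOpen_ball.measurableSet.inter
      (isOpen_lt continuous_const hc).measurableSet
  refine setLAverage_le_of_forall_le hm fun y hy ↦ ?_
  have := hball y (Metric.ball_subset_ball hr.2.le hy.1)
  rw [this.2 hy.2]
  exact this.1.le

/-- The normal is the coordinate vector in direction `l`, and the traces are the values of the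
continuous extensions `f` and `g` at `x`. -/
theorem mem_jumpSet_of_eventually_eq {Ω : Set (Rn n)} {u f g : Rn n → Rn n} {x : Rn n}
    (hx : x ∈ Ω) (l : Fin n) (hf : ContinuousAt f x) (hg : ContinuousAt g x) (hne : f x ≠ g x)
    (h1 : ∀ᶠ y in 𝓝 x, x l < y l → u y = f y) (h2 : ∀ᶠ y in 𝓝 x, y l < x l → u y = g y) :
    x ∈ jumpSet Ω u := by
  refine ⟨hx, f x, g x, EuclideanSpace.single l 1, hne, by simp,
    isOneSidedApproxLimit_of_eventually_eq hf ?_, isOneSidedApproxLimit_of_eventually_eq hg ?_⟩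
  · filter_upwards [h1] with y hy hlt
    exact hy (by simpa [EuclideanSpace.inner_single_right] using hlt)
  · filter_upwards [h2] with y hy hlt
    exact hy (by simpa [EuclideanSpace.inner_single_right] using hlt)

theorem HasFDerivAt.hasApproxGradientAt {u : Rn n → Rn n} {L : Rn n →L[ℝ] Rn n} {x : Rn n}
    (h : HasFDerivAt u L x) : HasApproxGradientAt u L x := by
  refine ⟨u x, ENNReal.tendsto_nhds_zero.2 fun ε hε ↦ ?_⟩
  obtain ⟨c, hc0, hc⟩ : ∃ c : ℝ, 0 < c ∧ ENNReal.ofReal c ≤ ε := by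
    rcases eq_or_ne ε ⊤ with rfl | ht
    · exact ⟨1, one_pos, le_top⟩
    · exact ⟨ε.toReal, ENNReal.toReal_pos hε.ne' ht, by rw [ENNReal.ofReal_toReal ht]⟩
  obtain ⟨δ, hδ, hball⟩ := Metric.eventually_nhds_iff_ball.1
    (h.isLittleO.bound hc0)
  filter_upwards [Ioo_mem_nhdsGT hδ] with r hr
  refine setLAverage_le_of_forall_le Metric.isOpen_ball.measurableSet fun y hy ↦ ?_
  have h1 := hball y (Metric.ball_subset_ball hr.2.le hy)
  have h2 : ‖y - x‖ ≤ r := by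
    rw [Metric.mem_ball, dist_eq_norm] at hy; exact hy.le
  refine (ENNReal.div_le_of_le_mul ?_).trans hc
  rw [← ofReal_norm, ← ENNReal.ofReal_mul hc0.le]
  exact ENNReal.ofReal_le_ofReal (h1.trans (by gcongr))

end ApproxLimits

/-! ### No Cantor part; lower bound for the variation -/

section GridFunctions
open scoped ENNReal

variable {n : ℕ} {T : Set ℝ}

theorem differentiableAt_of_gridC1 {u : Rn n → Rn n} (hu : ∀ k, GridC1 T fun x ↦ u x k)
    {x : Rn n} (hx : x ∉ grid n T) : DifferentiableAt ℝ u x := by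
  rw [differentiableAt_piLp]
  intro k
  have hT : ∀ m, x m ∉ T := fun m hm ↦ hx ⟨m, hm⟩
  obtain ⟨f, g, hf, -, -, -, h3⟩ := hu k x k fun m _ ↦ hT m
  exact (hf.differentiable one_ne_zero x).congr_of_eventuallyEq (h3 (hT k))

theorem isApproxGradient_fderiv {u : Rn n → Rn n} (hT : T.Countable)
    (hu : ∀ k, GridC1 T fun x ↦ u x k) (Ω : Set (Rn n)) :
    IsApproxGradient Ω u (fderiv ℝ u) := by
  refine ae_restrict_of_ae ?_
  have : ∀ᵐ x : Rn n, x ∉ grid n T := by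
    rw [ae_iff]; simpa using volume_grid hT
  filter_upwards [this] with x hx
  exact (differentiableAt_of_gridC1 hu hx).hasFDerivAt.hasApproxGradientAt

/-- One entry of the Jacobian matrix is at most its operator norm. This transfers a lower bound for
`∫ |a|` to the full gradient. -/
theorem enorm_partial_le_enorm_fderiv {u : Rn n → Rn n} {x : Rn n} (hu : DifferentiableAt ℝ u x)
    (i j : Fin n) {a : ℝ} (ha : HasPartialAt j (fun y ↦ u y i) a x) :
    ‖a‖ₑ ≤ ‖fderiv ℝ u x‖ₑ := by
  have hs : setCoord j (x j) x = x := by simp [setCoord]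
  have h0 : HasDerivAt (fun s ↦ setCoord j s x) (EuclideanSpace.single j 1) (x j) := by
    unfold setCoord
    simpa using (((hasDerivAt_id (x j)).sub_const (x j)).smul_const
      (EuclideanSpace.single j (1 : ℝ))).const_add x
  have h1 : HasFDerivAt u (fderiv ℝ u x) (setCoord j (x j) x) := by
    rw [hs]; exact hu.hasFDerivAt
  have h2 := h1.comp_hasDerivAt (x j) h0
  have h3 : HasDerivAt (fun s ↦ u (setCoord j s x) i)
      (fderiv ℝ u x (EuclideanSpace.single j 1) i) (x j) :=
    (EuclideanSpace.proj (𝕜 := ℝ) i).hasFDerivAt.comp_hasDerivAt (x j) h2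
  rw [ha.unique h3, enorm_le_iff_norm_le]
  refine (PiLp.norm_apply_le _ i).trans (((fderiv ℝ u x).le_opNorm _).trans ?_)
  simp

/-- The strain measure of a function which is piecewise `C¹` with respect to a grid, and whose
absolutely continuous part vanishes, does not charge the complement of the jump set. -/
theorem totalVariation_diff_jumpSet_eq_zero {Ω : Set (Rn n)} (hΩ : IsOpen Ω) (hT : T.Countable)
    {u : Rn n → Rn n} (hu : ∀ k, GridC1 T fun x ↦ u x k) (i j : Fin n) {P N : Measure (Rn n)}
    [IsFiniteMeasure P] [IsFiniteMeasure N] (hP : FaceAC T P) (hN : FaceAC T N)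
    (H : ∀ φ, IsTestFunction Ω φ →
      ∫ x, (u x i * partialDeriv j φ x + u x j * partialDeriv i φ x) / 2
        = -(∫ x, φ x ∂P) + ∫ x, φ x ∂N) :
    (P.toSignedMeasure - N.toSignedMeasure).totalVariation (Ω \ jumpSet Ω u) = 0 := by
  have hcorner : (P.toSignedMeasure - N.toSignedMeasure).totalVariation (gridCorners n T) = 0 :=
    totalVariation_sub_eq_zero P N (measurableSet_gridCorners hT) fun S' hS' _ ↦ by
      rw [measure_mono_null hS' (hP.gridCorners hT), measure_mono_null hS' (hN.gridCorners hT)]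
  have hgood : (P.toSignedMeasure - N.toSignedMeasure).totalVariation
      ((Ω \ jumpSet Ω u) \ gridCorners n T) = 0 := by
    refine measure_null_of_locally_null _ fun x hx ↦ ?_
    obtain ⟨⟨hxΩ, -⟩, hxc⟩ := hx
    -- A point that is not a corner meets the grid in at most one direction `l`; failing that, two
    -- distinct coordinates in `T` would be found.
    obtain ⟨l, hl⟩ : ∃ l : Fin n, ∀ m, m ≠ l → x m ∉ T := by
      by_contra! hcon
      obtain ⟨m, hm, hmT⟩ := hcon i
      obtain ⟨m', hm', hmT'⟩ := hcon m
      exact hxc ⟨m, m', hm', hmT, hmT'⟩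
    choose f g hf hg h1 h2 _ using fun k ↦ hu k x l hl
    obtain ⟨ε, hε, hball⟩ := Metric.eventually_nhds_iff_ball.1
      ((eventually_all.2 h1).and (eventually_all.2 h2))
    set W := Metric.ball x ε ∩ Ω with hWdef
    have hW : IsOpen W := Metric.isOpen_ball.inter hΩ
    have hxW : x ∈ W := ⟨Metric.mem_ball_self hε, hxΩ⟩
    have hWK : W ⊆ Metric.closedBall x ε :=
      Set.inter_subset_left.trans Metric.ball_subset_closedBall
    have hK := isCompact_closedBall x ε
    have e1 : ∀ k, ∀ y ∈ W, x l < y l → u y k = f k y := fun k y hy ↦ (hball y hy.1).1 k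
    have e2 : ∀ k, ∀ y ∈ W, y l < x l → u y k = g k y := fun k y hy ↦ (hball y hy.1).2 k
    -- These are the points of the hyperplane through `x` where the traces differ. Near `x` they
    -- belong to the jump set, so it suffices to show that the strain does not charge `W \ J`.
    set J : Set (Rn n) := {y | y l = x l ∧ ∃ k, f k y ≠ g k y} with hJ
    have hJm : MeasurableSet J := by
      have : J = {y | y l = x l} ∩ ⋃ k, {y | f k y ≠ g k y} := by ext y; simp [hJ]
      rw [this]
      refine ((measurableSet_singleton (x l)).preimage (continuous_coord l).measurable).inter
        (MeasurableSet.iUnion fun k ↦ ?_)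
      exact (isOpen_ne_fun (hf k).continuous (hg k).continuous).measurableSet
    have hJsub : W ∩ J ⊆ jumpSet Ω u := by
      rintro y ⟨hyW, hyl, k, hk⟩
      have hcf : Continuous fun z ↦ (WithLp.toLp 2 fun k ↦ f k z : Rn n) :=
        (PiLp.continuous_toLp 2 _).comp (continuous_pi fun k ↦ (hf k).continuous)
      have hcg : Continuous fun z ↦ (WithLp.toLp 2 fun k ↦ g k z : Rn n) :=
        (PiLp.continuous_toLp 2 _).comp (continuous_pi fun k ↦ (hg k).continuous)
      refine mem_jumpSet_of_eventually_eq hyW.2 l hcf.continuousAt hcg.continuousAt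
        (fun he ↦ hk (congrArg (fun v : Rn n ↦ v k) he)) ?_ ?_
      · filter_upwards [hW.mem_nhds hyW] with z hz hlt
        ext k; exact e1 k z hz (hyl ▸ hlt)
      · filter_upwards [hW.mem_nhds hyW] with z hz hlt
        ext k; exact e2 k z hz (hyl ▸ hlt)
    refine ⟨W \ J, ?_, ?_⟩
    · refine mem_of_superset (inter_mem_nhdsWithin _ (hW.mem_nhds hxW)) ?_
      rintro y ⟨⟨⟨-, hyJ⟩, -⟩, hyW⟩
      exact ⟨hyW, fun hy ↦ hyJ (hJsub ⟨hyW, hy⟩)⟩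
    · refine totalVariation_sub_eq_zero P N (hW.measurableSet.diff hJm) fun S' hS' hm ↦ ?_
      -- In `W` the strain has the volume density `h` and the face density `k`. Restriction to the
      -- Lebesgue null grid discards `h`, and outside `J` the traces agree, so `k` vanishes on the
      -- face.
      rw [← hP.inter_grid hT, ← hN.inter_grid hT]
      set h : Rn n → ℝ := fun y ↦ (sideDeriv l (x l) j (f i) (g i) y
        + sideDeriv l (x l) i (f j) (g j) y) / 2 with hh
      set k : Rn n → ℝ := fun y ↦ (sideJump l j (f i) (g i) y
        + sideJump l i (f j) (g j) y) / 2 with hk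
      have ih : Integrable h (volume.restrict W) :=
        (((integrableOn_sideDeriv (hf i) (hg i) l (x l) j hK).add
          (integrableOn_sideDeriv (hf j) (hg j) l (x l) i hK)).mono_set hWK).div_const 2
      have hkc : Continuous k :=
        ((continuous_sideJump (hf i) (hg i) l j).add
          (continuous_sideJump (hf j) (hg j) l i)).div_const 2
      have ik : Integrable k ((faceMeasure l (x l)).restrict W) :=
        (hkc.continuousOn.integrableOn_compact hK).mono_set hWK
      have hgm := measurableSet_grid (n := n) hT
      have hsub : S' ∩ grid n T ⊆ W := fun y hy ↦ (hS' hy.1).1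
      symm
      refine measure_eq_of_testFunction_densities hW ih ik (fun φ hφ ↦ ?_) hsub (hm.inter hgm) ?_ ?_
      · have hφ1 : ContDiff ℝ 1 φ := hφ.smooth.of_le (by simp)
        have hz : ∀ y, y ∉ W → φ y = 0 := fun y hy ↦
          image_eq_zero_of_notMem_tsupport fun hy' ↦ hy (hφ.support hy')
        obtain ⟨a1, a2, a3⟩ := integral_twoSided_mul_partialDeriv (hf i) (hg i) (e1 i) (e2 i)
          hφ1 hφ.compact hφ.support j
        obtain ⟨b1, b2, b3⟩ := integral_twoSided_mul_partialDeriv (hf j) (hg j) (e1 j) (e2 j)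
          hφ1 hφ.compact hφ.support i
        have H' := H φ ⟨hφ.smooth, hφ.compact, hφ.support.trans Set.inter_subset_right⟩
        rw [integral_div, integral_add a1 b1, a3, b3] at H'
        have c1 : ∫ y in W, h y * φ y = ∫ y, h y * φ y :=
          setIntegral_eq_integral_of_forall_compl_eq_zero fun y hy ↦ by simp [hz y hy]
        have c2 : ∫ y in W, k y * φ y ∂(faceMeasure l (x l)) = ∫ y, k y * φ y ∂(faceMeasure l (x l)) :=
          setIntegral_eq_integral_of_forall_compl_eq_zero fun y hy ↦ by simp [hz y hy]
        have d1 : ∫ y, h y * φ y = ((∫ y, sideDeriv l (x l) j (f i) (g i) y * φ y)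
            + ∫ y, sideDeriv l (x l) i (f j) (g j) y * φ y) / 2 := by
          rw [← integral_add a2 b2, ← integral_div]
          congr 1; ext y; simp only [hh]; ring
        have d2 : ∫ y, k y * φ y ∂(faceMeasure l (x l))
            = ((∫ y, sideJump l j (f i) (g i) y * φ y ∂(faceMeasure l (x l)))
            + ∫ y, sideJump l i (f j) (g j) y * φ y ∂(faceMeasure l (x l))) / 2 := by
          rw [← integral_add, ← integral_div]
          · congr 1; ext y; simp only [hk]; ring
          · exact ((continuous_sideJump (hf i) (hg i) l j).mul
              hφ1.continuous).integrable_of_hasCompactSupport hφ.compact.mul_left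
          · exact ((continuous_sideJump (hf j) (hg j) l i).mul
              hφ1.continuous).integrable_of_hasCompactSupport hφ.compact.mul_left
        rw [c1, c2, d1, d2]
        linarith
      · refine ae_restrict_of_ae ?_
        have : ∀ᵐ y : Rn n, y ∉ grid n T := by
          rw [ae_iff]; simpa using volume_grid hT
        filter_upwards [this] with y hy hy'
        exact absurd hy'.2 hy
      · refine ae_restrict_of_ae ?_
        have : ∀ᵐ y ∂(faceMeasure l (x l)), y l = x l := by
          rw [ae_iff]; exact faceMeasure_compl_face l (x l)
        filter_upwards [this] with y hy hy'
        have hnJ : ∀ k, f k y = g k y := by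
          by_contra! hcon
          exact (hS' hy'.1).2 ⟨hy, hcon⟩
        simp [hk, sideJump, hnJ]
  refine measure_mono_null (fun y hy ↦ ?_) (measure_union_null hcorner hgood)
  by_cases hc : y ∈ gridCorners n T
  · exact Or.inl hc
  · exact Or.inr ⟨hy, hc⟩

/-- If the weak derivative of a function with absolutely continuous part `a` is the measure `D`
in `O`, then the integral of `|a|` is at most the total variation of `D`. -/
theorem setLIntegral_enorm_le_totalVariation {O : Set (Rn n)} (hO : IsOpen O) (hT : T.Countable)
    (D : SignedMeasure (Rn n)) {P N : Measure (Rn n)} [IsFiniteMeasure P] [IsFiniteMeasure N]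
    (hP : FaceAC T P) (hN : FaceAC T N) {a : Rn n → ℝ} (hm : Measurable a) (ha : Integrable a)
    (H : ∀ φ, IsTestFunction O φ →
      ∫ᵛ x, φ x ∂<•D = (∫ x, a x * φ x) + (∫ x, φ x ∂P) - ∫ x, φ x ∂N) :
    ∫⁻ x in O, ‖a x‖ₑ ≤ D.totalVariation O := by
  set Dp := D.toJordanDecomposition.posPart
  set Dn := D.toJordanDecomposition.negPart
  have hg := measurableSet_grid (n := n) hT
  -- Off the grid the singular measures vanish, so there `D` is `a` times Lebesgue measure, with
  -- negative parts moved to the other side.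
  have key : ∀ S, MeasurableSet S → S ⊆ O \ grid n T →
      Dn S + ∫⁻ x in S, ENNReal.ofReal (a x) = Dp S + ∫⁻ x in S, ENNReal.ofReal (-a x) := by
    intro S hS hSO
    have h0 : ∀ {Q : Measure (Rn n)}, FaceAC T Q → Q S = 0 := fun hQ ↦
      measure_mono_null (fun y hy ↦ (hSO hy).2) (hQ.compl_grid hT)
    have := measure_add_withDensity_eq hO (P := Dn + P) (N := Dp + N) ha (fun φ hφ ↦ ?_)
      (hSO.trans Set.sdiff_subset) hS
    · simpa [withDensity_apply _ hS, h0 hP, h0 hN] using this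
    · have := H φ hφ
      rw [integral_signedMeasure_eq_jordan D (hφ.integrable _) (hφ.integrable _)] at this
      rw [integral_add_measure (hφ.integrable _) (hφ.integrable _),
        integral_add_measure (hφ.integrable _) (hφ.integrable _)]
      simp only [Dp, Dn]
      linarith
  -- Where `a ≥ 0` the density is controlled by the positive Jordan part of `D`, and elsewhere by
  -- the negative one. The grid itself contributes nothing to the integral.
  set A := {x | 0 ≤ a x}
  have hA : MeasurableSet A := measurableSet_le measurable_const hm
  set O' := O \ grid n T
  have hO' : MeasurableSet O' := hO.measurableSet.diff hg
  have k1 : ∫⁻ x in O' ∩ A, ENNReal.ofReal |a x| ≤ Dp (O' ∩ A) := by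
    have e := key (O' ∩ A) (hO'.inter hA) Set.inter_subset_left
    have z : ∫⁻ x in O' ∩ A, ENNReal.ofReal (-a x) = 0 :=
      setLIntegral_eq_zero (hO'.inter hA) fun x hx ↦ by
        simpa using (show 0 ≤ a x from hx.2)
    have z' : ∫⁻ x in O' ∩ A, ENNReal.ofReal |a x| = ∫⁻ x in O' ∩ A, ENNReal.ofReal (a x) :=
      setLIntegral_congr_fun (hO'.inter hA) fun x hx ↦ by
        rw [abs_of_nonneg (show 0 ≤ a x from hx.2)]
    rw [z, add_zero] at e
    rw [z', ← e]; exact le_add_self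
  have k2 : ∫⁻ x in O' \ A, ENNReal.ofReal |a x| ≤ Dn (O' \ A) := by
    have e := key (O' \ A) (hO'.diff hA) Set.sdiff_subset
    have z : ∫⁻ x in O' \ A, ENNReal.ofReal (a x) = 0 :=
      setLIntegral_eq_zero (hO'.diff hA) fun x hx ↦ by
        simpa using (not_le.1 hx.2).le
    have z' : ∫⁻ x in O' \ A, ENNReal.ofReal |a x| = ∫⁻ x in O' \ A, ENNReal.ofReal (-a x) :=
      setLIntegral_congr_fun (hO'.diff hA) fun x hx ↦ by
        rw [abs_of_neg (not_le.1 hx.2)]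
    rw [z, add_zero] at e
    rw [z', e]; exact le_add_self
  have hOO : ∫⁻ x in O, ‖a x‖ₑ = ∫⁻ x in O', ENNReal.ofReal |a x| := by
    have : (O' : Set (Rn n)) =ᵐ[volume] O := sdiff_null_ae_eq_self (volume_grid hT)
    rw [← setLIntegral_congr this]
    simp_rw [Real.enorm_eq_ofReal_abs]
  rw [hOO, ← lintegral_inter_add_sdiff _ O' hA]
  calc _ ≤ Dp (O' ∩ A) + Dn (O' \ A) := add_le_add k1 k2
    _ ≤ Dp O + Dn O := add_le_add (measure_mono (Set.inter_subset_left.trans Set.sdiff_subset))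
        (measure_mono (Set.sdiff_subset.trans Set.sdiff_subset))
    _ = D.totalVariation O := by simp [SignedMeasure.totalVariation, Dp, Dn]

end GridFunctions

/-! ### Disjoint dyadic cubes shrinking to a point -/

section DyadicBoxes
open scoped ENNReal

variable {n : ℕ}

/-- The open box `∏ (p_m, q_m)`. -/
def obox (p q : Fin n → ℝ) : Set (Rn n) := {x | ∀ m, x m ∈ Set.Ioo (p m) (q m)}

theorem isOpen_obox (p q : Fin n → ℝ) : IsOpen (obox p q) := by
  have : obox p q = ⋂ m, (fun x : Rn n ↦ x m) ⁻¹' Set.Ioo (p m) (q m) := by ext x; simp [obox]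
  rw [this]
  exact isOpen_iInter_of_finite fun m ↦ isOpen_Ioo.preimage (continuous_coord m)

theorem obox_subset_hbox (p q : Fin n → ℝ) : obox p q ⊆ hbox p q := fun _ hx m ↦
  Set.Ioo_subset_Ico_self (hx m)

theorem volume_hbox_diff_obox (p q : Fin n → ℝ) : volume (hbox p q \ obox p q) = 0 := by
  refine measure_mono_null (t := ⋃ m, {x : Rn n | x m = p m}) ?_
    (measure_iUnion_null fun m ↦ volume_face m (p m))
  rintro x ⟨hx, hx'⟩
  simp only [obox, Set.mem_ofPred_eq, not_forall] at hx'
  obtain ⟨m, hm⟩ := hx'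
  refine Set.mem_iUnion.2 ⟨m, ?_⟩
  by_contra hne
  exact hm ⟨lt_of_le_of_ne (hx m).1 (Ne.symm hne), (hx m).2⟩

/-- The lower corner of the `m`-th cube of side `c 2^{-m-1}` on the diagonal ray from `x₀`. -/
noncomputable def cubeLo (x₀ : Rn n) (c : ℝ) (m : ℕ) (k : Fin n) : ℝ := x₀ k + c * (1 / 2) ^ (m + 1)

/-- The upper corner of the `m`-th cube of side `c 2^{-m-1}` on the diagonal ray from `x₀`. -/
noncomputable def cubeHi (x₀ : Rn n) (c : ℝ) (m : ℕ) (k : Fin n) : ℝ := x₀ k + c * (1 / 2) ^ m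

theorem cubeLo_lt_cubeHi {x₀ : Rn n} {c : ℝ} (hc : 0 < c) (m : ℕ) (k : Fin n) :
    cubeLo x₀ c m k < cubeHi x₀ c m k := by
  unfold cubeLo cubeHi
  have : 0 < c * (1 / 2 : ℝ) ^ m := by positivity
  rw [pow_succ]
  linarith

/-- A single coordinate decides: the intervals `[c 2^(-m-1), c 2^(-m))` are pairwise disjoint. -/
theorem eq_of_mem_cubes {x₀ : Rn n} {c : ℝ} (hc : 0 < c) (i : Fin n) {m m' : ℕ} {x : Rn n}
    (h : x ∈ hbox (cubeLo x₀ c m) (cubeHi x₀ c m))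
    (h' : x ∈ hbox (cubeLo x₀ c m') (cubeHi x₀ c m')) : m = m' := by
  have aux : ∀ m m' : ℕ, x ∈ hbox (cubeLo x₀ c m) (cubeHi x₀ c m) →
      x ∈ hbox (cubeLo x₀ c m') (cubeHi x₀ c m') → ¬ m < m' := by
    intro m m' h h' hlt
    have h1 := (h i).1
    have h2 := (h' i).2
    unfold cubeLo at h1
    unfold cubeHi at h2
    have : c * (1 / 2 : ℝ) ^ m' ≤ c * (1 / 2) ^ (m + 1) := by
      gcongr ?_ * ?_
      exact pow_le_pow_of_le_one (by norm_num) (by norm_num) hlt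
    linarith
  exact le_antisymm (not_lt.1 (aux _ _ h' h)) (not_lt.1 (aux _ _ h h'))

/-- A cube is contained in a ball. -/
theorem mem_ball_of_mem_cube {x₀ : Rn n} {R : ℝ} (hR : 0 < R) {m : ℕ} {x : Rn n}
    (h : x ∈ hbox (cubeLo x₀ (R / (n + 1)) m) (cubeHi x₀ (R / (n + 1)) m)) :
    x ∈ Metric.ball x₀ R := by
  have hc : 0 < R / (n + 1) := by positivity
  set c := R / (n + 1) with hcdef
  have hk : ∀ k, dist (x k) (x₀ k) ^ 2 ≤ c ^ 2 := fun k ↦ by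
    have h1 := (h k).1
    have h2 := (h k).2
    unfold cubeLo at h1
    unfold cubeHi at h2
    have h3 : 0 < c * (1 / 2 : ℝ) ^ (m + 1) := by positivity
    have h4 : c * (1 / 2 : ℝ) ^ m ≤ c :=
      mul_le_of_le_one_right hc.le (pow_le_one₀ (by norm_num) (by norm_num))
    rw [Real.dist_eq, sq_abs]
    exact pow_le_pow_left₀ (by linarith) (by linarith) 2
  rw [Metric.mem_ball, EuclideanSpace.dist_eq, Real.sqrt_lt' hR]
  calc ∑ k, dist (x k) (x₀ k) ^ 2 ≤ ∑ _k : Fin n, c ^ 2 := Finset.sum_le_sum fun k _ ↦ hk k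
    _ = n * c ^ 2 := by simp
    _ < (n + 1) ^ 2 * c ^ 2 := by
        gcongr ?_ * _
        have : (0 : ℝ) ≤ n := n.cast_nonneg
        nlinarith
    _ = R ^ 2 := by
        rw [hcdef]; field_simp

/-- The cubes accumulate only at `x₀`. -/
theorem eventually_notMem_cubes {x₀ : Rn n} (c : ℝ) {x : Rn n} {k : Fin n} (hx : x k ≠ x₀ k) :
    ∃ M, ∀ᶠ y in 𝓝 x, ∀ m ≥ M, y ∉ hbox (cubeLo x₀ c m) (cubeHi x₀ c m) := by
  have hd : 0 < |x k - x₀ k| / 2 := by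
    have := abs_pos.2 (sub_ne_zero.2 hx); positivity
  have ht : Tendsto (fun m : ℕ ↦ |c| * (1 / 2 : ℝ) ^ m) atTop (𝓝 0) := by
    simpa using (tendsto_pow_atTop_nhds_zero_of_lt_one (by norm_num : (0 : ℝ) ≤ 1 / 2)
      (by norm_num)).const_mul |c|
  obtain ⟨M, hM⟩ := eventually_atTop.1 (ht.eventually_lt_const hd)
  refine ⟨M, ?_⟩
  have hcont : Continuous fun y : Rn n ↦ |y k - x₀ k| :=
    ((continuous_coord k).sub continuous_const).abs
  filter_upwards [hcont.continuousAt.eventually (lt_mem_nhds (half_lt_self_iff.2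
    (abs_pos.2 (sub_ne_zero.2 hx))))] with y hy m hm hmem
  have h1 := (hmem k).1
  have h2 := (hmem k).2
  unfold cubeLo at h1
  unfold cubeHi at h2
  have h3 := hM m hm
  have h4 : c * (1 / 2 : ℝ) ^ m ≤ |c| * (1 / 2) ^ m := by gcongr; exact le_abs_self c
  have h5 : -(|c| * (1 / 2 : ℝ) ^ m) ≤ c * (1 / 2) ^ (m + 1) := by
    rw [pow_succ]
    have : -(|c| * (1 / 2 : ℝ) ^ m) ≤ c * (1 / 2) ^ m := by
      rw [← neg_mul]; gcongr; exact neg_abs_le c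
    have : 0 ≤ |c| * (1 / 2 : ℝ) ^ m := by positivity
    linarith
  have : |y k - x₀ k| ≤ |c| * (1 / 2) ^ m := abs_le.2 ⟨by linarith, by linarith⟩
  linarith

end DyadicBoxes

/-! ### Sums of blocks and their strain measures -/

section BlockSums
open scoped ENNReal

variable {n : ℕ} {T : Set ℝ} {x₀ : Rn n} {c : ℝ} {j : Fin n} {F a : ℕ → Rn n → ℝ}

/-- A sequence of piecewise smooth functions with geometrically decreasing norms, which are
supported in cubes accumulating at `x₀`. -/
def IsBlockSeq (T : Set ℝ) (x₀ : Rn n) (c : ℝ) (j : Fin n) (F a : ℕ → Rn n → ℝ) : Prop :=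
  ∀ m, IsBoxFun T (cubeLo x₀ c m) (cubeHi x₀ c m) (ENNReal.ofReal ((1 / 2) ^ m)) ((1 / 2) ^ m) j
    (F m) (a m)

namespace IsBlockSeq

theorem summable (h : IsBlockSeq T x₀ c j F a) (x : Rn n) : Summable fun m ↦ F m x :=
  Summable.of_norm_bounded summable_geometric_two fun m ↦ (h m).bdd x

theorem abs_tsum_le (h : IsBlockSeq T x₀ c j F a) (x : Rn n) : |∑' m, F m x| ≤ 2 := by
  rw [← Real.norm_eq_abs]
  exact tsum_of_norm_bounded hasSum_geometric_two fun m ↦ (h m).bdd x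

theorem measurable_tsum (h : IsBlockSeq T x₀ c j F a) : Measurable fun x ↦ ∑' m, F m x :=
  measurable_of_tendsto_metrizable
    (fun M ↦ Finset.measurable_fun_sum (Finset.range M) fun m _ ↦ (h m).measurable)
    (tendsto_pi_nhds.2 fun x ↦ (h.summable x).hasSum.tendsto_sum_nat)

theorem tsum_eq_of_mem (h : IsBlockSeq T x₀ c j F a) (hc : 0 < c) {m : ℕ} {x : Rn n}
    (hx : x ∈ hbox (cubeLo x₀ c m) (cubeHi x₀ c m)) : ∑' m, F m x = F m x :=
  tsum_eq_single m fun m' hm' ↦ (h m').supp x fun hx' ↦ hm' (eq_of_mem_cubes hc j hx' hx)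

theorem tsum_eq_zero (h : IsBlockSeq T x₀ c j F a) {x : Rn n}
    (hx : ∀ m, x ∉ hbox (cubeLo x₀ c m) (cubeHi x₀ c m)) : ∑' m, F m x = 0 := by
  simp [fun m ↦ (h m).supp x (hx m)]

theorem eventually_tsum_eq (h : IsBlockSeq T x₀ c j F a) (hc : 0 < c) {m : ℕ} {x : Rn n}
    (hx : x ∈ obox (cubeLo x₀ c m) (cubeHi x₀ c m)) : ∀ᶠ y in 𝓝 x, ∑' m, F m y = F m y := by
  filter_upwards [(isOpen_obox _ _).mem_nhds hx] with y hy
  exact h.tsum_eq_of_mem hc (obox_subset_hbox _ _ hy)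

/-- As `n ≥ 2` there is a coordinate `k ≠ l`. It avoids `T`, which contains the coordinates of `x₀`,
so `x_k ≠ (x₀)_k`, and only finitely many cubes come near `x`. The accumulation point thus counts as
a corner and needs no regularity. -/
theorem gridC1 (h : IsBlockSeq T x₀ c j F a) (hn : 2 ≤ n) (hx₀ : ∀ k, x₀ k ∈ T) :
    GridC1 T fun x ↦ ∑' m, F m x := by
  intro x l hx
  have : Nontrivial (Fin n) := Fin.nontrivial_iff_two_le.2 hn
  obtain ⟨k, hk⟩ := exists_ne l
  have hne : x k ≠ x₀ k := fun he ↦ hx k hk (he ▸ hx₀ k)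
  obtain ⟨M, hM⟩ := eventually_notMem_cubes c hne
  obtain ⟨f, g, hf, hg, h1, h2, h3⟩ :=
    GridC1.sum (Finset.range M) (fun m _ ↦ (h m).grid) x l hx
  have he : ∀ᶠ y in 𝓝 x, ∑' m, F m y = ∑ m ∈ Finset.range M, F m y := by
    filter_upwards [hM] with y hy
    refine tsum_eq_sum fun m hm ↦ (h m).supp y (hy m ?_)
    simpa using hm
  refine ⟨f, g, hf, hg, ?_, ?_, fun hl ↦ ?_⟩
  · filter_upwards [he, h1] with y e1 e2 e; rw [e1, e2 e]
  · filter_upwards [he, h2] with y e1 e2 e; rw [e1, e2 e]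
  · filter_upwards [he, h3 hl] with y e1 e2; rw [e1, e2]

theorem hasPartialAt (h : IsBlockSeq T x₀ c j F a) (hc : 0 < c) {m : ℕ} {x : Rn n}
    (hx : x ∈ obox (cubeLo x₀ c m) (cubeHi x₀ c m)) (hT : x j ∉ T) :
    HasPartialAt j (fun x ↦ ∑' m, F m x) (a m x) x := by
  refine HasDerivAt.congr_of_eventuallyEq ((h m).partialAt x hT) ?_
  have hs : setCoord j (x j) x = x := by simp [setCoord]
  have hcont : ContinuousAt (fun s ↦ setCoord j s x) (x j) :=
    (contDiff_setCoord j x).continuous.continuousAt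
  rw [ContinuousAt, hs] at hcont
  exact hcont.eventually (h.eventually_tsum_eq hc hx)

end IsBlockSeq

/-- The `(k, l)` entry of the strain measure of a function with vanishing absolutely continuous
strain. -/
def IsStrainPair (T : Set ℝ) (k l : Fin n) (U V : Rn n → ℝ) (P N : Measure (Rn n)) : Prop :=
  FaceAC T P ∧ FaceAC T N ∧ ∀ φ : Rn n → ℝ, ContDiff ℝ 1 φ → HasCompactSupport φ →
    ∫ x, (U x * partialDeriv l φ x + V x * partialDeriv k φ x) / 2
      = -(∫ x, φ x ∂P) + ∫ x, φ x ∂N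

/-- The opposite densities cancel in the symmetrized derivative, and only half the sum of the
singular measures remains. -/
theorem IsWeakPartial.exists_isStrainPair {k l : Fin n} {U V g : Rn n → ℝ} {C : ℝ≥0∞}
    (h : IsWeakPartial T l U g C) (h' : IsWeakPartial T k V (fun x ↦ -g x) C)
    (hU : Integrable U) (hV : Integrable V) :
    ∃ P N : Measure (Rn n), IsFiniteMeasure P ∧ IsFiniteMeasure N ∧ P Set.univ ≤ C ∧
      N Set.univ ≤ C ∧ IsStrainPair T k l U V P N := by
  obtain ⟨P, N, h1, h2, h3, h4, h5, h6, h7⟩ := h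
  obtain ⟨P', N', h1', h2', h3', h4', h5', h6', h7'⟩ := h'
  have half : ∀ Q Q' : Measure (Rn n), Q Set.univ ≤ C → Q' Set.univ ≤ C →
      ((2 : ℝ≥0∞)⁻¹ • (Q + Q')) Set.univ ≤ C := fun Q Q' hQ hQ' ↦ by
    rw [Measure.smul_apply, Measure.add_apply, smul_eq_mul]
    calc (2 : ℝ≥0∞)⁻¹ * (Q Set.univ + Q' Set.univ) ≤ 2⁻¹ * (C + C) := by gcongr
      _ = C := by rw [← two_mul, ← mul_assoc, ENNReal.inv_mul_cancel (by simp) (by simp), one_mul]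
  have hac : ∀ Q Q' : Measure (Rn n), FaceAC T Q → FaceAC T Q' →
      FaceAC T ((2 : ℝ≥0∞)⁻¹ • (Q + Q')) := fun Q Q' hQ hQ' S hS h0 ↦ by
    simp [hQ S hS h0, hQ' S hS h0]
  refine ⟨(2 : ℝ≥0∞)⁻¹ • (P + P'), (2 : ℝ≥0∞)⁻¹ • (N + N'), Measure.smul_finite _ (by simp),
    Measure.smul_finite _ (by simp), half P P' h3 h3', half N N' h4 h4', hac P P' h5 h5',
    hac N N' h6 h6', fun φ hφ hc ↦ ?_⟩
  have hi := fun (Q : Measure (Rn n)) [IsFiniteMeasure Q] ↦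
    integrable_of_continuous_hasCompactSupport hφ.continuous hc Q
  rw [integral_div, integral_add (integrable_mul_of_continuous hU (continuous_partialDeriv hφ l)
      (hasCompactSupport_partialDeriv hc l)) (integrable_mul_of_continuous hV
      (continuous_partialDeriv hφ k) (hasCompactSupport_partialDeriv hc k)), h7 φ hφ hc,
    h7' φ hφ hc, integral_smul_measure, integral_smul_measure, integral_add_measure (hi P) (hi P'),
    integral_add_measure (hi N) (hi N')]
  simp only [neg_mul, integral_neg, ENNReal.toReal_inv, ENNReal.toReal_ofNat, smul_eq_mul]
  ring

/-- The summable bounds `b m` allow the left side to be integrated term by term, and the summable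
masses `C m` make the sums of the singular measures finite. Absolute continuity on the grid passes
to countable sums. -/
theorem exists_isStrainPair_tsum {k l : Fin n} {U V : ℕ → Rn n → ℝ} {b : ℕ → ℝ} (hb : Summable b)
    (hUm : ∀ m, Measurable (U m)) (hVm : ∀ m, Measurable (V m)) (hU : ∀ m x, |U m x| ≤ b m)
    (hV : ∀ m x, |V m x| ≤ b m) {C : ℕ → ℝ≥0∞} (hC : ∑' m, C m ≠ ⊤)
    (h : ∀ m, ∃ P N : Measure (Rn n), IsFiniteMeasure P ∧ IsFiniteMeasure N ∧ P Set.univ ≤ C m ∧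
      N Set.univ ≤ C m ∧ IsStrainPair T k l (U m) (V m) P N) :
    ∃ P N : Measure (Rn n), IsFiniteMeasure P ∧ IsFiniteMeasure N ∧
      IsStrainPair T k l (fun x ↦ ∑' m, U m x) (fun x ↦ ∑' m, V m x) P N := by
  choose P N hPf hNf hP hN hPac hNac H using h
  have hfin : ∀ Q : ℕ → Measure (Rn n), (∀ m, Q m Set.univ ≤ C m) →
      IsFiniteMeasure (Measure.sum Q) := fun Q hQ ↦ ⟨by
    rw [Measure.sum_apply _ MeasurableSet.univ]
    exact (ENNReal.tsum_le_tsum hQ).trans_lt hC.lt_top⟩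
  have hac : ∀ Q : ℕ → Measure (Rn n), (∀ m, FaceAC T (Q m)) → FaceAC T (Measure.sum Q) :=
    fun Q hQ S hS h0 ↦ by
      rw [Measure.sum_apply _ hS]; simp [fun m ↦ hQ m S hS h0]
  have := hfin P hP
  have := hfin N hN
  refine ⟨Measure.sum P, Measure.sum N, hfin P hP, hfin N hN, hac P hPac, hac N hNac,
    fun φ hφ hc ↦ ?_⟩
  have dl := continuous_partialDeriv hφ l
  have dk := continuous_partialDeriv hφ k
  have il : Integrable (partialDeriv l φ) :=
    dl.integrable_of_hasCompactSupport (hasCompactSupport_partialDeriv hc l)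
  have ik : Integrable (partialDeriv k φ) :=
    dk.integrable_of_hasCompactSupport (hasCompactSupport_partialDeriv hc k)
  have sU : ∀ x, Summable fun m ↦ U m x := fun x ↦ Summable.of_norm_bounded hb fun m ↦ hU m x
  have sV : ∀ x, Summable fun m ↦ V m x := fun x ↦ Summable.of_norm_bounded hb fun m ↦ hV m x
  set G : ℕ → Rn n → ℝ := fun m x ↦
    (U m x * partialDeriv l φ x + V m x * partialDeriv k φ x) / 2 with hG
  set K : Rn n → ℝ := fun x ↦ (|partialDeriv l φ x| + |partialDeriv k φ x|) / 2 with hK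
  have iK : Integrable K := (il.abs.add ik.abs).div_const 2
  have hGK : ∀ m x, ‖G m x‖ ≤ b m * K x := fun m x ↦ by
    simp only [hG, hK, Real.norm_eq_abs, abs_div, abs_two]
    calc |U m x * partialDeriv l φ x + V m x * partialDeriv k φ x| / 2
        ≤ (|U m x| * |partialDeriv l φ x| + |V m x| * |partialDeriv k φ x|) / 2 := by
          gcongr; rw [← abs_mul, ← abs_mul]; exact abs_add_le _ _
      _ ≤ (b m * |partialDeriv l φ x| + b m * |partialDeriv k φ x|) / 2 := by
          gcongr
          · exact hU m x
          · exact hV m x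
      _ = b m * ((|partialDeriv l φ x| + |partialDeriv k φ x|) / 2) := by ring
  have iG : ∀ m, Integrable (G m) := fun m ↦ by
    refine (iK.const_mul (b m)).mono' ?_ (Eventually.of_forall (hGK m))
    exact ((((hUm m).mul dl.measurable).add ((hVm m).mul dk.measurable)).div_const 2
      ).aestronglyMeasurable
  have sG : Summable fun m ↦ ∫ x, ‖G m x‖ := by
    refine Summable.of_nonneg_of_le (fun m ↦ integral_nonneg fun x ↦ norm_nonneg _)
      (fun m ↦ ?_) (hb.mul_right (∫ x, K x))
    rw [← integral_const_mul]
    exact integral_mono (iG m).norm (iK.const_mul _) (hGK m)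
  have s1 := hasSum_integral_of_summable_integral_norm iG sG
  have e1 : ∀ x, ∑' m, G m x = ((∑' m, U m x) * partialDeriv l φ x
      + (∑' m, V m x) * partialDeriv k φ x) / 2 := fun x ↦ by
    simp only [hG]
    rw [tsum_div_const, ((sU x).mul_right _).tsum_add ((sV x).mul_right _), tsum_mul_right,
      tsum_mul_right]
  simp only [e1] at s1
  have s2 := hasSum_integral_measure
    (integrable_of_continuous_hasCompactSupport hφ.continuous hc (Measure.sum P))
  have s3 := hasSum_integral_measure
    (integrable_of_continuous_hasCompactSupport hφ.continuous hc (Measure.sum N))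
  refine s1.unique ?_
  convert s2.neg.add s3 using 1
  ext m
  exact H m φ hφ hc

end BlockSums

/-! ### The vector field made of blocks -/

section BlockField
open scoped ENNReal

variable {n : ℕ} {T : Set ℝ} {x₀ : Rn n} {c : ℝ} {i j : Fin n} {F H a : ℕ → Rn n → ℝ}

/-- The vector field with components `∑ F_m` and `∑ H_m` in the directions `i` and `j`. -/
noncomputable def blockField (i j : Fin n) (F H : ℕ → Rn n → ℝ) (x : Rn n) : Rn n :=
  (∑' m, F m x) • EuclideanSpace.single i 1 + (∑' m, H m x) • EuclideanSpace.single j 1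

theorem blockField_apply (i j : Fin n) (F H : ℕ → Rn n → ℝ) (x : Rn n) (k : Fin n) :
    blockField i j F H x k = (if k = i then 1 else 0) * (∑' m, F m x)
      + (if k = j then 1 else 0) * ∑' m, H m x := by
  simp [blockField]

theorem blockField_apply_fst (hij : i ≠ j) (F H : ℕ → Rn n → ℝ) (x : Rn n) :
    blockField i j F H x i = ∑' m, F m x := by
  simp [blockField_apply, hij]

/-- The field with components `F` and `H` in the directions `i` and `j` has a strain measure without
absolutely continuous part. -/
theorem exists_isStrainPair_block {p q : Fin n → ℝ} {C : ℝ≥0∞} {b : ℝ} {F H a : Rn n → ℝ}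
    (hij : i ≠ j) (hF : IsBoxFun T p q C b j F a) (hH : IsBoxFun T p q C b i H fun x ↦ -a x)
    (k l : Fin n) :
    ∃ P N : Measure (Rn n), IsFiniteMeasure P ∧ IsFiniteMeasure N ∧ P Set.univ ≤ C + C ∧
      N Set.univ ≤ C + C ∧ IsStrainPair T k l
        (fun x ↦ (if k = i then 1 else 0) * F x + (if k = j then 1 else 0) * H x)
        (fun x ↦ (if l = i then 1 else 0) * F x + (if l = j then 1 else 0) * H x) P N := by
  have hint : ∀ k : Fin n, Integrable fun x ↦
      (if k = i then 1 else 0) * F x + (if k = j then 1 else 0) * H x := fun k ↦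
    ((hF.integrable volume).const_mul _).add ((hH.integrable volume).const_mul _)
  have hweak : ∀ k l : Fin n, IsWeakPartial T l
      (fun x ↦ (if k = i then 1 else 0) * F x + (if k = j then 1 else 0) * H x)
      (fun x ↦ (if k = i then 1 else 0) * (if l = j then a else fun _ ↦ 0) x
        + (if k = j then 1 else 0) * (if l = i then (fun x ↦ -a x) else fun _ ↦ 0) x) (C + C) := by
    intro k l
    have h01 : ∀ m : Fin n, (0 : ℝ) ≤ if k = m then 1 else 0 := fun m ↦ by split_ifs <;> simp
    have hle : ∀ m : Fin n, ENNReal.ofReal (if k = m then 1 else 0) * C ≤ C := fun m ↦ by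
      split_ifs <;> simp
    refine (IsWeakPartial.add ((hF.weak l).const_mul (h01 i)) ((hH.weak l).const_mul (h01 j))
      ((hF.integrable volume).const_mul _) ((hH.integrable volume).const_mul _)
      ((hF.integrable_ite l).const_mul _) ((hH.integrable_ite l).const_mul _)).mono subset_rfl
      (add_le_add (hle i) (hle j))
  refine IsWeakPartial.exists_isStrainPair (hweak k l) ?_ (hint k) (hint l)
  -- The matrix of densities has `a` at `(i, j)`, `-a` at `(j, i)` and zeros elsewhere. It is
  -- antisymmetric, which is what cancellation in the strain requires.
  convert hweak l k using 2 with x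
  have := hij.symm
  by_cases h1 : k = i <;> by_cases h2 : k = j <;> by_cases h3 : l = i <;> by_cases h4 : l = j <;>
    simp_all

theorem exists_isStrainPair_blockField (hij : i ≠ j) (hF : IsBlockSeq T x₀ c j F a)
    (hH : IsBlockSeq T x₀ c i H fun m x ↦ -a m x) (k l : Fin n) :
    ∃ P N : Measure (Rn n), IsFiniteMeasure P ∧ IsFiniteMeasure N ∧
      IsStrainPair T k l (fun x ↦ blockField i j F H x k) (fun x ↦ blockField i j F H x l) P N := by
  have hb : ∀ (k : Fin n) (m : ℕ) (x : Rn n),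
      |(if k = i then 1 else 0) * F m x + (if k = j then 1 else 0) * H m x|
        ≤ (1 / 2 : ℝ) ^ m + (1 / 2) ^ m := fun k m x ↦ by
    have hle : ∀ (m' : Fin n) (y : ℝ), |(if k = m' then 1 else 0) * y| ≤ |y| := fun m' y ↦ by
      split_ifs <;> simp
    exact (abs_add_le _ _).trans (add_le_add ((hle i _).trans ((hF m).bdd x))
      ((hle j _).trans ((hH m).bdd x)))
  have hm : ∀ (k : Fin n) (m : ℕ), Measurable fun x ↦
      (if k = i then 1 else 0) * F m x + (if k = j then 1 else 0) * H m x := fun k m ↦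
    ((hF m).measurable.const_mul _).add ((hH m).measurable.const_mul _)
  have hs : ∀ (k : Fin n), (fun x ↦ blockField i j F H x k) = fun x ↦
      ∑' m, ((if k = i then 1 else 0) * F m x + (if k = j then 1 else 0) * H m x) := fun k ↦ by
    ext x
    rw [blockField_apply, ((hF.summable x).mul_left _).tsum_add ((hH.summable x).mul_left _),
      tsum_mul_left, tsum_mul_left]
  have hC : ∑' m : ℕ, (ENNReal.ofReal ((1 / 2) ^ m) + ENNReal.ofReal ((1 / 2) ^ m)) ≠ ⊤ := by
    have : ∑' m : ℕ, ENNReal.ofReal ((1 / 2) ^ m) ≠ ⊤ := summable_geometric_two.tsum_ofReal_ne_top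
    rw [ENNReal.tsum_add]
    exact ENNReal.add_ne_top.2 ⟨this, this⟩
  rw [hs k, hs l]
  exact exists_isStrainPair_tsum (summable_geometric_two.add summable_geometric_two) (hm k) (hm l)
    (hb k) (hb l) hC fun m ↦ exists_isStrainPair_block hij (hF m) (hH m) k l

theorem gridC1_blockField (hn : 2 ≤ n) (hx₀ : ∀ k, x₀ k ∈ T) (hF : IsBlockSeq T x₀ c j F a)
    (hH : IsBlockSeq T x₀ c i H fun m x ↦ -a m x) (k : Fin n) :
    GridC1 T fun x ↦ blockField i j F H x k := by
  simp only [blockField_apply]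
  exact ((gridC1_const T _).mul (hF.gridC1 hn hx₀)).add
    ((gridC1_const T _).mul (hH.gridC1 hn hx₀))

theorem norm_blockField_le (hF : IsBlockSeq T x₀ c j F a)
    (hH : IsBlockSeq T x₀ c i H fun m x ↦ -a m x) (x : Rn n) : ‖blockField i j F H x‖ ≤ 4 := by
  have h1 := hF.abs_tsum_le x
  have h2 := hH.abs_tsum_le x
  refine (norm_add_le _ _).trans ?_
  simp only [norm_smul, Real.norm_eq_abs, PiLp.norm_single, norm_one, mul_one]
  linarith

theorem measurable_blockField (hF : IsBlockSeq T x₀ c j F a)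
    (hH : IsBlockSeq T x₀ c i H fun m x ↦ -a m x) : Measurable (blockField i j F H) :=
  (hF.measurable_tsum.smul_const _).add (hH.measurable_tsum.smul_const _)

theorem blockField_eq_zero (hF : IsBlockSeq T x₀ c j F a)
    (hH : IsBlockSeq T x₀ c i H fun m x ↦ -a m x) {x : Rn n}
    (hx : ∀ m, x ∉ hbox (cubeLo x₀ c m) (cubeHi x₀ c m)) : blockField i j F H x = 0 := by
  simp [blockField, hF.tsum_eq_zero hx, hH.tsum_eq_zero hx]

/-- A field with values in a ball which is in `GBV` has components in `BV_loc`. -/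
theorem IsGBV.isBVLoc_component {Ω : Set (Rn n)} {u : Rn n → Rn n} (h : IsGBV Ω u) {M : ℝ}
    (hM : 0 < M) (hu : ∀ x, ‖u x‖ ≤ M) (k : Fin n) : IsBVLoc Ω fun x ↦ u x k := by
  -- The cutoff equals one on the ball that contains the values of `u`, so `χ(z) z_k` is an
  -- admissible `φ` with `φ ∘ u = u_k`.
  let χ : ContDiffBump (0 : Rn n) := ⟨M, M + 1, hM, by linarith⟩
  have hφ : ContDiff ℝ 1 fun z : Rn n ↦ χ z * z k :=
    χ.contDiff.mul (EuclideanSpace.proj (𝕜 := ℝ) k).contDiff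
  have hc : HasCompactSupport fun z : Rn n ↦ χ z * z k := χ.hasCompactSupport.mul_right
  have := h.2 _ hφ (hc.fderiv (𝕜 := ℝ))
  have he : (fun x ↦ χ (u x) * u x k) = fun x ↦ u x k := by
    ext x
    rw [χ.one_of_mem_closedBall (by simpa using hu x), one_mul]
  rwa [he] at this

theorem one_le_setLIntegral_obox {p q : Fin n → ℝ} {C : ℝ≥0∞} {b : ℝ} {F a : Rn n → ℝ}
    (hF : IsBoxFun T p q C b j F a) (h1 : 1 ≤ ∫ x, |a x|) : 1 ≤ ∫⁻ x in obox p q, ‖a x‖ₑ := by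
  have e1 : ∫⁻ x in obox p q, ‖a x‖ₑ = ∫⁻ x in hbox p q, ‖a x‖ₑ :=
    setLIntegral_congr ((obox_subset_hbox p q).eventuallyLE.antisymm
      (ae_le_set.2 (volume_hbox_diff_obox p q)))
  have e2 : ∫⁻ x in hbox p q, ‖a x‖ₑ = ∫⁻ x, ‖a x‖ₑ := by
    rw [← lintegral_indicator (measurableSet_hbox p q)]
    congr 1
    ext x
    by_cases hx : x ∈ hbox p q
    · simp [hx]
    · simp [hx, hF.supp' x hx]
  rw [e1, e2, ← ofReal_integral_norm_eq_lintegral_enorm (hF.integrable' volume)]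
  simpa using ENNReal.ofReal_le_ofReal h1

/-- A measure giving mass at least one to infinitely many disjoint sets is infinite. -/
theorem measure_eq_top_of_one_le {X : Type*} [MeasurableSpace X] (μ : Measure X) {O : ℕ → Set X}
    (hO : ∀ m, MeasurableSet (O m)) (hd : Pairwise (Function.onFun Disjoint O)) {S : Set X}
    (h : ∀ m, 1 ≤ μ (O m ∩ S)) : μ S = ⊤ := by
  have h1 : (μ.restrict S) (⋃ m, O m) = ⊤ := by
    rw [measure_iUnion hd hO, ← top_le_iff]
    calc (⊤ : ℝ≥0∞) = ∑' _ : ℕ, 1 := (ENNReal.tsum_const_eq_top_of_ne_zero one_ne_zero).symm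
      _ ≤ _ := ENNReal.tsum_le_tsum fun m ↦ by rw [Measure.restrict_apply (hO m)]; exact h m
  rw [← top_le_iff, ← h1]
  exact (measure_mono (Set.subset_univ _)).trans (by simp)

end BlockField

/-! ### Assembly of the counterexample -/

section Construction
open scoped ENNReal

variable {n : ℕ} {T : Set ℝ} {x₀ : Rn n} {c : ℝ} {i j : Fin n} {F H a : ℕ → Rn n → ℝ}

/-- Building blocks in the dyadic cubes, with a large rotation in the cubes of even index and a large
jump set in the cubes of odd index. -/
theorem exists_blockSeq (x₀ : Rn n) (hc : 0 < c) (hij : i ≠ j) :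
    ∃ (T : Set ℝ) (F H a : ℕ → Rn n → ℝ) (J : ℕ → Set (Rn n)), (∀ k, x₀ k ∈ T) ∧ T.Countable ∧
      IsBlockSeq T x₀ c j F a ∧ IsBlockSeq T x₀ c i H (fun m x ↦ -a m x) ∧
      (∀ m, 1 ≤ ∫ x, |a (2 * m) x|) ∧
      (∀ m, 1 ≤ Measure.euclideanHausdorffMeasure (n - 1) (J m) ∧
        ∀ x ∈ J m, x ∈ obox (cubeLo x₀ c (2 * m + 1)) (cubeHi x₀ c (2 * m + 1)) ∧
          ∃ α β : ℝ, α ≠ β ∧ (∀ᶠ y in 𝓝 x, x i < y i → F (2 * m + 1) y = α) ∧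
            ∀ᶠ y in 𝓝 x, y i < x i → F (2 * m + 1) y = β) ∧
      ∀ m x, H (2 * m + 1) x = 0 := by
  have hpq := fun m : ℕ ↦ cubeLo_lt_cubeHi (x₀ := x₀) hc m
  have hε := fun m : ℕ ↦ pow_pos (by norm_num : (0 : ℝ) < 1 / 2) m
  choose T₁ F₁ H₁ a₁ hF₁ hH₁ ha₁ using fun m ↦ exists_large_rotation hij (hpq m) (hε m)
  choose T₂ F₂ J₂ hF₂ hJ₂ hx₂ using fun m ↦ exists_many_jumps hij (hpq m) (hε m)
  -- One countable grid serves all blocks. The coordinates of `x₀` are added so that the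
  -- accumulation point of the cubes is excluded from the regularity condition.
  set T : Set ℝ := (⋃ m, T₁ m ∪ T₂ m) ∪ Set.range x₀
  have hT : T.Countable :=
    (Set.countable_iUnion fun m ↦ (hF₁ m).countable.union (hF₂ m).countable).union
      (Set.countable_range _)
  have s1 : ∀ m, T₁ m ⊆ T := fun m t ht ↦ Or.inl (Set.mem_iUnion.2 ⟨m, Or.inl ht⟩)
  have s2 : ∀ m, T₂ m ⊆ T := fun m t ht ↦ Or.inl (Set.mem_iUnion.2 ⟨m, Or.inr ht⟩)
  refine ⟨T, fun m ↦ if Even m then F₁ m else F₂ m, fun m ↦ if Even m then H₁ m else fun _ ↦ 0,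
    fun m ↦ if Even m then a₁ m else fun _ ↦ 0, fun m ↦ J₂ (2 * m + 1), fun k ↦ Or.inr ⟨k, rfl⟩, hT,
    fun m ↦ ?_, fun m ↦ ?_, fun m ↦ ?_, fun m ↦ ⟨hJ₂ _, fun x hx ↦ ?_⟩, fun m x ↦ ?_⟩
  · dsimp only
    split_ifs
    · exact (hF₁ m).mono (s1 m) hT le_rfl le_rfl
    · exact (hF₂ m).mono (s2 m) hT le_rfl le_rfl
  · dsimp only
    split_ifs
    · exact (hH₁ m).mono (s1 m) hT le_rfl le_rfl
    · simpa using (IsBoxFun.zero (cubeLo x₀ c m) (cubeHi x₀ c m) i).mono (Set.empty_subset T) hT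
        zero_le (hε m).le
  · simpa using ha₁ (2 * m)
  · simpa [obox] using hx₂ _ x hx
  · simp

theorem obox_subset_ball {R : ℝ} (hR : 0 < R) (m : ℕ) :
    obox (cubeLo x₀ (R / (n + 1)) m) (cubeHi x₀ (R / (n + 1)) m) ⊆ Metric.ball x₀ R :=
  (obox_subset_hbox _ _).trans fun _ hx ↦ mem_ball_of_mem_cube hR hx

theorem pairwise_disjoint_obox (hc : 0 < c) (i : Fin n) {s : ℕ → ℕ} (hs : s.Injective) :
    Pairwise (Function.onFun Disjoint fun m ↦
      obox (cubeLo x₀ c (s m)) (cubeHi x₀ c (s m))) := fun _ _ hne ↦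
  Set.disjoint_left.2 fun _ hx hx' ↦ hne
    (hs (eq_of_mem_cubes hc i (obox_subset_hbox _ _ hx) (obox_subset_hbox _ _ hx')))

/-- If `u` were in `GBV`, the component `u_i` would have a finite derivative measure on the ball.
But in each even cube the variation of its `j`-th part is at least `∫ |a| ≥ 1`, and there are
infinitely many disjoint cubes. -/
theorem not_isGBV_blockField {Ω : Set (Rn n)} {R : ℝ} (hR : 0 < R)
    (hΩ : Metric.closedBall x₀ R ⊆ Ω) (hij : i ≠ j) (hT : T.Countable)
    (hF : IsBlockSeq T x₀ (R / (n + 1)) j F a)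
    (hH : IsBlockSeq T x₀ (R / (n + 1)) i H fun m x ↦ -a m x)
    (ha : ∀ m, 1 ≤ ∫ x, |a (2 * m) x|) : ¬ IsGBV Ω (blockField i j F H) := by
  intro hG
  have hc : 0 < R / (n + 1) := by positivity
  have hcl : closure (Metric.ball x₀ R) ⊆ Metric.closedBall x₀ R := Metric.closure_ball_subset_closedBall
  obtain ⟨-, D, hD⟩ := hG.isBVLoc_component (M := 4) (by norm_num) (norm_blockField_le hF hH) i
    (Metric.ball x₀ R) Metric.isOpen_ball
    ((isCompact_closedBall x₀ R).of_isClosed_subset isClosed_closure hcl) (hcl.trans hΩ)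
  have key : ∀ m, 1 ≤ (D j).totalVariation
      (obox (cubeLo x₀ (R / (n + 1)) (2 * m)) (cubeHi x₀ (R / (n + 1)) (2 * m))) := fun m ↦ by
    refine (one_le_setLIntegral_obox (hF (2 * m)) (ha m)).trans ?_
    obtain ⟨P, N, _, _, -, -, hP, hN, hw⟩ := (hF (2 * m)).weak j
    refine setLIntegral_enorm_le_totalVariation (isOpen_obox _ _) hT (D j) hP hN
      (hF (2 * m)).measurable' ((hF (2 * m)).integrable' _) fun φ hφ ↦ ?_
    have h1 := hD φ ⟨hφ.smooth, hφ.compact, hφ.support.trans (obox_subset_ball hR _)⟩ j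
    have h2 := hw φ (hφ.smooth.of_le (by simp)) hφ.compact
    have hz : ∀ x, x ∉ obox (cubeLo x₀ (R / (n + 1)) (2 * m)) (cubeHi x₀ (R / (n + 1)) (2 * m)) →
        partialDeriv j φ x = 0 := fun x hx ↦ by
      have : fderiv ℝ φ x = 0 := by
        by_contra hne
        exact hx (hφ.support (support_fderiv_subset ℝ hne))
      simp [partialDeriv, this]
    rw [setIntegral_eq_integral_of_forall_compl_eq_zero fun x hx ↦ by
      rw [hz x fun hx' ↦ hx (obox_subset_ball hR _ hx'), mul_zero]] at h1
    -- The test function lives in one open cube, where the infinite sum reduces to a single block.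
    have h3 : ∫ x, blockField i j F H x i * partialDeriv j φ x
        = ∫ x, F (2 * m) x * partialDeriv j φ x := by
      congr 1
      ext x
      by_cases hx : x ∈ obox (cubeLo x₀ (R / (n + 1)) (2 * m)) (cubeHi x₀ (R / (n + 1)) (2 * m))
      · rw [blockField_apply_fst hij, hF.tsum_eq_of_mem hc (obox_subset_hbox _ _ hx)]
      · simp [hz x hx]
    rw [h3, h2] at h1
    simp only [if_true] at h1
    linarith
  have htop := measure_eq_top_of_one_le (D j).totalVariation (S := Set.univ)
    (fun m ↦ (isOpen_obox _ _).measurableSet)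
    (pairwise_disjoint_obox (x₀ := x₀) hc i (s := fun m ↦ 2 * m) fun m m' h ↦ by simpa using h)
    (fun m ↦ by simpa using key m)
  exact measure_ne_top _ _ htop

/-- Off the null grid the entry `∂_j u_i` of the gradient is `a` in each even cube, so each of these
disjoint cubes contributes at least one. -/
theorem lintegral_fderiv_blockField {Ω : Set (Rn n)} {R : ℝ} (hR : 0 < R)
    (hΩ : Metric.closedBall x₀ R ⊆ Ω) (hn : 2 ≤ n) (hij : i ≠ j) (hx₀ : ∀ k, x₀ k ∈ T)
    (hT : T.Countable) (hF : IsBlockSeq T x₀ (R / (n + 1)) j F a)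
    (hH : IsBlockSeq T x₀ (R / (n + 1)) i H fun m x ↦ -a m x)
    (ha : ∀ m, 1 ≤ ∫ x, |a (2 * m) x|) : ∫⁻ x in Ω, ‖fderiv ℝ (blockField i j F H) x‖ₑ = ⊤ := by
  have hc : 0 < R / (n + 1) := by positivity
  set μ := volume.withDensity fun x ↦ ‖fderiv ℝ (blockField i j F H) x‖ₑ with hμ
  have hO : ∀ m, MeasurableSet (obox (cubeLo x₀ (R / (n + 1)) m) (cubeHi x₀ (R / (n + 1)) m)) :=
    fun m ↦ (isOpen_obox _ _).measurableSet
  have htop : μ (⋃ m, obox (cubeLo x₀ (R / (n + 1)) (2 * m)) (cubeHi x₀ (R / (n + 1)) (2 * m)))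
      = ⊤ := by
    refine measure_eq_top_of_one_le μ (fun m ↦ hO (2 * m))
      (pairwise_disjoint_obox (x₀ := x₀) hc i (s := fun m ↦ 2 * m) fun m m' h ↦ by simpa using h)
      fun m ↦ ?_
    rw [Set.inter_eq_self_of_subset_left (Set.subset_iUnion (fun m ↦
        obox (cubeLo x₀ (R / (n + 1)) (2 * m)) (cubeHi x₀ (R / (n + 1)) (2 * m))) m),
      withDensity_apply _ (hO _)]
    refine (one_le_setLIntegral_obox (hF (2 * m)) (ha m)).trans
      (lintegral_mono_ae ((ae_restrict_iff' (hO _)).2 ?_))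
    have : ∀ᵐ x : Rn n, x ∉ grid n T := by
      rw [ae_iff]; simpa using volume_grid hT
    filter_upwards [this] with x hx hxO
    refine enorm_partial_le_enorm_fderiv
      (differentiableAt_of_gridC1 (gridC1_blockField hn hx₀ hF hH) hx) i j ?_
    simp only [blockField_apply_fst hij]
    exact hF.hasPartialAt hc hxO fun hjT ↦ hx ⟨j, hjT⟩
  rw [withDensity_apply _ (MeasurableSet.iUnion fun m ↦ hO _)] at htop
  rw [← top_le_iff, ← htop]
  exact lintegral_mono_set (Set.iUnion_subset fun m ↦ (obox_subset_ball hR _).trans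
    (Metric.ball_subset_closedBall.trans hΩ))

/-- Each odd cube contains jumps of area at least one. There `H` vanishes, so `u` is locally
constant on each side of the face, and the distinct values of `F` give distinct traces. -/
theorem hausdorffMeasure_jumpSet_blockField {Ω : Set (Rn n)} {R : ℝ} (hR : 0 < R)
    (hΩ : Metric.closedBall x₀ R ⊆ Ω)
    (hF : IsBlockSeq T x₀ (R / (n + 1)) j F a)
    (hH : IsBlockSeq T x₀ (R / (n + 1)) i H fun m x ↦ -a m x) {J : ℕ → Set (Rn n)}
    (hJ : ∀ m, 1 ≤ Measure.euclideanHausdorffMeasure (n - 1) (J m) ∧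
        ∀ x ∈ J m, x ∈ obox (cubeLo x₀ (R / (n + 1)) (2 * m + 1))
          (cubeHi x₀ (R / (n + 1)) (2 * m + 1)) ∧
          ∃ α β : ℝ, α ≠ β ∧ (∀ᶠ y in 𝓝 x, x i < y i → F (2 * m + 1) y = α) ∧
            ∀ᶠ y in 𝓝 x, y i < x i → F (2 * m + 1) y = β)
    (hH0 : ∀ m x, H (2 * m + 1) x = 0) :
    Measure.euclideanHausdorffMeasure (n - 1) (jumpSet Ω (blockField i j F H)) = ⊤ := by
  have hc : 0 < R / (n + 1) := by positivity
  refine measure_eq_top_of_one_le _ (fun m ↦ (isOpen_obox _ _).measurableSet)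
    (pairwise_disjoint_obox (x₀ := x₀) hc i (s := fun m ↦ 2 * m + 1) fun m m' h ↦ by simpa using h)
    fun m ↦ (hJ m).1.trans (measure_mono fun x hx ↦ ?_)
  obtain ⟨hxO, α, β, hne, h1, h2⟩ := (hJ m).2 x hx
  have hu : ∀ᶠ y in 𝓝 x, blockField i j F H y = F (2 * m + 1) y • EuclideanSpace.single i 1 := by
    filter_upwards [hF.eventually_tsum_eq hc hxO, hH.eventually_tsum_eq hc hxO] with y e1 e2
    rw [blockField, e1, e2, hH0, zero_smul, add_zero]
  refine ⟨hxO, mem_jumpSet_of_eventually_eq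
    (hΩ (Metric.ball_subset_closedBall (obox_subset_ball hR _ hxO))) i
    (f := fun _ ↦ α • EuclideanSpace.single i 1) (g := fun _ ↦ β • EuclideanSpace.single i 1)
    continuousAt_const continuousAt_const (fun he ↦ hne ?_) ?_ ?_⟩
  · simpa using congrArg (fun v : Rn n ↦ v i) he
  · filter_upwards [hu, h1] with y e1 e2 hy
    rw [e1, e2 hy]
  · filter_upwards [hu, h2] with y e1 e2 hy
    rw [e1, e2 hy]

end Construction

theorem theorem3p1 (n : ℕ) (hn : 2 ≤ n) (Ω : Set (Rn n)) (hΩ : IsOpen Ω) (hne : Ω.Nonempty) :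
    ∃ (u : Rn n → Rn n) (E : Fin n → Fin n → SignedMeasure (Rn n))
      (G : Rn n → Rn n →L[ℝ] Rn n),
      IsSBD Ω u E ∧
      MemLp u ⊤ (volume.restrict Ω) ∧
      (∀ᵐ x ∂volume.restrict Ω, strainDensity E x = 0) ∧
      Measure.euclideanHausdorffMeasure (n - 1) (jumpSet Ω u) = ⊤ ∧
      (IsApproxGradient Ω u G ∧ AEStronglyMeasurable G (volume.restrict Ω) ∧
        ∫⁻ x in Ω, ‖G x‖ₑ = ⊤) ∧
      ¬ IsGBV Ω u := by
  obtain ⟨x₀, hx₀⟩ := hne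
  obtain ⟨R, hR, hball⟩ := Metric.nhds_basis_closedBall.mem_iff.1 (hΩ.mem_nhds hx₀)
  have hc : 0 < R / (n + 1) := by positivity
  obtain ⟨i, j, hij⟩ : ∃ i j : Fin n, i ≠ j :=
    ⟨⟨0, by omega⟩, ⟨1, by omega⟩, by simp⟩
  obtain ⟨T, F, H, a, J, hT₀, hT, hF, hH, ha, hJ, hH0⟩ := exists_blockSeq x₀ hc hij
  set u := blockField i j F H with hu
  have hu0 : ∀ x, x ∉ Metric.ball x₀ R → u x = 0 := fun x hx ↦
    blockField_eq_zero hF hH fun m hm ↦ hx (mem_ball_of_mem_cube hR hm)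
  have hu0' : ∀ x, x ∉ Ω → u x = 0 := fun x hx ↦
    hu0 x fun hx' ↦ hx (hball (Metric.ball_subset_closedBall hx'))
  have hum : Measurable u := measurable_blockField hF hH
  have hub : ∀ x, ‖u x‖ ≤ 4 := norm_blockField_le hF hH
  have hgrid : ∀ k, GridC1 T fun x ↦ u x k := gridC1_blockField hn hT₀ hF hH
  choose P N hPf hNf hP hN hE using exists_isStrainPair_blockField hij hF hH
  -- The measures `P` and `N` come from the whole space; restriction to `Ω` makes the strain measure
  -- concentrated on `Ω` and is invisible to test functions supported there.
  set E : Fin n → Fin n → SignedMeasure (Rn n) := fun k l ↦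
    ((P k l).restrict Ω).toSignedMeasure - ((N k l).restrict Ω).toSignedMeasure
  have hac : ∀ {Q : Measure (Rn n)}, FaceAC T Q → FaceAC T (Q.restrict Ω) := fun hQ S hS h0 ↦
    Measure.absolutelyContinuous_of_le Measure.restrict_le_self (hQ S hS h0)
  have htest : ∀ k l φ, IsTestFunction Ω φ →
      ∫ x, (u x k * partialDeriv l φ x + u x l * partialDeriv k φ x) / 2
        = -(∫ x in Ω, φ x ∂(P k l)) + ∫ x in Ω, φ x ∂(N k l) := fun k l φ hφ ↦ by
    have hz : ∀ x, x ∉ Ω → φ x = 0 := fun x hx ↦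
      image_eq_zero_of_notMem_tsupport fun hx' ↦ hx (hφ.support hx')
    rw [setIntegral_eq_integral_of_forall_compl_eq_zero hz,
      setIntegral_eq_integral_of_forall_compl_eq_zero hz]
    exact hE k l φ (hφ.smooth.of_le (by simp)) hφ.compact
  -- The strain lives on the Lebesgue null grid, so its density vanishes and it equals its singular
  -- part.
  have hconc : ∀ k l, (E k l).totalVariation (grid n T)ᶜ = 0 := fun k l ↦
    totalVariation_sub_eq_zero _ _ (measurableSet_grid hT).compl fun S' hS' _ ↦ by
      rw [measure_mono_null hS' ((hac (hP k l)).compl_grid hT),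
        measure_mono_null hS' ((hac (hN k l)).compl_grid hT)]
  have hsing := fun k l ↦ rnDeriv_eq_zero_of_concentrated (E k l) volume
    (measurableSet_grid hT) (hconc k l) (volume_grid hT)
  refine ⟨u, E, fderiv ℝ u, ⟨⟨?_, ?_, ?_⟩, ?_⟩, ?_, ?_, ?_, ⟨?_, ?_, ?_⟩, ?_⟩
  · have hi : IntegrableOn u (Metric.ball x₀ R) :=
      Measure.integrableOn_of_bounded measure_ball_lt_top.ne hum.aestronglyMeasurable
        (Eventually.of_forall hub)
    exact (integrableOn_iff_integrable_of_support_subset fun x hx ↦ by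
      by_contra hx'; exact hx (hu0 x hx')).1 hi |>.integrableOn
  · exact fun k l ↦ totalVariation_sub_eq_zero _ _ hΩ.measurableSet.compl fun S' hS' hm ↦ by
      have h0 : ∀ Q : Measure (Rn n), Q.restrict Ω S' = 0 := fun Q ↦ by
        rw [Measure.restrict_apply hm]
        have : S' ∩ Ω = ∅ := Set.disjoint_iff_inter_eq_empty.1
          (Set.disjoint_left.2 fun x hx ↦ hS' hx)
        simp [this]
      rw [h0, h0]
  · intro φ hφ k l
    rw [setIntegral_eq_integral_of_forall_compl_eq_zero fun x hx ↦ by simp [hu0' x hx],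
      htest k l φ hφ, integral_toSignedMeasure_sub _ _ (hφ.integrable _) (hφ.integrable _)]
    ring
  · intro k l
    rw [strainSingularPart, (hsing k l).2]
    exact totalVariation_diff_jumpSet_eq_zero hΩ hT hgrid k l (hac (hP k l)) (hac (hN k l))
      (htest k l)
  · exact memLp_top_of_bound hum.aestronglyMeasurable 4 (Eventually.of_forall hub)
  · refine ae_restrict_of_ae ?_
    have : ∀ᵐ x, ∀ k l, (E k l).rnDeriv volume x = 0 :=
      ae_all_iff.2 fun k ↦ ae_all_iff.2 fun l ↦ (hsing k l).1
    filter_upwards [this] with x hx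
    ext k l
    exact hx k l
  · exact hausdorffMeasure_jumpSet_blockField hR hball hF hH hJ hH0
  · exact isApproxGradient_fderiv hT hgrid Ω
  · exact (measurable_fderiv ℝ u).aestronglyMeasurable
  · exact lintegral_fderiv_blockField hR hball hn hij hT₀ hT hF hH ha
  · exact not_isGBV_blockField hR hball hij hT hF hH ha
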